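/- Let $K$ be a field and let $H$ be a bialgebra over $K$. Write $\Delta(c)=c_1\otimes c_2$ for comultiplications and $\varepsilon$ for counits. Let $A$ be a $K$-vector space that is both an algebra and a coalgebra (no compatibility assumed) with $\varepsilon_A(1_A)=1$, together with a left $H$-action $x\otimes a\mapsto x\triangleright a$ making the algebra $A$ a left $H$-module algebra and a left $H$-coaction $a\mapsto a_{-1}\otimes a_0\in H\otimes A$ making the coalgebra $A$ a left $H$-comodule coalgebra. Let $B$ be a $K$-vector space that is both an algebra and a coalgebra with $\varepsilon_B(1_B)=1$, together with a right $H$-action $b\otimes x\mapsto b\triangleleft x$ making $B$ a right $H$-module algebra and a right $H$-coaction $b\mapsto b_{[0]}\otimes b_{[1]}\in B\otimes H$ making $B$ a right $H$-comodule coalgebra. On $A\otimes H\otimes B$ consider the two-sided smash product $A\#H\#B$, with unit $1_A\otimes 1_H\otimes 1_B$ and $$(a\otimes x\otimes b)(a'\otimes x'\otimes b')=a(x_1\triangleright a')\otimes x_2x'_1\otimes (b\triangleleft x'_2)b',$$ and the two-sided smash coproduct $A\times H\times B$, with counit $\varepsilon(a\otimes x\otimes b)=\varepsilon_A(a)\varepsilon_H(x)\varepsilon_B(b)$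 and $$\Delta(a\otimes x\otimes b)=(a_1\otimes a_{2\,-1}x_1\otimes b_{1[0]})\otimes(a_{2\,0}\otimes x_2b_{1[1]}\otimes b_2).$$ Then $A\otimes H\otimes B$ with these structures is a bialgebra if and only if the following hold for all $a,a'\in A$, $b,b'\in B$, $x\in H$: - (C1) $\varepsilon_A$ and $\varepsilon_B$ are algebra maps; - (C2) $\Delta_A(1_A)=1_A\otimes 1_A$ and $\Delta_B(1_B)=1_B\otimes 1_B$; - (C3) $(1_A)_{-1}\otimes (1_A)_0=1_H\otimes 1_A$ and $(1_B)_{[0]}\otimes (1_B)_{[1]}=1_B\otimes 1_H$; - (C4) $\varepsilon_A(x\triangleright a)=\varepsilon_A(a)\varepsilon_H(x)$ and $\varepsilon_B(b\triangleleft x)=\varepsilon_B(b)\varepsilon_H(x)$; - (D8) $(aa')_{-1}\otimes(aa')_0=a_{-1}a'_{-1}\otimes a_0a'_0$; - (D10) $(bb')_{[0]}\otimes(bb')_{[1]}=b_{[0]}b'_{[0]}\otimes b_{[1]}b'_{[1]}$; - (D16) $(x_1\triangleright a)_{-1}x_2\otimes(x_1\triangleright a)_0=x_1a_{-1}\otimes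 x_2\triangleright a_0$; - (D17) $(b\triangleleft x_2)_{[0]}\otimes x_1(b\triangleleft x_2)_{[1]}=b_{[0]}\triangleleft x_1\otimes b_{[1]}x_2$; - (D21) $b_{[1]}\triangleright a_0\otimes b_{[0]}\triangleleft a_{-1}=a\otimes b$; - (F1) $(aa')_1\otimes(aa')_2=a_1(a_{2\,-1}\triangleright a'_1)\otimes a_{2\,0}a'_2$; - (F2) $(bb')_1\otimes(bb')_2=b_1b'_{1[0]}\otimes(b_2\triangleleft b'_{1[1]})b'_2$; - (F3) $(x\triangleright a)_1\otimes(x\triangleright a)_2=(x_1\triangleright a_1)\otimes(x_2\triangleright a_2)$; - (F4) $(b\triangleleft x)_1\otimes(b\triangleleft x)_2=(b_1\triangleleft x_1)\otimes(b_2\triangleleft x_2)$. In particular, if with these structures $A$ is a bialgebra in the category ${}^H_H\mathbb{YD}$ of left-left Yetter–Drinfeld modules and $B$ is a bialgebra in the category $\mathbb{YD}{}^H_H$ of right-right Yetter–Drinfeld modules (Majid's double biproduct setting), then $A\#H\#B$ with the coproduct of $A\times H\times B$ is a bialgebra if and only if Majid's condition (D21) holds: the condition is necessary as well as sufficient. 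-/

import Mathlib

open scoped TensorProduct

noncomputable section

namespace DoubleBiproduct

universe u v

/-! ## Structures on `A` and `B` over a bialgebra `H`

A left action of `H` on `A` is given by a bilinear map `act`, with `act x a = x ▷ a`; a right action
of `H` on `B` by a bilinear map `ract`, with `ract b x = b ◁ x`. A left coaction is a linear map
`ρ : A → H ⊗ A`, `ρ a = a₋₁ ⊗ a₀`, and a right coaction is a linear map `ψ : B → B ⊗ H`,
`ψ b = b₍₀₎ ⊗ b₍₁₎`. -/

/-- `A` is a left `H`-module algebra (an algebra with a left `H`-action). -/
structure IsLeftModuleAlgebra {K H A : Type*} [Field K] [Ring H] [Bialgebra K H]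
    [Ring A] [Algebra K A] (act : H →ₗ[K] A →ₗ[K] A) : Prop where
  one_act : ∀ a : A, act 1 a = a
  mul_act : ∀ (x y : H) (a : A), act (x * y) a = act x (act y a)
  /-- `x ▷ 1 = ε(x) 1` -/
  act_one : ∀ x : H, act x 1 = (Coalgebra.counit x : K) • (1 : A)
  /-- `x ▷ (a a') = (x₁ ▷ a) (x₂ ▷ a')` -/
  act_mul : ∀ (x : H) (a a' : A), act x (a * a') =
    LinearMap.mul' K A (TensorProduct.map (act.flip a) (act.flip a') (Coalgebra.comul x))

/-- `B` is a right `H`-module algebra (an algebra with a right `H`-action). -/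
structure IsRightModuleAlgebra {K H B : Type*} [Field K] [Ring H] [Bialgebra K H]
    [Ring B] [Algebra K B] (ract : B →ₗ[K] H →ₗ[K] B) : Prop where
  act_one : ∀ b : B, ract b 1 = b
  act_mul : ∀ (b : B) (x y : H), ract b (x * y) = ract (ract b x) y
  /-- `1 ◁ x = ε(x) 1` -/
  one_act : ∀ x : H, ract 1 x = (Coalgebra.counit x : K) • (1 : B)
  /-- `(b b') ◁ x = (b ◁ x₁) (b' ◁ x₂)` -/
  mul_act : ∀ (b b' : B) (x : H), ract (b * b') x =
    LinearMap.mul' K B (TensorProduct.map (ract b) (ract b') (Coalgebra.comul x))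

/-- `A` is a left `H`-comodule coalgebra. -/
structure IsLeftComoduleCoalgebra {K H A : Type*} [Field K] [Ring H] [Bialgebra K H]
    [AddCommGroup A] [Module K A] [Coalgebra K A] (ρ : A →ₗ[K] H ⊗[K] A) : Prop where
  /-- `a₋₁ ⊗ (a₀)₋₁ ⊗ (a₀)₀ = (a₋₁)₁ ⊗ (a₋₁)₂ ⊗ a₀` -/
  coassoc : ∀ a : A, ρ.lTensor H (ρ a) =
    TensorProduct.assoc K H H A ((Coalgebra.comul (R := K) (A := H)).rTensor A (ρ a))
  /-- `ε(a₋₁) a₀ = a` -/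
  counit_coact : ∀ a : A,
    TensorProduct.lid K A ((Coalgebra.counit (R := K) (A := H)).rTensor A (ρ a)) = a
  /-- `a₋₁ ⊗ (a₀)₁ ⊗ (a₀)₂ = (a₁)₋₁ (a₂)₋₁ ⊗ (a₁)₀ ⊗ (a₂)₀` -/
  coact_comul : ∀ a : A, (Coalgebra.comul (R := K) (A := A)).lTensor H (ρ a) =
    (LinearMap.mul' K H).rTensor (A ⊗[K] A) (TensorProduct.tensorTensorTensorComm K H A H A
      (TensorProduct.map ρ ρ (Coalgebra.comul a)))
  /-- `a₋₁ ε(a₀) = ε(a) 1` -/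
  coact_counit : ∀ a : A,
    TensorProduct.rid K H ((Coalgebra.counit (R := K) (A := A)).lTensor H (ρ a)) =
      (Coalgebra.counit a : K) • (1 : H)

/-- `B` is a right `H`-comodule coalgebra. -/
structure IsRightComoduleCoalgebra {K H B : Type*} [Field K] [Ring H] [Bialgebra K H]
    [AddCommGroup B] [Module K B] [Coalgebra K B] (ψ : B →ₗ[K] B ⊗[K] H) : Prop where
  /-- `(b₍₀₎)₍₀₎ ⊗ (b₍₀₎)₍₁₎ ⊗ b₍₁₎ = b₍₀₎ ⊗ (b₍₁₎)₁ ⊗ (b₍₁₎)₂` -/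
  coassoc : ∀ b : B, TensorProduct.assoc K B H H (ψ.rTensor H (ψ b)) =
    (Coalgebra.comul (R := K) (A := H)).lTensor B (ψ b)
  /-- `b₍₀₎ ε(b₍₁₎) = b` -/
  counit_coact : ∀ b : B,
    TensorProduct.rid K B ((Coalgebra.counit (R := K) (A := H)).lTensor B (ψ b)) = b
  /-- `(b₍₀₎)₁ ⊗ (b₍₀₎)₂ ⊗ b₍₁₎ = (b₁)₍₀₎ ⊗ (b₂)₍₀₎ ⊗ (b₁)₍₁₎ (b₂)₍₁₎` -/
  coact_comul : ∀ b : B, (Coalgebra.comul (R := K) (A := B)).rTensor H (ψ b) =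
    (LinearMap.mul' K H).lTensor (B ⊗[K] B) (TensorProduct.tensorTensorTensorComm K B H B H
      (TensorProduct.map ψ ψ (Coalgebra.comul b)))
  /-- `ε(b₍₀₎) b₍₁₎ = ε(b) 1` -/
  coact_counit : ∀ b : B,
    TensorProduct.lid K H ((Coalgebra.counit (R := K) (A := B)).rTensor H (ψ b)) =
      (Coalgebra.counit b : K) • (1 : H)

/-! ## The two-sided smash product and the two-sided smash coproduct -/

section Smash

variable {K H A B : Type*} [Field K] [Ring H] [Bialgebra K H]

/-- `(a ⊗ x) ⊗ (y ⊗ b) ↦ a ⊗ (x y ⊗ b)` -/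
def mergeH (K H A B : Type*) [Field K] [Ring H] [Bialgebra K H] [AddCommGroup A] [Module K A]
    [AddCommGroup B] [Module K B] : (A ⊗[K] H) ⊗[K] (H ⊗[K] B) →ₗ[K] A ⊗[K] (H ⊗[K] B) :=
  ((LinearMap.mul' K H).rTensor B ∘ₗ (TensorProduct.assoc K H H B).symm.toLinearMap).lTensor A ∘ₗ
    (TensorProduct.assoc K A H (H ⊗[K] B)).toLinearMap

/-- `x ⊗ a ↦ (x₁ ▷ a) ⊗ x₂` -/
def crossLeft [AddCommGroup A] [Module K A] (act : H →ₗ[K] A →ₗ[K] A) : H ⊗[K] A →ₗ[K] A ⊗[K] H :=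
  (TensorProduct.lift act).rTensor H ∘ₗ (TensorProduct.assoc K H A H).symm.toLinearMap ∘ₗ
    (TensorProduct.comm K H A).toLinearMap.lTensor H ∘ₗ (TensorProduct.assoc K H H A).toLinearMap ∘ₗ
    (Coalgebra.comul (R := K) (A := H)).rTensor A

/-- `b ⊗ x ↦ x₁ ⊗ (b ◁ x₂)` -/
def crossRight [AddCommGroup B] [Module K B] (ract : B →ₗ[K] H →ₗ[K] B) :
    B ⊗[K] H →ₗ[K] H ⊗[K] B :=
  (TensorProduct.lift ract).lTensor H ∘ₗ (TensorProduct.assoc K H B H).toLinearMap ∘ₗ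
    (TensorProduct.comm K B H).toLinearMap.rTensor H ∘ₗ
    (TensorProduct.assoc K B H H).symm.toLinearMap ∘ₗ (Coalgebra.comul (R := K) (A := H)).lTensor B

/-- The multiplication of the two-sided smash product `A # H # B`:
`(a ⊗ x ⊗ b) (a' ⊗ x' ⊗ b') = a (x₁ ▷ a') ⊗ x₂ x'₁ ⊗ (b ◁ x'₂) b'`. -/
def smashMul [Ring A] [Algebra K A] [Ring B] [Algebra K B]
    (act : H →ₗ[K] A →ₗ[K] A) (ract : B →ₗ[K] H →ₗ[K] B) :
    (A ⊗[K] (H ⊗[K] B)) ⊗[K] (A ⊗[K] (H ⊗[K] B)) →ₗ[K] A ⊗[K] (H ⊗[K] B) :=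
  (LinearMap.mul' K A).rTensor (H ⊗[K] B) ∘ₗ
    (TensorProduct.assoc K A A (H ⊗[K] B)).symm.toLinearMap ∘ₗ
    (mergeH K H A B ∘ₗ
      TensorProduct.map (crossLeft act)
        ((LinearMap.mul' K B).lTensor H ∘ₗ (TensorProduct.assoc K H B B).toLinearMap ∘ₗ
          (crossRight ract).rTensor B ∘ₗ (TensorProduct.assoc K B H B).symm.toLinearMap) ∘ₗ
      (TensorProduct.tensorTensorTensorComm K H B A (H ⊗[K] B)).toLinearMap).lTensor A ∘ₗ
    (TensorProduct.assoc K A (H ⊗[K] B) (A ⊗[K] (H ⊗[K] B))).toLinearMap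

/-- The comultiplication of the two-sided smash coproduct `A × H × B`:
`Δ(a ⊗ x ⊗ b) = (a₁ ⊗ (a₂)₋₁ x₁ ⊗ (b₁)₍₀₎) ⊗ ((a₂)₀ ⊗ x₂ (b₁)₍₁₎ ⊗ b₂)`. -/
def smashComul [AddCommGroup A] [Module K A] [Coalgebra K A] [AddCommGroup B] [Module K B]
    [Coalgebra K B] (ρ : A →ₗ[K] H ⊗[K] A) (ψ : B →ₗ[K] B ⊗[K] H) :
    A ⊗[K] (H ⊗[K] B) →ₗ[K] (A ⊗[K] (H ⊗[K] B)) ⊗[K] (A ⊗[K] (H ⊗[K] B)) :=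
  TensorProduct.map (mergeH K H A B)
      (((LinearMap.mul' K H).rTensor B ∘ₗ
        (TensorProduct.assoc K H H B).symm.toLinearMap).lTensor A) ∘ₗ
    (TensorProduct.tensorTensorTensorComm K (A ⊗[K] H) A (H ⊗[K] B)
      (H ⊗[K] (H ⊗[K] B))).toLinearMap ∘ₗ
    TensorProduct.map
      ((TensorProduct.assoc K A H A).symm.toLinearMap ∘ₗ ρ.lTensor A ∘ₗ Coalgebra.comul)
      ((TensorProduct.tensorTensorTensorComm K H H B (H ⊗[K] B)).toLinearMap ∘ₗ
        TensorProduct.map Coalgebra.comul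
          ((TensorProduct.assoc K B H B).toLinearMap ∘ₗ ψ.rTensor B ∘ₗ Coalgebra.comul))

/-- The counit of the two-sided smash coproduct: `ε(a ⊗ x ⊗ b) = ε(a) ε(x) ε(b)`. -/
def smashCounit (K H A B : Type*) [Field K] [Ring H] [Bialgebra K H] [AddCommGroup A] [Module K A]
    [Coalgebra K A] [AddCommGroup B] [Module K B] [Coalgebra K B] : A ⊗[K] (H ⊗[K] B) →ₗ[K] K :=
  LinearMap.mul' K K ∘ₗ TensorProduct.map Coalgebra.counit
    (LinearMap.mul' K K ∘ₗ TensorProduct.map Coalgebra.counit Coalgebra.counit)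

/-- The multiplication in terms of Sweedler expansions of `Δ x` and `Δ x'`. -/
theorem smashMul_tmul [Ring A] [Algebra K A] [Ring B] [Algebra K B]
    (act : H →ₗ[K] A →ₗ[K] A) (ract : B →ₗ[K] H →ₗ[K] B) (a a' : A) (x x' : H) (b b' : B)
    {ι κ : Type*} (I : Finset ι) (J : Finset κ) (x1 x2 : ι → H) (y1 y2 : κ → H)
    (hx : Coalgebra.comul (R := K) x = ∑ i ∈ I, x1 i ⊗ₜ x2 i)
    (hx' : Coalgebra.comul (R := K) x' = ∑ j ∈ J, y1 j ⊗ₜ y2 j) :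
    smashMul act ract ((a ⊗ₜ (x ⊗ₜ b)) ⊗ₜ (a' ⊗ₜ (x' ⊗ₜ b'))) =
      ∑ j ∈ J, ∑ i ∈ I,
        (a * act (x1 i) a') ⊗ₜ[K] ((x2 i * y1 j) ⊗ₜ[K] (ract b (y2 j) * b')) := by
  simp [smashMul, crossLeft, crossRight, mergeH, hx, hx', TensorProduct.sum_tmul,
    TensorProduct.tmul_sum]

/-- The comultiplication in terms of Sweedler expansions. -/
theorem smashComul_tmul [AddCommGroup A] [Module K A] [Coalgebra K A] [AddCommGroup B]
    [Module K B] [Coalgebra K B] (ρ : A →ₗ[K] H ⊗[K] A) (ψ : B →ₗ[K] B ⊗[K] H)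
    (a : A) (x : H) (b : B) {ι κ μ ι' κ' : Type*} (I : Finset ι) (J : Finset κ) (M : Finset μ)
    (I' : Finset ι') (J' : Finset κ') (a1 a2 : ι → A) (am : ι → ι' → H) (a0 : ι → ι' → A)
    (x1 x2 : μ → H) (b1 b2 : κ → B) (b10 : κ → κ' → B) (b11 : κ → κ' → H)
    (ha : Coalgebra.comul (R := K) a = ∑ i ∈ I, a1 i ⊗ₜ a2 i)
    (hx : Coalgebra.comul (R := K) x = ∑ m ∈ M, x1 m ⊗ₜ x2 m)
    (hb : Coalgebra.comul (R := K) b = ∑ j ∈ J, b1 j ⊗ₜ b2 j)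
    (hρ : ∀ i, ρ (a2 i) = ∑ k ∈ I', am i k ⊗ₜ a0 i k)
    (hψ : ∀ j, ψ (b1 j) = ∑ l ∈ J', b10 j l ⊗ₜ b11 j l) :
    smashComul ρ ψ (a ⊗ₜ (x ⊗ₜ b)) =
      ∑ j ∈ J, ∑ l ∈ J', ∑ m ∈ M, ∑ i ∈ I, ∑ k ∈ I',
        (a1 i ⊗ₜ[K] ((am i k * x1 m) ⊗ₜ[K] b10 j l)) ⊗ₜ[K]
          (a0 i k ⊗ₜ[K] ((x2 m * b11 j l) ⊗ₜ[K] b2 j)) := by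
  simp [smashComul, mergeH, ha, hx, hb, hρ, hψ, TensorProduct.sum_tmul,
    TensorProduct.tmul_sum]

end Smash

/-- The linear maps `mul`, `comul`, `counit` and the element `one` make the vector space `V` into a
bialgebra: there is a bialgebra `W` and a linear isomorphism `V ≃ W` along which these maps are the
structure maps of `W`. -/
def IsBialgebra (K : Type u) {V : Type v} [Field K] [AddCommGroup V] [Module K V]
    (mul : V ⊗[K] V →ₗ[K] V) (one : V) (comul : V →ₗ[K] V ⊗[K] V) (counit : V →ₗ[K] K) : Prop :=
  ∃ (W : Type v) (_ : Ring W) (_ : Bialgebra K W) (e : V ≃ₗ[K] W),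
    (∀ s t : V, e (mul (s ⊗ₜ t)) = e s * e t) ∧
    e one = 1 ∧
    (∀ s : V, TensorProduct.map e.toLinearMap e.toLinearMap (comul s) =
      Coalgebra.comul (R := K) (e s)) ∧
    (∀ s : V, counit s = Coalgebra.counit (R := K) (e s))

/-- The two-sided smash product `A # H # B`, with the two-sided smash coproduct `A × H × B`, is a
bialgebra. -/
def SmashIsBialgebra {K H A B : Type*} [Field K] [Ring H] [Bialgebra K H]
    [Ring A] [Algebra K A] [Coalgebra K A] [Ring B] [Algebra K B] [Coalgebra K B]
    (act : H →ₗ[K] A →ₗ[K] A) (ρ : A →ₗ[K] H ⊗[K] A)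
    (ract : B →ₗ[K] H →ₗ[K] B) (ψ : B →ₗ[K] B ⊗[K] H) : Prop :=
  IsBialgebra K (smashMul act ract) ((1 : A) ⊗ₜ[K] ((1 : H) ⊗ₜ[K] (1 : B)))
    (smashComul ρ ψ) (smashCounit K H A B)

/-! ## The conditions -/

section Conditions

variable {K H A B : Type*} [Field K] [Ring H] [Bialgebra K H]

/-- The counit of `A` is an algebra map. -/
def CounitIsAlgebraMap (K A : Type*) [Field K] [Ring A] [Algebra K A] [Coalgebra K A] : Prop :=
  (Coalgebra.counit (1 : A) : K) = 1 ∧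
    ∀ a a' : A, (Coalgebra.counit (a * a') : K) = Coalgebra.counit a * Coalgebra.counit a'

/-- `Δ(1) = 1 ⊗ 1` -/
def ComulOne (K A : Type*) [Field K] [Ring A] [Algebra K A] [Coalgebra K A] : Prop :=
  Coalgebra.comul (R := K) (1 : A) = (1 : A) ⊗ₜ[K] (1 : A)

section Left

variable [Ring A] [Algebra K A]

/-- `1₋₁ ⊗ 1₀ = 1 ⊗ 1` -/
def LeftCoactOne (ρ : A →ₗ[K] H ⊗[K] A) : Prop := ρ 1 = (1 : H) ⊗ₜ[K] (1 : A)

/-- `ε(x ▷ a) = ε(a) ε(x)` -/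
def LeftCounitAct [Coalgebra K A] (act : H →ₗ[K] A →ₗ[K] A) : Prop :=
  ∀ (x : H) (a : A),
    (Coalgebra.counit (act x a) : K) = Coalgebra.counit a * Coalgebra.counit x

/-- `(a a')₋₁ ⊗ (a a')₀ = a₋₁ a'₋₁ ⊗ a₀ a'₀` -/
def LeftCoactMul (ρ : A →ₗ[K] H ⊗[K] A) : Prop := ∀ a a' : A, ρ (a * a') = ρ a * ρ a'

/-- `(x₁ ▷ a)₋₁ x₂ ⊗ (x₁ ▷ a)₀ = x₁ a₋₁ ⊗ (x₂ ▷ a₀)` -/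
def LeftYetterDrinfeld (act : H →ₗ[K] A →ₗ[K] A) (ρ : A →ₗ[K] H ⊗[K] A) : Prop :=
  ∀ (x : H) (a : A),
    LinearMap.mul' K (H ⊗[K] A) (TensorProduct.map (ρ ∘ₗ act.flip a)
        (Algebra.TensorProduct.includeLeft (R := K) (S := K) (A := H) (B := A)).toLinearMap
        (Coalgebra.comul x)) =
      TensorProduct.map (LinearMap.mul' K H) (TensorProduct.lift act)
        (TensorProduct.tensorTensorTensorComm K H H H A ((Coalgebra.comul (R := K) x) ⊗ₜ[K] ρ a))

/-- `(a a')₁ ⊗ (a a')₂ = a₁ ((a₂)₋₁ ▷ a'₁) ⊗ (a₂)₀ a'₂` -/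
def LeftBraidedComulMul [Coalgebra K A] (act : H →ₗ[K] A →ₗ[K] A) (ρ : A →ₗ[K] H ⊗[K] A) : Prop :=
  ∀ a a' : A, Coalgebra.comul (R := K) (a * a') =
    (LinearMap.mul' K A).rTensor A ((TensorProduct.assoc K A A A).symm
      ((TensorProduct.map (TensorProduct.lift act) (LinearMap.mul' K A) ∘ₗ
          (TensorProduct.tensorTensorTensorComm K H A A A).toLinearMap).lTensor A
        (TensorProduct.assoc K A (H ⊗[K] A) (A ⊗[K] A)
          (ρ.lTensor A (Coalgebra.comul a) ⊗ₜ[K] Coalgebra.comul (R := K) a'))))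

/-- `(x ▷ a)₁ ⊗ (x ▷ a)₂ = (x₁ ▷ a₁) ⊗ (x₂ ▷ a₂)` -/
def LeftComulAct [Coalgebra K A] (act : H →ₗ[K] A →ₗ[K] A) : Prop :=
  ∀ (x : H) (a : A), Coalgebra.comul (R := K) (act x a) =
    TensorProduct.map (TensorProduct.lift act) (TensorProduct.lift act)
      (TensorProduct.tensorTensorTensorComm K H H A A
        (Coalgebra.comul (R := K) x ⊗ₜ[K] Coalgebra.comul (R := K) a))

end Left

section Right

variable [Ring B] [Algebra K B]

/-- `1₍₀₎ ⊗ 1₍₁₎ = 1 ⊗ 1` -/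
def RightCoactOne (ψ : B →ₗ[K] B ⊗[K] H) : Prop := ψ 1 = (1 : B) ⊗ₜ[K] (1 : H)

/-- `ε(b ◁ x) = ε(b) ε(x)` -/
def RightCounitAct [Coalgebra K B] (ract : B →ₗ[K] H →ₗ[K] B) : Prop :=
  ∀ (b : B) (x : H),
    (Coalgebra.counit (ract b x) : K) = Coalgebra.counit b * Coalgebra.counit x

/-- `(b b')₍₀₎ ⊗ (b b')₍₁₎ = b₍₀₎ b'₍₀₎ ⊗ b₍₁₎ b'₍₁₎` -/
def RightCoactMul (ψ : B →ₗ[K] B ⊗[K] H) : Prop := ∀ b b' : B, ψ (b * b') = ψ b * ψ b'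

/-- `(b ◁ x₂)₍₀₎ ⊗ x₁ (b ◁ x₂)₍₁₎ = (b₍₀₎ ◁ x₁) ⊗ b₍₁₎ x₂` -/
def RightYetterDrinfeld (ract : B →ₗ[K] H →ₗ[K] B) (ψ : B →ₗ[K] B ⊗[K] H) : Prop :=
  ∀ (b : B) (x : H),
    LinearMap.mul' K (B ⊗[K] H) (TensorProduct.map
        (Algebra.TensorProduct.includeRight (R := K) (A := B) (B := H)).toLinearMap
        (ψ ∘ₗ ract b) (Coalgebra.comul x)) =
      TensorProduct.map (TensorProduct.lift ract) (LinearMap.mul' K H)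
        (TensorProduct.tensorTensorTensorComm K B H H H (ψ b ⊗ₜ[K] Coalgebra.comul (R := K) x))

/-- `(b b')₁ ⊗ (b b')₂ = b₁ (b'₁)₍₀₎ ⊗ (b₂ ◁ (b'₁)₍₁₎) b'₂` -/
def RightBraidedComulMul [Coalgebra K B] (ract : B →ₗ[K] H →ₗ[K] B) (ψ : B →ₗ[K] B ⊗[K] H) :
    Prop :=
  ∀ b b' : B, Coalgebra.comul (R := K) (b * b') =
    (LinearMap.mul' K B).lTensor B (TensorProduct.assoc K B B B
      ((TensorProduct.map (LinearMap.mul' K B) (TensorProduct.lift ract) ∘ₗ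
          (TensorProduct.tensorTensorTensorComm K B B B H).toLinearMap).rTensor B
        ((TensorProduct.assoc K (B ⊗[K] B) (B ⊗[K] H) B).symm
          (Coalgebra.comul (R := K) b ⊗ₜ[K] ψ.rTensor B (Coalgebra.comul b')))))

/-- `(b ◁ x)₁ ⊗ (b ◁ x)₂ = (b₁ ◁ x₁) ⊗ (b₂ ◁ x₂)` -/
def RightComulAct [Coalgebra K B] (ract : B →ₗ[K] H →ₗ[K] B) : Prop :=
  ∀ (b : B) (x : H), Coalgebra.comul (R := K) (ract b x) =
    TensorProduct.map (TensorProduct.lift ract) (TensorProduct.lift ract)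
      (TensorProduct.tensorTensorTensorComm K B B H H
        (Coalgebra.comul (R := K) b ⊗ₜ[K] Coalgebra.comul (R := K) x))

end Right

/-- Majid's condition `(b₍₁₎ ▷ a₀) ⊗ (b₍₀₎ ◁ a₋₁) = a ⊗ b`. -/
def MajidCondition [Ring A] [Algebra K A] [Ring B] [Algebra K B]
    (act : H →ₗ[K] A →ₗ[K] A) (ρ : A →ₗ[K] H ⊗[K] A)
    (ract : B →ₗ[K] H →ₗ[K] B) (ψ : B →ₗ[K] B ⊗[K] H) : Prop :=
  ∀ (a : A) (b : B),
    TensorProduct.map (TensorProduct.lift act) (TensorProduct.lift ract)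
      (TensorProduct.comm K (B ⊗[K] H) (H ⊗[K] A)
        (TensorProduct.tensorTensorTensorComm K B H H A (ψ b ⊗ₜ[K] ρ a))) = a ⊗ₜ[K] b

/-- `A` is a bialgebra in the category of left-left Yetter-Drinfeld modules over `H`: a
Yetter-Drinfeld module with an algebra structure and a coalgebra structure whose structure maps are
`H`-linear and `H`-colinear, such that the counit and the comultiplication are algebra maps, where
`A ⊗ A` has the product twisted by the braiding `c ⊗ d ↦ (c₋₁ ▷ d) ⊗ c₀`. -/
structure IsLeftYDBialgebra [Ring A] [Algebra K A] [Coalgebra K A]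
    (act : H →ₗ[K] A →ₗ[K] A) (ρ : A →ₗ[K] H ⊗[K] A) : Prop extends
    IsLeftModuleAlgebra act, IsLeftComoduleCoalgebra ρ where
  yetterDrinfeld : LeftYetterDrinfeld act ρ
  coact_one : LeftCoactOne ρ
  coact_mul : LeftCoactMul ρ
  counit_act : LeftCounitAct act
  comul_act : LeftComulAct act
  counit_algebraMap : CounitIsAlgebraMap K A
  comul_one : ComulOne K A
  comul_mul : LeftBraidedComulMul act ρ

/-- `B` is a bialgebra in the category of right-right Yetter-Drinfeld modules over `H`, with the
braiding `c ⊗ d ↦ d₍₀₎ ⊗ (c ◁ d₍₁₎)`. -/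
structure IsRightYDBialgebra [Ring B] [Algebra K B] [Coalgebra K B]
    (ract : B →ₗ[K] H →ₗ[K] B) (ψ : B →ₗ[K] B ⊗[K] H) : Prop extends
    IsRightModuleAlgebra ract, IsRightComoduleCoalgebra ψ where
  yetterDrinfeld : RightYetterDrinfeld ract ψ
  coact_one : RightCoactOne ψ
  coact_mul : RightCoactMul ψ
  counit_act : RightCounitAct ract
  comul_act : RightComulAct ract
  counit_algebraMap : CounitIsAlgebraMap K B
  comul_one : ComulOne K B
  comul_mul : RightBraidedComulMul ract ψ

end Conditions

end DoubleBiproduct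

end

/-!
The algebra `A # H # B` is generated by copies of `A`, `H` and `B` subject to the relations
`x a = (x₁ ▷ a) x₂`, `b x = x₁ (b ◁ x₂)` and `a b = b a`. Its universal property (`Smash.lift`)
turns both directions of the equivalence into computations on generators. The associativity of the
smash product is itself obtained this way: left multiplications are operators on `A ⊗ H ⊗ B` which
satisfy the three relations (`smashLift_op_apply`), so that left multiplication is a
representation.

*Sufficiency.* The smash coproduct sends the generators to
`Δ a = a₁ (a₂)₋₁ ⊗ (a₂)₀`, `Δ x = x₁ ⊗ x₂` and `Δ b = (b₁)₍₀₎ ⊗ (b₁)₍₁₎ b₂`,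
and these are convolution products of maps into the tensor square: `Δ a` is the convolution product
of `a ↦ a ⊗ 1` and `a ↦ a₋₁ ⊗ a₀`, and similarly for `x` and `b`. Moreover
`Δ (a ⊗ x ⊗ b) = Δ a * Δ x * Δ b` (`Smash.smashComul_eq`). By the universal property `Δ` is
an algebra map as soon as it is one on `A`, `H` and `B` and respects the three relations. The
formulas for `Δ (a a')` and `Δ (b b')`, with the multiplicativity of the coactions, give the first
(`conv_mul_of_leftBraided`, `conv_mul_of_rightBraided`). Compatibility with the relation between `H`
and `A` passes through convolution products (`LeftSmashRel.conv_right`): for the factor `a ⊗ 1` it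
is the smash relation, for the factor `a₋₁ ⊗ a₀` it is the Yetter-Drinfeld condition. Majid's
condition makes `Δ a` and `Δ b` commute (`Smash.commute_deltaA_deltaB`). Coassociativity and
counitality are equalities of algebra maps, checked on the generators; on each of them
coassociativity is the associativity of a threefold convolution product.

*Necessity.* If the smash coproduct is multiplicative, the relations hold between `Δ a`, `Δ x` and
`Δ b` in the tensor square. The counit being an algebra map makes the counits of `A` and `B`
multiplicative and `H`-linear, and then `A # H # B` acts on `A` from the left (with `B` acting by
its counit), on `B` from the right (with `A` acting by its counit), and on `H` through the
projection given by both counits. Evaluating `Δ a` at `1 ⊗ 1` in `A ⊗ A` returns the coproduct of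
`a`, and in `H ⊗ A` it returns the coaction. Each condition on `A` is thus one of the relations
evaluated in `A ⊗ A` or `H ⊗ A`, each condition on `B` is one evaluated in `B ⊗ B` or `B ⊗ H`, and
Majid's condition is `Δ a * Δ b = Δ b * Δ a` evaluated in `B ⊗ A`
(`Smash.smashConditions_of_comul`).
-/

open scoped TensorProduct

noncomputable section

namespace DoubleBiproduct

open TensorProduct

-- Type class search on iterated tensor products is much faster for these than for `map_zero`.
attribute [local simp] LinearMap.map_zero LinearEquiv.map_zero

/-! ### Convolution products and smash relations -/

section

section Convolution

variable {K : Type*} [Field K]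

section MulMap

variable {M N C D : Type*} [AddCommMonoid M] [Module K M] [AddCommMonoid N] [Module K N]
  [Semiring C] [Algebra K C] [Semiring D] [Algebra K D]

/-- The linear map `m ⊗ n ↦ f m * g n`. -/
def mulMap (f : M →ₗ[K] C) (g : N →ₗ[K] C) : M ⊗[K] N →ₗ[K] C :=
  LinearMap.mul' K C ∘ₗ TensorProduct.map f g

@[simp]
theorem mulMap_tmul (f : M →ₗ[K] C) (g : N →ₗ[K] C) (m : M) (n : N) :
    mulMap f g (m ⊗ₜ n) = f m * g n := by
  simp [mulMap]

theorem map_mulMap (φ : C →ₐ[K] D) (f : M →ₗ[K] C) (g : N →ₗ[K] C) (t : M ⊗[K] N) :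
    φ (mulMap f g t) = mulMap (φ.toLinearMap ∘ₗ f) (φ.toLinearMap ∘ₗ g) t := by
  induction t with
  | zero => simp
  | tmul m n => simp
  | add s t hs ht => simp [hs, ht]

theorem mulMap_mul (f : M →ₗ[K] C) (g : N →ₗ[K] C) (t : M ⊗[K] N) (c : C) :
    mulMap f g t * c = mulMap f (LinearMap.mulRight K c ∘ₗ g) t := by
  induction t with
  | zero => simp
  | tmul m n => simp [mul_assoc]
  | add s t hs ht => simp [add_mul, hs, ht]

theorem mul_mulMap (f : M →ₗ[K] C) (g : N →ₗ[K] C) (t : M ⊗[K] N) (c : C) :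
    c * mulMap f g t = mulMap (LinearMap.mulLeft K c ∘ₗ f) g t := by
  induction t with
  | zero => simp
  | tmul m n => simp [mul_assoc]
  | add s t hs ht => simp [mul_add, hs, ht]

/-- A scalar in the middle may be moved from one factor to the other. -/
theorem mulMap_mulLeft (f : M →ₗ[K] C) (g : N →ₗ[K] C) (c : C) :
    mulMap f (LinearMap.mulLeft K c ∘ₗ g) = mulMap (LinearMap.mulRight K c ∘ₗ f) g :=
  TensorProduct.ext' fun m n => by simp [mul_assoc]

theorem commute_mulMap {f : M →ₗ[K] C} {g : N →ₗ[K] C} {c : C} (hf : ∀ m, Commute c (f m))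
    (hg : ∀ n, Commute c (g n)) (t : M ⊗[K] N) : Commute c (mulMap f g t) := by
  induction t with
  | zero => simp
  | tmul m n => simpa using (hf m).mul_right (hg n)
  | add s t hs ht => simpa using hs.add_right ht

end MulMap

section Conv

variable {M C D : Type*} [AddCommMonoid M] [Module K M] [Coalgebra K M]
  [Semiring C] [Algebra K C] [Semiring D] [Algebra K D]

/-- The convolution product `m ↦ f m₁ * g m₂` of linear maps from a coalgebra to an algebra. -/
def conv (f g : M →ₗ[K] C) : M →ₗ[K] C := mulMap f g ∘ₗ Coalgebra.comul

theorem conv_apply (f g : M →ₗ[K] C) (m : M) :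
    conv f g m = mulMap f g (Coalgebra.comul m) := rfl

theorem conv_assoc (f g h : M →ₗ[K] C) : conv (conv f g) h = conv f (conv g h) :=
  congrArg WithConv.ofConv
    (mul_assoc (WithConv.toConv f) (WithConv.toConv g) (WithConv.toConv h))

theorem map_conv (φ : C →ₐ[K] D) (f g : M →ₗ[K] C) (m : M) :
    φ (conv f g m) = conv (φ.toLinearMap ∘ₗ f) (φ.toLinearMap ∘ₗ g) m :=
  map_mulMap φ f g _

theorem conv_mul (f g : M →ₗ[K] C) (m : M) (c : C) :
    conv f g m * c = conv f (LinearMap.mulRight K c ∘ₗ g) m := mulMap_mul f g _ c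

theorem mul_conv (f g : M →ₗ[K] C) (m : M) (c : C) :
    c * conv f g m = conv (LinearMap.mulLeft K c ∘ₗ f) g m := mul_mulMap f g _ c

theorem conv_mulLeft (f g : M →ₗ[K] C) (c : C) :
    conv f (LinearMap.mulLeft K c ∘ₗ g) = conv (LinearMap.mulRight K c ∘ₗ f) g := by
  rw [conv, conv, mulMap_mulLeft]

theorem conv_mulLeft_left (f g : M →ₗ[K] C) (c : C) :
    conv (LinearMap.mulLeft K c ∘ₗ f) g = LinearMap.mulLeft K c ∘ₗ conv f g :=
  LinearMap.ext fun m => (mul_conv f g m c).symm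

theorem conv_mulRight_right (f g : M →ₗ[K] C) (c : C) :
    conv f (LinearMap.mulRight K c ∘ₗ g) = LinearMap.mulRight K c ∘ₗ conv f g :=
  LinearMap.ext fun m => (conv_mul f g m c).symm

theorem commute_conv {f g : M →ₗ[K] C} {c : C} (hf : ∀ m, Commute c (f m))
    (hg : ∀ m, Commute c (g m)) (m : M) : Commute c (conv f g m) := commute_mulMap hf hg _

end Conv

section ConvAlgHom

variable {H C : Type*} [Ring H] [Bialgebra K H] [Semiring C] [Algebra K C]

/-- The convolution product of two algebra maps with commuting images, as an algebra map. -/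
def convAlgHom (f g : H →ₐ[K] C) (hfg : ∀ x y, Commute (f x) (g y)) : H →ₐ[K] C :=
  (Algebra.TensorProduct.lift f g hfg).comp (Bialgebra.comulAlgHom K H)

theorem lift_eq_mulMap {X Y : Type*} [Semiring X] [Algebra K X] [Semiring Y] [Algebra K Y]
    (f : X →ₐ[K] C) (g : Y →ₐ[K] C) (hfg : ∀ x y, Commute (f x) (g y)) :
    (Algebra.TensorProduct.lift f g hfg).toLinearMap = mulMap f.toLinearMap g.toLinearMap :=
  TensorProduct.ext' fun x y => by simp

theorem convAlgHom_toLinearMap (f g : H →ₐ[K] C) (hfg : ∀ x y, Commute (f x) (g y)) :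
    (convAlgHom f g hfg).toLinearMap = conv f.toLinearMap g.toLinearMap := by
  rw [conv, ← lift_eq_mulMap f g hfg]
  rfl

theorem convAlgHom_apply (f g : H →ₐ[K] C) (hfg : ∀ x y, Commute (f x) (g y)) (x : H) :
    convAlgHom f g hfg x = conv f.toLinearMap g.toLinearMap x :=
  LinearMap.congr_fun (convAlgHom_toLinearMap f g hfg) x

end ConvAlgHom

end Convolution

section Relations

variable {K H A B C D : Type*} [Field K] [Ring H] [Bialgebra K H]
  [Semiring C] [Algebra K C] [Semiring D] [Algebra K D]

section Left

variable [AddCommMonoid A] [Module K A]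

/-- The smash product relation `γ x * f a = f (x₁ ▷ a) * γ x₂` in an algebra `C`. -/
def LeftSmashRel (act : H →ₗ[K] A →ₗ[K] A) (γ : H →ₗ[K] C) (f : A →ₗ[K] C) : Prop :=
  ∀ x a, γ x * f a = conv (f ∘ₗ act.flip a) γ x

variable {act : H →ₗ[K] A →ₗ[K] A} {γ γ₁ γ₂ : H →ₗ[K] C} {f g : A →ₗ[K] C}

theorem LeftSmashRel.mulRight (h : LeftSmashRel act γ f) (a : A) :
    LinearMap.mulRight K (f a) ∘ₗ γ = conv (f ∘ₗ act.flip a) γ :=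
  LinearMap.ext fun x => h x a

theorem LeftSmashRel.map (h : LeftSmashRel act γ f) (φ : C →ₐ[K] D) :
    LeftSmashRel act (φ.toLinearMap ∘ₗ γ) (φ.toLinearMap ∘ₗ f) := by
  intro x a
  have := congrArg φ (h x a)
  rwa [map_mul, map_conv] at this

/-- A smash relation survives multiplication of `γ` by a map that commutes with `f`. -/
theorem LeftSmashRel.conv_of_commute (h : LeftSmashRel act γ₁ f)
    (hc : ∀ x a, Commute (γ₂ x) (f a)) : LeftSmashRel act (conv γ₁ γ₂) f := by
  intro x a
  have h2 : LinearMap.mulRight K (f a) ∘ₗ γ₂ = LinearMap.mulLeft K (f a) ∘ₗ γ₂ :=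
    LinearMap.ext fun y => hc y a
  rw [conv_mul, h2, conv_mulLeft, h.mulRight, conv_assoc]

/-- If the coproduct of `A` is `H`-linear, the smash relation for `f` and for `g` gives the one for
their convolution product. -/
theorem LeftSmashRel.conv_right {A : Type*} [Ring A] [Algebra K A]
    [Coalgebra K A] {act : H →ₗ[K] A →ₗ[K] A} {f g : A →ₗ[K] C} (hf : LeftSmashRel act γ f)
    (hg : LeftSmashRel act γ g) (h : LeftComulAct act) : LeftSmashRel act γ (conv f g) := by
  have key : ∀ (x : H) (t : A ⊗[K] A), γ x * mulMap f g t =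
      conv (mulMap f g ∘ₗ TensorProduct.map (TensorProduct.lift act) (TensorProduct.lift act) ∘ₗ
        (TensorProduct.tensorTensorTensorComm K H H A A).toLinearMap ∘ₗ
        (TensorProduct.mk K (H ⊗[K] H) (A ⊗[K] A)).flip t ∘ₗ Coalgebra.comul) γ x := by
    intro x t
    induction t with
    | zero => simp [conv, mulMap]
    | tmul a b =>
      have e : mulMap f g ∘ₗ TensorProduct.map (TensorProduct.lift act) (TensorProduct.lift act) ∘ₗ
          (TensorProduct.tensorTensorTensorComm K H H A A).toLinearMap ∘ₗ
          (TensorProduct.mk K (H ⊗[K] H) (A ⊗[K] A)).flip (a ⊗ₜ b) =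
            mulMap (f ∘ₗ act.flip a) (g ∘ₗ act.flip b) :=
        TensorProduct.ext' fun x y => by simp
      have e' : mulMap f g ∘ₗ
          TensorProduct.map (TensorProduct.lift act) (TensorProduct.lift act) ∘ₗ
          (TensorProduct.tensorTensorTensorComm K H H A A).toLinearMap ∘ₗ
          (TensorProduct.mk K (H ⊗[K] H) (A ⊗[K] A)).flip (a ⊗ₜ b) ∘ₗ Coalgebra.comul =
            conv (f ∘ₗ act.flip a) (g ∘ₗ act.flip b) :=
        congrArg (fun l => l ∘ₗ (Coalgebra.comul : H →ₗ[K] H ⊗[K] H)) e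
      rw [e', mulMap_tmul, ← mul_assoc, hf x a, conv_mul, hg.mulRight, conv_assoc]
    | add s t hs ht =>
      rw [map_add, mul_add, hs, ht, map_add]
      simp only [conv, mulMap, LinearMap.add_comp, LinearMap.comp_add, TensorProduct.map_add_left,
        LinearMap.add_apply]
  intro x a
  -- for `t = Δ a`, the tensors on the right-hand side of `key` are `Δ (x₁ ▷ a)`
  rw [conv_apply, key]
  congr 2
  ext y
  simpa [conv_apply] using congrArg (mulMap f g) (h y a).symm

end Left

section Right

variable [AddCommMonoid B] [Module K B]

/-- The smash product relation `g b * γ x = γ x₁ * g (b ◁ x₂)` in an algebra `C`. -/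
def RightSmashRel (ract : B →ₗ[K] H →ₗ[K] B) (γ : H →ₗ[K] C) (g : B →ₗ[K] C) : Prop :=
  ∀ b x, g b * γ x = conv γ (g ∘ₗ ract b) x

variable {ract : B →ₗ[K] H →ₗ[K] B} {γ γ₁ γ₂ : H →ₗ[K] C} {f g : B →ₗ[K] C}

theorem RightSmashRel.mulLeft (h : RightSmashRel ract γ g) (b : B) :
    LinearMap.mulLeft K (g b) ∘ₗ γ = conv γ (g ∘ₗ ract b) :=
  LinearMap.ext fun x => h b x

theorem RightSmashRel.map (h : RightSmashRel ract γ g) (φ : C →ₐ[K] D) :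
    RightSmashRel ract (φ.toLinearMap ∘ₗ γ) (φ.toLinearMap ∘ₗ g) := by
  intro b x
  have := congrArg φ (h b x)
  rwa [map_mul, map_conv] at this

/-- A smash relation survives multiplication of `γ` by a map that commutes with `g`. -/
theorem RightSmashRel.conv_of_commute (h : RightSmashRel ract γ₂ g)
    (hc : ∀ x b, Commute (γ₁ x) (g b)) : RightSmashRel ract (conv γ₁ γ₂) g := by
  intro b x
  have h2 : LinearMap.mulLeft K (g b) ∘ₗ γ₁ = LinearMap.mulRight K (g b) ∘ₗ γ₁ :=
    LinearMap.ext fun y => (hc y b).symm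
  rw [mul_conv, h2, ← conv_mulLeft, h.mulLeft, conv_assoc]

/-- If the coproduct of `B` is `H`-linear, the smash relation for `f` and for `g` gives the one for
their convolution product. -/
theorem RightSmashRel.conv_right {B : Type*} [Ring B] [Algebra K B]
    [Coalgebra K B] {ract : B →ₗ[K] H →ₗ[K] B} {f g : B →ₗ[K] C} (hf : RightSmashRel ract γ f)
    (hg : RightSmashRel ract γ g) (h : RightComulAct ract) : RightSmashRel ract γ (conv f g) := by
  have key : ∀ (x : H) (t : B ⊗[K] B), mulMap f g t * γ x =
      conv γ (mulMap f g ∘ₗ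
        TensorProduct.map (TensorProduct.lift ract) (TensorProduct.lift ract) ∘ₗ
        (TensorProduct.tensorTensorTensorComm K B B H H).toLinearMap ∘ₗ
        (TensorProduct.mk K (B ⊗[K] B) (H ⊗[K] H)) t ∘ₗ Coalgebra.comul) x := by
    intro x t
    induction t with
    | zero => simp [conv, mulMap]
    | tmul a b =>
      have e : mulMap f g ∘ₗ
          TensorProduct.map (TensorProduct.lift ract) (TensorProduct.lift ract) ∘ₗ
          (TensorProduct.tensorTensorTensorComm K B B H H).toLinearMap ∘ₗ
          (TensorProduct.mk K (B ⊗[K] B) (H ⊗[K] H)) (a ⊗ₜ b) =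
            mulMap (f ∘ₗ ract a) (g ∘ₗ ract b) :=
        TensorProduct.ext' fun x y => by simp
      have e' : mulMap f g ∘ₗ
          TensorProduct.map (TensorProduct.lift ract) (TensorProduct.lift ract) ∘ₗ
          (TensorProduct.tensorTensorTensorComm K B B H H).toLinearMap ∘ₗ
          (TensorProduct.mk K (B ⊗[K] B) (H ⊗[K] H)) (a ⊗ₜ b) ∘ₗ Coalgebra.comul =
            conv (f ∘ₗ ract a) (g ∘ₗ ract b) :=
        congrArg (fun l => l ∘ₗ (Coalgebra.comul : H →ₗ[K] H ⊗[K] H)) e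
      rw [e', mulMap_tmul, mul_assoc, hg b x, mul_conv, hf.mulLeft, conv_assoc]
    | add s t hs ht =>
      rw [map_add, add_mul, hs, ht, map_add]
      simp only [conv, mulMap, LinearMap.add_comp, LinearMap.comp_add, TensorProduct.map_add_right,
        LinearMap.add_apply]
  intro b x
  rw [conv_apply (m := b), key]
  congr 2
  ext y
  simpa [conv_apply] using congrArg (mulMap f g) (h b y).symm

end Right

section BraidedMul

variable [Ring A] [Algebra K A] [Coalgebra K A] [Ring B] [Algebra K B] [Coalgebra K B]

set_option synthInstance.maxHeartbeats 200000 in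
/-- If `g` and `f` satisfy the exchange rule `g c * f a = f (c₋₁ ▷ a) * g c₀`, then the formula for
`Δ (a a')` makes `a ↦ f a₁ * g a₂` multiplicative. -/
theorem conv_mul_of_leftBraided {act : H →ₗ[K] A →ₗ[K] A} {ρ : A →ₗ[K] H ⊗[K] A}
    (h : LeftBraidedComulMul act ρ) (f g : A →ₐ[K] C)
    (hex : ∀ c a, g c * f a =
      mulMap (f.toLinearMap ∘ₗ act.flip a) g.toLinearMap (ρ c)) (a a' : A) :
    conv f.toLinearMap g.toLinearMap (a * a') =
      conv f.toLinearMap g.toLinearMap a * conv f.toLinearMap g.toLinearMap a' := by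
  simp only [conv_apply]
  rw [h a a']
  generalize (Coalgebra.comul (R := K) a) = s
  generalize (Coalgebra.comul (R := K) a') = t
  induction s with
  | zero => simp
  | add s₁ s₂ h₁ h₂ => simp only [map_add, add_tmul, add_mul, h₁, h₂]
  | tmul a₁ a₂ =>
    induction t with
    | zero => simp
    | add t₁ t₂ h₁ h₂ => simp only [map_add, tmul_add, mul_add, h₁, h₂]
    | tmul b₁ b₂ =>
      simp only [mulMap_tmul, AlgHom.toLinearMap_apply, LinearMap.lTensor_tmul]
      rw [mul_assoc, ← mul_assoc (g a₂), hex]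
      generalize ρ a₂ = r
      induction r with
      | zero => simp
      | add r₁ r₂ h₁ h₂ => simp only [map_add, tmul_add, add_tmul, mul_add, add_mul, h₁, h₂]
      | tmul x c => simp [mul_assoc]

/-- If `g` and `f` satisfy the exchange rule `g b * f c = f c₍₀₎ * g (b ◁ c₍₁₎)`, then the formula
for `Δ (b b')` makes `b ↦ f b₁ * g b₂` multiplicative. -/
theorem conv_mul_of_rightBraided {ract : B →ₗ[K] H →ₗ[K] B} {ψ : B →ₗ[K] B ⊗[K] H}
    (h : RightBraidedComulMul ract ψ) (f g : B →ₐ[K] C)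
    (hex : ∀ b c, g b * f c =
      mulMap f.toLinearMap (g.toLinearMap ∘ₗ ract b) (ψ c)) (b b' : B) :
    conv f.toLinearMap g.toLinearMap (b * b') =
      conv f.toLinearMap g.toLinearMap b * conv f.toLinearMap g.toLinearMap b' := by
  simp only [conv_apply]
  rw [h b b']
  generalize (Coalgebra.comul (R := K) b) = s
  generalize (Coalgebra.comul (R := K) b') = t
  induction s with
  | zero => simp
  | add s₁ s₂ h₁ h₂ => simp only [map_add, add_tmul, add_mul, h₁, h₂]
  | tmul a₁ a₂ =>
    induction t with
    | zero => simp
    | add t₁ t₂ h₁ h₂ => simp only [map_add, tmul_add, mul_add, h₁, h₂]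
    | tmul b₁ b₂ =>
      simp only [mulMap_tmul, AlgHom.toLinearMap_apply, LinearMap.rTensor_tmul]
      rw [mul_assoc, ← mul_assoc (g a₂), hex]
      generalize ψ b₁ = r
      induction r with
      | zero => simp
      | add r₁ r₂ h₁ h₂ => simp only [map_add, tmul_add, add_tmul, mul_add, add_mul, h₁, h₂]
      | tmul x c => simp [mul_assoc]

end BraidedMul

end Relations

end

/-! ### The smash product and its operators on `A ⊗ H ⊗ B` -/

section

section Conv

variable {K M C : Type*} [Field K] [AddCommMonoid M] [Module K M] [Coalgebra K M]
  [Semiring C] [Algebra K C]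

theorem conv_counit_right {f g : M →ₗ[K] C}
    (hg : ∀ m, g m = algebraMap K C (Coalgebra.counit m)) : conv f g = f := by
  obtain rfl : g = (1 : WithConv (M →ₗ[K] C)).ofConv := LinearMap.ext hg
  exact congrArg WithConv.ofConv (mul_one (WithConv.toConv f))

theorem conv_counit_left {f g : M →ₗ[K] C}
    (hf : ∀ m, f m = algebraMap K C (Coalgebra.counit m)) : conv f g = g := by
  obtain rfl : f = (1 : WithConv (M →ₗ[K] C)).ofConv := LinearMap.ext hf
  exact congrArg WithConv.ofConv (one_mul (WithConv.toConv g))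

end Conv

variable {K H A B : Type*} [Field K] [Ring H] [Bialgebra K H]
  [Ring A] [Algebra K A] [Ring B] [Algebra K B]

section Lift

variable {C : Type*} [Semiring C] [Algebra K C]

/-- The linear map `a ⊗ x ⊗ b ↦ α a * γ x * β b`. -/
def smashLift (α : A →ₗ[K] C) (γ : H →ₗ[K] C) (β : B →ₗ[K] C) : A ⊗[K] (H ⊗[K] B) →ₗ[K] C :=
  mulMap α (mulMap γ β)

@[simp]
theorem smashLift_tmul (α : A →ₗ[K] C) (γ : H →ₗ[K] C) (β : B →ₗ[K] C) (a : A) (x : H) (b : B) :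
    smashLift α γ β (a ⊗ₜ (x ⊗ₜ b)) = α a * (γ x * β b) := by
  simp [smashLift]

/-- Maps of `A`, `H` and `B` that satisfy the relations of `A # H # B` turn the smash product into
the product. -/
theorem smashLift_smashMul {act : H →ₗ[K] A →ₗ[K] A} {ract : B →ₗ[K] H →ₗ[K] B}
    (α : A →ₐ[K] C) (γ : H →ₐ[K] C) (β : B →ₐ[K] C)
    (hα : LeftSmashRel act γ.toLinearMap α.toLinearMap)
    (hβ : RightSmashRel ract γ.toLinearMap β.toLinearMap)
    (hαβ : ∀ a b, Commute (α a) (β b)) (s t : A ⊗[K] (H ⊗[K] B)) :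
    smashLift α.toLinearMap γ.toLinearMap β.toLinearMap (smashMul act ract (s ⊗ₜ t)) =
      smashLift α.toLinearMap γ.toLinearMap β.toLinearMap s *
        smashLift α.toLinearMap γ.toLinearMap β.toLinearMap t := by
  induction s with
  | zero => simp
  | add s₁ s₂ h₁ h₂ => simp only [map_add, add_tmul, add_mul, h₁, h₂]
  | tmul a u =>
  induction u with
  | zero => simp
  | add s₁ s₂ h₁ h₂ => simp only [map_add, add_tmul, tmul_add, add_mul, h₁, h₂]
  | tmul x b =>
  induction t with
  | zero => simp
  | add s₁ s₂ h₁ h₂ => simp only [map_add, tmul_add, mul_add, h₁, h₂]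
  | tmul a' u =>
  induction u with
  | zero => simp
  | add s₁ s₂ h₁ h₂ => simp only [map_add, tmul_add, mul_add, h₁, h₂]
  | tmul x' b' =>
  have hx := (Coalgebra.Repr.arbitrary K x).eq
  have hx' := (Coalgebra.Repr.arbitrary K x').eq
  rw [smashMul_tmul act ract a a' x x' b b' _ _ _ _ _ _ hx.symm hx'.symm]
  have h1 := hα x a'
  have h2 := hβ b x'
  rw [conv_apply, ← hx, map_sum] at h1
  rw [conv_apply, ← hx', map_sum] at h2
  simp only [AlgHom.toLinearMap_apply, mulMap_tmul, LinearMap.comp_apply,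
    LinearMap.flip_apply] at h1 h2
  have e : α a * (γ x * β b) * (α a' * (γ x' * β b')) =
      α a * (γ x * α a') * (β b * γ x') * β b' := by
    have := (hαβ a' b).eq
    calc _ = α a * γ x * (β b * α a') * γ x' * β b' := by simp only [mul_assoc]
      _ = _ := by rw [← this]; simp only [mul_assoc]
  simp only [smashLift_tmul, AlgHom.toLinearMap_apply, map_sum]
  rw [e, h1, h2]
  simp only [Finset.mul_sum, Finset.sum_mul, map_mul, mul_assoc]

end Lift

section Operators

/-- Left multiplication by `b` on `H # B`, that is `x ⊗ b' ↦ x₁ ⊗ (b ◁ x₂) b'`. -/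
def rightOp (ract : B →ₗ[K] H →ₗ[K] B) : B →ₗ[K] Module.End K (H ⊗[K] B) :=
  TensorProduct.curry ((LinearMap.mul' K B).lTensor H ∘ₗ
    (TensorProduct.assoc K H B B).toLinearMap ∘ₗ (crossRight ract).rTensor B ∘ₗ
    (TensorProduct.assoc K B H B).symm.toLinearMap)

/-- The linear map `x ↦ x₁ ⊗ (b ◁ x₂)`, written as a convolution product. -/
def cross (ract : B →ₗ[K] H →ₗ[K] B) (b : B) : H →ₗ[K] H ⊗[K] B :=
  conv (Algebra.TensorProduct.includeLeft (R := K) (S := K) (A := H) (B := B)).toLinearMap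
    ((Algebra.TensorProduct.includeRight (R := K) (A := H) (B := B)).toLinearMap ∘ₗ ract b)

theorem rightOp_tmul (ract : B →ₗ[K] H →ₗ[K] B) (b b' : B) (x : H) :
    rightOp ract b (x ⊗ₜ b') = cross ract b x * (1 ⊗ₜ b') := by
  simp only [rightOp, cross, conv_apply, crossRight, TensorProduct.curry_apply,
    LinearMap.comp_apply, LinearEquiv.coe_coe, TensorProduct.assoc_symm_tmul,
    LinearMap.rTensor_tmul, LinearMap.lTensor_tmul]
  generalize Coalgebra.comul (R := K) x = t
  induction t with
  | zero => simp
  | tmul y z => simp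
  | add s t hs ht => simp only [tmul_add, add_tmul, add_mul, map_add, hs, ht]

theorem rightOp_mul_one_tmul (ract : B →ₗ[K] H →ₗ[K] B) (b b' : B) (t : H ⊗[K] B) :
    rightOp ract b (t * (1 ⊗ₜ b')) = rightOp ract b t * (1 ⊗ₜ b') := by
  induction t with
  | zero => simp
  | tmul y z => simp [rightOp_tmul, mul_assoc]
  | add s t hs ht => simp only [add_mul, map_add, hs, ht]

/-- The operator of `b` composed with `x ↦ x₁ ⊗ (c ◁ x₂)`: this is coassociativity of `H` together
with `(b c) ◁ x = (b ◁ x₁) (c ◁ x₂)`. -/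
theorem rightOp_comp_cross {ract : B →ₗ[K] H →ₗ[K] B} (h : IsRightModuleAlgebra ract)
    (b c : B) : rightOp ract b ∘ₗ cross ract c = cross ract (b * c) := by
  have e : (Algebra.TensorProduct.includeRight (R := K) (A := H) (B := B)).toLinearMap ∘ₗ
      ract (b * c) = conv
        ((Algebra.TensorProduct.includeRight (R := K) (A := H) (B := B)).toLinearMap ∘ₗ ract b)
        ((Algebra.TensorProduct.includeRight (R := K) (A := H) (B := B)).toLinearMap ∘ₗ
          ract c) := by
    ext x
    have := map_conv (Algebra.TensorProduct.includeRight (R := K) (A := H) (B := B))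
      (ract b) (ract c) x
    rw [← this, LinearMap.comp_apply, h.mul_act]
    rfl
  rw [cross, cross, e, ← conv_assoc]
  ext x
  rw [LinearMap.comp_apply, conv_apply, conv_apply]
  generalize Coalgebra.comul (R := K) x = t
  induction t with
  | zero => simp
  | tmul y z =>
    simpa only [mulMap_tmul, AlgHom.toLinearMap_apply, LinearMap.comp_apply,
      Algebra.TensorProduct.includeLeft_apply, Algebra.TensorProduct.includeRight_apply,
      Algebra.TensorProduct.tmul_mul_tmul, one_mul, mul_one, cross] using
      rightOp_tmul ract b (ract c z) y
  | add s t hs ht => simp only [map_add, hs, ht]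

/-- Left multiplication by elements of `B` on `H # B`, as a representation. -/
def rightOpHom {ract : B →ₗ[K] H →ₗ[K] B} (h : IsRightModuleAlgebra ract) :
    B →ₐ[K] Module.End K (H ⊗[K] B) :=
  AlgHom.ofLinearMap (rightOp ract)
    (TensorProduct.ext' fun x b => by
      have : cross ract 1 = (Algebra.TensorProduct.includeLeft (R := K) (S := K)
          (A := H) (B := B)).toLinearMap :=
        conv_counit_right fun m => by
          simp [h.one_act, Algebra.algebraMap_eq_smul_one, Algebra.TensorProduct.one_def]
      simp [rightOp_tmul, this])
    (fun b c => TensorProduct.ext' fun x d => by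
      rw [rightOp_tmul, ← rightOp_comp_cross h, Module.End.mul_apply, rightOp_tmul,
        rightOp_mul_one_tmul, LinearMap.comp_apply])

/-- Left multiplication by elements of `H` on `H # B`. -/
def mulLeftH (K H B : Type*) [Field K] [Ring H] [Bialgebra K H] [Ring B] [Algebra K B] :
    H →ₐ[K] Module.End K (H ⊗[K] B) :=
  (Algebra.lmul K (H ⊗[K] B)).comp Algebra.TensorProduct.includeLeft

theorem rightSmashRel_rightOp {ract : B →ₗ[K] H →ₗ[K] B} (h : IsRightModuleAlgebra ract) :
    RightSmashRel ract (mulLeftH K H B).toLinearMap (rightOpHom h).toLinearMap := by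
  intro b x
  refine TensorProduct.ext' fun y c => ?_
  have e : cross ract b (x * y) = mulMap
      (Algebra.TensorProduct.includeLeft (R := K) (S := K) (A := H) (B := B)).toLinearMap
      ((Algebra.TensorProduct.includeRight (R := K) (A := H) (B := B)).toLinearMap ∘ₗ ract b)
      (Coalgebra.comul x * Coalgebra.comul y) := by
    rw [cross, conv_apply, Bialgebra.comul_mul]
  have l : ((rightOpHom h).toLinearMap b * (mulLeftH K H B).toLinearMap x) (y ⊗ₜ c) =
      rightOp ract b ((x * y) ⊗ₜ c) := by
    simp [rightOpHom, mulLeftH]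
  rw [l, rightOp_tmul, e, conv_apply]
  generalize Coalgebra.comul (R := K) x = s
  induction s with
  | zero => simp
  | add s t hs ht => simp only [add_mul, map_add, hs, ht, LinearMap.add_apply]
  | tmul x₁ x₂ =>
    simp only [mulMap_tmul, AlgHom.toLinearMap_apply, LinearMap.comp_apply, Module.End.mul_apply,
      rightOpHom, AlgHom.ofLinearMap_apply, rightOp_tmul, cross, conv_apply]
    generalize Coalgebra.comul (R := K) y = t
    induction t with
    | zero => simp
    | add s t hs ht => simp only [mul_add, add_mul, map_add, hs, ht]
    | tmul y₁ y₂ => simp [mulLeftH, h.act_mul]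

/-- A module algebra structure gives a representation of `H` on `A`. -/
def actHom {act : H →ₗ[K] A →ₗ[K] A} (h : IsLeftModuleAlgebra act) : H →ₐ[K] Module.End K A :=
  AlgHom.ofLinearMap act (LinearMap.ext h.one_act) fun x y => LinearMap.ext (h.mul_act x y)

theorem leftSmashRel_lmul {act : H →ₗ[K] A →ₗ[K] A} (h : IsLeftModuleAlgebra act) :
    LeftSmashRel act (actHom h).toLinearMap (Algebra.lmul K A).toLinearMap := by
  intro x a
  ext a'
  simp only [AlgHom.toLinearMap_apply, actHom, AlgHom.ofLinearMap_apply, Module.End.mul_apply,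
    Algebra.coe_lmul_eq_mul, LinearMap.mul_apply_apply, h.act_mul, conv_apply]
  generalize Coalgebra.comul (R := K) x = s
  induction s with
  | zero => simp
  | add s t hs ht => simp only [map_add, hs, ht, LinearMap.add_apply]
  | tmul x₁ x₂ => simp

variable {act : H →ₗ[K] A →ₗ[K] A} {ract : B →ₗ[K] H →ₗ[K] B}

/-- Left multiplication by elements of `A` on `A # H # B`. -/
def opA (K H A B : Type*) [Field K] [Ring H] [Bialgebra K H] [Ring A] [Algebra K A] [Ring B]
    [Algebra K B] : A →ₐ[K] Module.End K (A ⊗[K] (H ⊗[K] B)) :=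
  (Module.End.rTensorAlgHom K A (H ⊗[K] B)).comp (Algebra.lmul K A)

theorem rTensorAlgHom_apply {M N : Type*} [AddCommMonoid M] [Module K M] [AddCommMonoid N]
    [Module K N] (f : Module.End K M) : Module.End.rTensorAlgHom K M N f = f.rTensor N := rfl

theorem lTensorAlgHom_apply {M N : Type*} [AddCommMonoid M] [Module K M] [AddCommMonoid N]
    [Module K N] (f : Module.End K M) : Module.End.lTensorAlgHom K M N f = f.lTensor N := rfl

theorem commute_rTensor_lTensor {M N : Type*} [AddCommMonoid M] [Module K M] [AddCommMonoid N]
    [Module K N] (f : Module.End K M) (g : Module.End K N) :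
    Commute (Module.End.rTensorAlgHom K M N f) (Module.End.lTensorAlgHom K N M g) :=
  TensorProduct.ext' fun m n => by
    simp only [Module.End.mul_apply, rTensorAlgHom_apply, lTensorAlgHom_apply,
      LinearMap.rTensor_tmul, LinearMap.lTensor_tmul]

variable (B) in
/-- The action of `H` on the factor `A` of `A ⊗ H ⊗ B`. -/
def opH₁ (h : IsLeftModuleAlgebra act) : H →ₐ[K] Module.End K (A ⊗[K] (H ⊗[K] B)) :=
  (Module.End.rTensorAlgHom K A (H ⊗[K] B)).comp (actHom h)

/-- Left multiplication by `x ∈ H` on the factor `H` of `A ⊗ H ⊗ B`. -/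
def opH₂ (K H A B : Type*) [Field K] [Ring H] [Bialgebra K H] [Ring A] [Algebra K A] [Ring B]
    [Algebra K B] : H →ₐ[K] Module.End K (A ⊗[K] (H ⊗[K] B)) :=
  (Module.End.lTensorAlgHom K (H ⊗[K] B) A).comp (mulLeftH K H B)

theorem commute_opH₁_opH₂ (h : IsLeftModuleAlgebra act) (x y : H) :
    Commute (opH₁ B h x) (opH₂ K H A B y) :=
  commute_rTensor_lTensor _ _

variable (B) in
/-- Left multiplication by elements of `H` on `A # H # B`: `x₁` acts on `A` and `x₂` multiplies the
factor `H`. -/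
def opH (h : IsLeftModuleAlgebra act) : H →ₐ[K] Module.End K (A ⊗[K] (H ⊗[K] B)) :=
  convAlgHom (opH₁ B h) (opH₂ K H A B) (commute_opH₁_opH₂ h)

variable (A) in
/-- Left multiplication by elements of `B` on `A # H # B`. -/
def opB (h : IsRightModuleAlgebra ract) : B →ₐ[K] Module.End K (A ⊗[K] (H ⊗[K] B)) :=
  (Module.End.lTensorAlgHom K (H ⊗[K] B) A).comp (rightOpHom h)

theorem leftSmashRel_op (h : IsLeftModuleAlgebra act) :
    LeftSmashRel act (opH B h).toLinearMap (opA K H A B).toLinearMap := by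
  rw [opH, convAlgHom_toLinearMap]
  exact ((leftSmashRel_lmul h).map (Module.End.rTensorAlgHom K A (H ⊗[K] B))).conv_of_commute
    fun _ _ => (commute_rTensor_lTensor _ _).symm

theorem rightSmashRel_op (hact : IsLeftModuleAlgebra act) (h : IsRightModuleAlgebra ract) :
    RightSmashRel ract (opH B hact).toLinearMap (opB A h).toLinearMap := by
  rw [opH, convAlgHom_toLinearMap]
  exact ((rightSmashRel_rightOp h).map (Module.End.lTensorAlgHom K (H ⊗[K] B) A)).conv_of_commute
    fun _ _ => commute_rTensor_lTensor _ _

/-- The smash product by `s` on the left is the operator that the operators of `A`, `H` and `B`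
assign to `s`. -/
theorem smashLift_op_apply (hact : IsLeftModuleAlgebra act) (hract : IsRightModuleAlgebra ract)
    (s t : A ⊗[K] (H ⊗[K] B)) :
    smashLift (opA K H A B).toLinearMap (opH B hact).toLinearMap (opB A hract).toLinearMap s t =
      smashMul act ract (s ⊗ₜ t) := by
  induction s with
  | zero => simp
  | add s₁ s₂ h₁ h₂ => simp only [map_add, add_tmul, LinearMap.add_apply, h₁, h₂]
  | tmul a u =>
  induction u with
  | zero => simp
  | add s₁ s₂ h₁ h₂ => simp only [map_add, add_tmul, tmul_add, LinearMap.add_apply, h₁, h₂]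
  | tmul x b =>
  induction t with
  | zero => simp
  | add s₁ s₂ h₁ h₂ => simp only [map_add, tmul_add, h₁, h₂]
  | tmul a' u =>
  induction u with
  | zero => simp
  | add s₁ s₂ h₁ h₂ => simp only [map_add, tmul_add, h₁, h₂]
  | tmul x' b' =>
  have hx := (Coalgebra.Repr.arbitrary K x).eq
  have hx' := (Coalgebra.Repr.arbitrary K x').eq
  rw [smashMul_tmul act ract a a' x x' b b' _ _ _ _ _ _ hx.symm hx'.symm]
  simp only [smashLift_tmul, AlgHom.toLinearMap_apply, opH, opH₁, opH₂, opA, opB, convAlgHom_apply,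
    conv_apply, Module.End.mul_apply, AlgHom.comp_apply, Algebra.coe_lmul_eq_mul,
    lTensorAlgHom_apply, rTensorAlgHom_apply, LinearMap.lTensor_tmul, rightOpHom,
    AlgHom.ofLinearMap_apply, rightOp_tmul, cross, ← hx, ← hx', map_sum]
  simp [LinearMap.sum_apply, Finset.sum_mul, tmul_sum, mulLeftH, actHom, rTensorAlgHom_apply,
    lTensorAlgHom_apply, -Module.End.rTensorAlgHom_apply_apply,
    -Module.End.lTensorAlgHom_apply_apply]

/-- The two-sided smash product is associative, as left multiplication is a representation of it. -/
theorem smashMul_assoc (hact : IsLeftModuleAlgebra act) (hract : IsRightModuleAlgebra ract)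
    (s t u : A ⊗[K] (H ⊗[K] B)) :
    smashMul act ract (smashMul act ract (s ⊗ₜ t) ⊗ₜ u) =
      smashMul act ract (s ⊗ₜ smashMul act ract (t ⊗ₜ u)) := by
  simp only [← smashLift_op_apply hact hract]
  rw [smashLift_op_apply hact hract s t, smashLift_smashMul _ _ _ (leftSmashRel_op hact)
    (rightSmashRel_op hact hract) fun a b => commute_rTensor_lTensor _ _]
  rfl

theorem one_smashMul (hact : IsLeftModuleAlgebra act) (hract : IsRightModuleAlgebra ract)
    (s : A ⊗[K] (H ⊗[K] B)) : smashMul act ract ((1 ⊗ₜ (1 ⊗ₜ 1)) ⊗ₜ s) = s := by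
  rw [← smashLift_op_apply hact hract]
  simp

theorem smashMul_one (hact : IsLeftModuleAlgebra act) (hract : IsRightModuleAlgebra ract)
    (s : A ⊗[K] (H ⊗[K] B)) : smashMul act ract (s ⊗ₜ (1 ⊗ₜ (1 ⊗ₜ 1))) = s := by
  induction s with
  | zero => simp
  | add s₁ s₂ h₁ h₂ => simp only [map_add, add_tmul, h₁, h₂]
  | tmul a u =>
  induction u with
  | zero => simp
  | add s₁ s₂ h₁ h₂ => simp only [map_add, add_tmul, tmul_add, h₁, h₂]
  | tmul x b =>
  rw [smashMul_tmul act ract a 1 x 1 b 1 _ {()} _ _ (fun _ => 1) (fun _ => 1)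
    (Coalgebra.Repr.arbitrary K x).eq.symm (by simp [Algebra.TensorProduct.one_def])]
  conv_rhs => rw [← Coalgebra.sum_counit_smul (Coalgebra.Repr.arbitrary K x)]
  simp [hact.act_one, hract.act_one, sum_tmul, tmul_sum, smul_tmul]

end Operators

end

/-! ### The algebra `A # H # B` and its universal property -/

section

variable {K H A B : Type*} [Field K] [Ring H] [Bialgebra K H]
  [Ring A] [Algebra K A] [Ring B] [Algebra K B]
  {act : H →ₗ[K] A →ₗ[K] A} {ract : B →ₗ[K] H →ₗ[K] B}

theorem smashMul_smul_left (act : H →ₗ[K] A →ₗ[K] A) (ract : B →ₗ[K] H →ₗ[K] B) (r : K)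
    (s t : A ⊗[K] (H ⊗[K] B)) :
    smashMul act ract ((r • s) ⊗ₜ t) = r • smashMul act ract (s ⊗ₜ t) := by
  rw [← smul_tmul', map_smul]

theorem smashMul_smul_right (act : H →ₗ[K] A →ₗ[K] A) (ract : B →ₗ[K] H →ₗ[K] B) (r : K)
    (s t : A ⊗[K] (H ⊗[K] B)) :
    smashMul act ract (s ⊗ₜ (r • t)) = r • smashMul act ract (s ⊗ₜ t) := by
  rw [tmul_smul, map_smul]

/-- The vector space `A ⊗ H ⊗ B`, as a type of its own that carries the algebra structure of the
two-sided smash product `A # H # B` (and not the one of a tensor product of algebras). -/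
def Smash (_ : IsLeftModuleAlgebra act) (_ : IsRightModuleAlgebra ract) :=
  A ⊗[K] (H ⊗[K] B)

namespace Smash

variable (hact : IsLeftModuleAlgebra act) (hract : IsRightModuleAlgebra ract)

instance : AddCommGroup (Smash hact hract) :=
  inferInstanceAs (AddCommGroup (A ⊗[K] (H ⊗[K] B)))

instance : Module K (Smash hact hract) :=
  inferInstanceAs (Module K (A ⊗[K] (H ⊗[K] B)))

instance : Ring (Smash hact hract) where
  __ := (inferInstance : AddCommGroup (Smash hact hract))
  mul s t := smashMul act ract (s ⊗ₜ t)
  one := (1 : A) ⊗ₜ[K] ((1 : H) ⊗ₜ[K] (1 : B))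
  left_distrib s t u :=
    (congrArg (smashMul act ract) (tmul_add _ _ _)).trans (map_add (smashMul act ract) _ _)
  right_distrib s t u :=
    (congrArg (smashMul act ract) (add_tmul _ _ _)).trans (map_add (smashMul act ract) _ _)
  zero_mul s := (congrArg (smashMul act ract) (zero_tmul _ _)).trans (map_zero (smashMul act ract))
  mul_zero s := (congrArg (smashMul act ract) (tmul_zero _ _)).trans (map_zero (smashMul act ract))
  mul_assoc := smashMul_assoc hact hract
  one_mul := one_smashMul hact hract
  mul_one := smashMul_one hact hract

instance : Algebra K (Smash hact hract) :=
  Algebra.ofModule (smashMul_smul_left act ract) (smashMul_smul_right act ract)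

/-- The identity of `A ⊗ H ⊗ B`, seen as a linear isomorphism onto `A # H # B`. -/
def of : A ⊗[K] (H ⊗[K] B) ≃ₗ[K] Smash hact hract where
  toFun s := s
  invFun s := s
  map_add' _ _ := rfl
  map_smul' _ _ := rfl

theorem of_one : of hact hract (1 ⊗ₜ (1 ⊗ₜ 1)) = 1 := rfl

section Lift

variable {C : Type*} [Semiring C] [Algebra K C]

/-- The universal property of the two-sided smash product: `a ⊗ x ⊗ b ↦ α a * γ x * β b` is an
algebra map if `α`, `γ`, `β` are and satisfy the relations between `A`, `H` and `B`. -/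
def lift (α : A →ₐ[K] C) (γ : H →ₐ[K] C) (β : B →ₐ[K] C)
    (hα : LeftSmashRel act γ.toLinearMap α.toLinearMap)
    (hβ : RightSmashRel ract γ.toLinearMap β.toLinearMap)
    (hαβ : ∀ a b, Commute (α a) (β b)) : Smash hact hract →ₐ[K] C :=
  AlgHom.ofLinearMap
    (smashLift α.toLinearMap γ.toLinearMap β.toLinearMap ∘ₗ (of hact hract).symm.toLinearMap)
    (by
      rw [LinearMap.comp_apply, LinearEquiv.coe_coe, ← of_one, LinearEquiv.symm_apply_apply]
      simp)
    (fun s t => smashLift_smashMul α γ β hα hβ hαβ s t)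

theorem lift_of (α : A →ₐ[K] C) (γ : H →ₐ[K] C) (β : B →ₐ[K] C)
    (hα : LeftSmashRel act γ.toLinearMap α.toLinearMap)
    (hβ : RightSmashRel ract γ.toLinearMap β.toLinearMap)
    (hαβ : ∀ a b, Commute (α a) (β b)) (s : A ⊗[K] (H ⊗[K] B)) :
    lift hact hract α γ β hα hβ hαβ (of hact hract s) =
      smashLift α.toLinearMap γ.toLinearMap β.toLinearMap s := rfl

end Lift

/-- The left regular representation of `A # H # B`. -/
def leftRegular : Smash hact hract →ₐ[K] Module.End K (A ⊗[K] (H ⊗[K] B)) :=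
  lift hact hract (opA K H A B) (opH B hact) (opB A hract) (leftSmashRel_op hact)
    (rightSmashRel_op hact hract) fun _ _ => commute_rTensor_lTensor _ _

theorem leftRegular_of (s t : A ⊗[K] (H ⊗[K] B)) :
    leftRegular hact hract (of hact hract s) t = smashMul act ract (s ⊗ₜ t) :=
  smashLift_op_apply hact hract s t

theorem leftRegular_injective : Function.Injective (leftRegular hact hract) := by
  intro s t h
  have h1 : ∀ u : Smash hact hract, leftRegular hact hract u (1 ⊗ₜ (1 ⊗ₜ 1)) = u :=
    fun u => (leftRegular_of hact hract u _).trans (smashMul_one hact hract u)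
  rw [← h1 s, ← h1 t, h]

theorem leftRegular_of_tmul (a : A) (x : H) (b : B) :
    leftRegular hact hract (of hact hract (a ⊗ₜ (x ⊗ₜ b))) =
      opA K H A B a * (opH B hact x * opB A hract b) :=
  (lift_of hact hract _ _ _ _ _ _ _).trans (smashLift_tmul _ _ _ a x b)

/-- The inclusion `a ↦ a ⊗ 1 ⊗ 1` of `A` into `A # H # B`. -/
def inA : A →ₐ[K] Smash hact hract :=
  AlgHom.ofLinearMap ((of hact hract).toLinearMap ∘ₗ
      (TensorProduct.mk K A (H ⊗[K] B)).flip (1 ⊗ₜ 1)) (of_one hact hract)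
    (fun a a' => leftRegular_injective hact hract (by simp [leftRegular_of_tmul]))

/-- The inclusion `x ↦ 1 ⊗ x ⊗ 1` of `H` into `A # H # B`. -/
def inH : H →ₐ[K] Smash hact hract :=
  AlgHom.ofLinearMap ((of hact hract).toLinearMap ∘ₗ TensorProduct.mk K A (H ⊗[K] B) 1 ∘ₗ
      (TensorProduct.mk K H B).flip 1) (of_one hact hract)
    (fun a a' => leftRegular_injective hact hract (by simp [leftRegular_of_tmul]))

/-- The inclusion `b ↦ 1 ⊗ 1 ⊗ b` of `B` into `A # H # B`. -/
def inB : B →ₐ[K] Smash hact hract :=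
  AlgHom.ofLinearMap ((of hact hract).toLinearMap ∘ₗ TensorProduct.mk K A (H ⊗[K] B) 1 ∘ₗ
      TensorProduct.mk K H B 1) (of_one hact hract)
    (fun a a' => leftRegular_injective hact hract (by simp [leftRegular_of_tmul]))

theorem inA_apply (a : A) : inA hact hract a = of hact hract (a ⊗ₜ (1 ⊗ₜ 1)) := rfl

theorem inH_apply (x : H) : inH hact hract x = of hact hract (1 ⊗ₜ (x ⊗ₜ 1)) := rfl

theorem inB_apply (b : B) : inB hact hract b = of hact hract (1 ⊗ₜ (1 ⊗ₜ b)) := rfl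

section Lift

variable {C : Type*} [Semiring C] [Algebra K C] (α : A →ₐ[K] C) (γ : H →ₐ[K] C) (β : B →ₐ[K] C)
  (hα : LeftSmashRel act γ.toLinearMap α.toLinearMap)
  (hβ : RightSmashRel ract γ.toLinearMap β.toLinearMap) (hαβ : ∀ a b, Commute (α a) (β b))

@[simp]
theorem lift_inA (a : A) : lift hact hract α γ β hα hβ hαβ (inA hact hract a) = α a :=
  (smashLift_tmul _ _ _ a 1 1).trans (by simp)

@[simp]
theorem lift_inH (x : H) : lift hact hract α γ β hα hβ hαβ (inH hact hract x) = γ x :=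
  (smashLift_tmul _ _ _ 1 x 1).trans (by simp)

@[simp]
theorem lift_inB (b : B) : lift hact hract α γ β hα hβ hαβ (inB hact hract b) = β b :=
  (smashLift_tmul _ _ _ 1 1 b).trans (by simp)

end Lift

theorem leftRegular_inA (a : A) : leftRegular hact hract (inA hact hract a) = opA K H A B a :=
  lift_inA ..

theorem leftRegular_inH (x : H) : leftRegular hact hract (inH hact hract x) = opH B hact x :=
  lift_inH ..

theorem leftRegular_inB (b : B) : leftRegular hact hract (inB hact hract b) = opB A hract b :=
  lift_inB ..

theorem leftRegular_comp_inA :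
    (leftRegular hact hract).toLinearMap ∘ₗ (inA hact hract).toLinearMap =
      (opA K H A B).toLinearMap :=
  LinearMap.ext (leftRegular_inA hact hract)

theorem leftRegular_comp_inH :
    (leftRegular hact hract).toLinearMap ∘ₗ (inH hact hract).toLinearMap =
      (opH B hact).toLinearMap :=
  LinearMap.ext (leftRegular_inH hact hract)

theorem leftRegular_comp_inB :
    (leftRegular hact hract).toLinearMap ∘ₗ (inB hact hract).toLinearMap =
      (opB A hract).toLinearMap :=
  LinearMap.ext (leftRegular_inB hact hract)

theorem of_tmul (a : A) (x : H) (b : B) : of hact hract (a ⊗ₜ (x ⊗ₜ b)) =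
    inA hact hract a * (inH hact hract x * inB hact hract b) :=
  leftRegular_injective hact hract (by
    simp [leftRegular_of_tmul, leftRegular_inA, leftRegular_inH, leftRegular_inB])

theorem leftSmashRel :
    LeftSmashRel act (inH hact hract).toLinearMap (inA hact hract).toLinearMap := by
  intro x a
  apply leftRegular_injective
  rw [map_mul, map_conv, ← LinearMap.comp_assoc, leftRegular_comp_inA, leftRegular_comp_inH,
    AlgHom.toLinearMap_apply, AlgHom.toLinearMap_apply, leftRegular_inA, leftRegular_inH]
  exact leftSmashRel_op hact x a

theorem rightSmashRel :
    RightSmashRel ract (inH hact hract).toLinearMap (inB hact hract).toLinearMap := by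
  intro b x
  apply leftRegular_injective
  rw [map_mul, map_conv, ← LinearMap.comp_assoc, leftRegular_comp_inB, leftRegular_comp_inH,
    AlgHom.toLinearMap_apply, AlgHom.toLinearMap_apply, leftRegular_inB, leftRegular_inH]
  exact rightSmashRel_op hact hract b x

theorem commute_inA_inB (a : A) (b : B) : Commute (inA hact hract a) (inB hact hract b) := by
  apply leftRegular_injective
  simp only [map_mul, leftRegular_inA, leftRegular_inB]
  exact commute_rTensor_lTensor _ _

variable {hact hract}

theorem linearMap_ext {M : Type*} [AddCommMonoid M] [Module K M] {f g : Smash hact hract →ₗ[K] M}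
    (h : ∀ a x b, f (of hact hract (a ⊗ₜ (x ⊗ₜ b))) = g (of hact hract (a ⊗ₜ (x ⊗ₜ b)))) :
    f = g := by
  have : f ∘ₗ (of hact hract).toLinearMap = g ∘ₗ (of hact hract).toLinearMap := by
    ext a x b
    exact h a x b
  exact LinearMap.ext fun s => LinearMap.congr_fun this s

theorem algHom_ext {C : Type*} [Semiring C] [Algebra K C] {f g : Smash hact hract →ₐ[K] C}
    (hA : ∀ a, f (inA hact hract a) = g (inA hact hract a))
    (hH : ∀ x, f (inH hact hract x) = g (inH hact hract x))
    (hB : ∀ b, f (inB hact hract b) = g (inB hact hract b)) : f = g := by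
  apply AlgHom.toLinearMap_injective
  apply linearMap_ext
  intro a x b
  simp [of_tmul, hA, hH, hB]

end Smash

/-- If `A ⊗ H ⊗ B` is a bialgebra, the smash coproduct and its counit are algebra maps on
`A # H # B`. -/
theorem SmashIsBialgebra.map_mul [Coalgebra K A] [Coalgebra K B] {ρ : A →ₗ[K] H ⊗[K] A}
    {ψ : B →ₗ[K] B ⊗[K] H} (hact : IsLeftModuleAlgebra act) (hract : IsRightModuleAlgebra ract)
    (h : SmashIsBialgebra act ρ ract ψ) :
    ∃ (Δ : Smash hact hract →ₐ[K] Smash hact hract ⊗[K] Smash hact hract)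
      (ε : Smash hact hract →ₐ[K] K),
      (∀ s, Δ (Smash.of hact hract s) = TensorProduct.map (Smash.of hact hract).toLinearMap
        (Smash.of hact hract).toLinearMap (smashComul ρ ψ s)) ∧
      ∀ s, ε (Smash.of hact hract s) = smashCounit K H A B s := by
  obtain ⟨W, _, _, e, hmul, hone, hcomul, hcounit⟩ := h
  let e' : Smash hact hract ≃ₐ[K] W :=
    AlgEquiv.ofLinearEquiv ((Smash.of hact hract).symm ≪≫ₗ e) hone hmul
  refine ⟨((Algebra.TensorProduct.congr e' e').symm : _ →ₐ[K] _).comp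
    ((Bialgebra.comulAlgHom K W).comp (e' : Smash hact hract →ₐ[K] W)),
    (Bialgebra.counitAlgHom K W).comp (e' : Smash hact hract →ₐ[K] W), fun s => ?_,
    fun s => (hcounit s).symm⟩
  rw [AlgHom.comp_apply, AlgEquiv.coe_toAlgHom, AlgEquiv.symm_apply_eq]
  refine (hcomul s).symm.trans ?_
  generalize smashComul ρ ψ s = t
  induction t with
  | zero => simp
  | add s t hs ht => simp only [map_add, hs, ht]
  | tmul s t => rfl

end

/-! ### The coproduct on generators -/

section

variable {K H A B : Type*} [Field K] [Ring H] [Bialgebra K H]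
  [Ring A] [Algebra K A] [Ring B] [Algebra K B]
  {act : H →ₗ[K] A →ₗ[K] A} {ract : B →ₗ[K] H →ₗ[K] B}

namespace Smash

variable (hact : IsLeftModuleAlgebra act) (hract : IsRightModuleAlgebra ract)

/-- `a ↦ a ⊗ 1` -/
def fstA : A →ₐ[K] Smash hact hract ⊗[K] Smash hact hract :=
  Algebra.TensorProduct.includeLeft.comp (inA hact hract)

/-- `x ↦ x ⊗ 1` -/
def fstH : H →ₐ[K] Smash hact hract ⊗[K] Smash hact hract :=
  Algebra.TensorProduct.includeLeft.comp (inH hact hract)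

/-- `x ↦ 1 ⊗ x` -/
def sndH : H →ₐ[K] Smash hact hract ⊗[K] Smash hact hract :=
  Algebra.TensorProduct.includeRight.comp (inH hact hract)

/-- `b ↦ 1 ⊗ b` -/
def sndB : B →ₐ[K] Smash hact hract ⊗[K] Smash hact hract :=
  Algebra.TensorProduct.includeRight.comp (inB hact hract)

/-- The inclusion `x ⊗ a ↦ x ⊗ a` of `H ⊗ A` into the tensor square of `A # H # B`. -/
def midA : H ⊗[K] A →ₐ[K] Smash hact hract ⊗[K] Smash hact hract :=
  Algebra.TensorProduct.map (inH hact hract) (inA hact hract)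

/-- The inclusion `b ⊗ x ↦ b ⊗ x` of `B ⊗ H` into the tensor square of `A # H # B`. -/
def midB : B ⊗[K] H →ₐ[K] Smash hact hract ⊗[K] Smash hact hract :=
  Algebra.TensorProduct.map (inB hact hract) (inH hact hract)

@[simp]
theorem fstA_apply (a : A) : fstA hact hract a = inA hact hract a ⊗ₜ 1 := rfl

@[simp]
theorem fstH_apply (x : H) : fstH hact hract x = inH hact hract x ⊗ₜ 1 := rfl

@[simp]
theorem sndH_apply (x : H) : sndH hact hract x = 1 ⊗ₜ inH hact hract x := rfl

@[simp]
theorem sndB_apply (b : B) : sndB hact hract b = 1 ⊗ₜ inB hact hract b := rfl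

@[simp]
theorem midA_tmul (x : H) (a : A) :
    midA hact hract (x ⊗ₜ a) = inH hact hract x ⊗ₜ inA hact hract a := rfl

@[simp]
theorem midB_tmul (b : B) (x : H) :
    midB hact hract (b ⊗ₜ x) = inB hact hract b ⊗ₜ inH hact hract x := rfl

theorem commute_fstH_sndH (x y : H) : Commute (fstH hact hract x) (sndH hact hract y) := by
  simp [Commute, SemiconjBy]

/-- The comultiplication `x ↦ x₁ ⊗ x₂` of the factor `H` of `A # H # B`. -/
def deltaH : H →ₐ[K] Smash hact hract ⊗[K] Smash hact hract :=
  convAlgHom (fstH hact hract) (sndH hact hract) (commute_fstH_sndH hact hract)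

theorem toLinearMap_deltaH : (deltaH hact hract).toLinearMap =
    conv (fstH hact hract).toLinearMap (sndH hact hract).toLinearMap :=
  convAlgHom_toLinearMap _ _ _

variable [Coalgebra K A] [Coalgebra K B] (ρ : A →ₗ[K] H ⊗[K] A) (ψ : B →ₗ[K] B ⊗[K] H)

/-- The comultiplication `a ↦ a₁ (a₂)₋₁ ⊗ (a₂)₀` of the factor `A` of `A # H # B`, as the
convolution product of `a ↦ a ⊗ 1` and `a ↦ a₋₁ ⊗ a₀`. -/
def deltaA : A →ₗ[K] Smash hact hract ⊗[K] Smash hact hract :=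
  conv (fstA hact hract).toLinearMap ((midA hact hract).toLinearMap ∘ₗ ρ)

/-- The comultiplication `b ↦ (b₁)₍₀₎ ⊗ (b₁)₍₁₎ b₂` of the factor `B` of `A # H # B`, as the
convolution product of `b ↦ b₍₀₎ ⊗ b₍₁₎` and `b ↦ 1 ⊗ b`. -/
def deltaB : B →ₗ[K] Smash hact hract ⊗[K] Smash hact hract :=
  conv ((midB hact hract).toLinearMap ∘ₗ ψ) (sndB hact hract).toLinearMap

set_option maxHeartbeats 1000000 in
/-- The smash coproduct is determined by its values on `A`, `H` and `B`:
`Δ (a ⊗ x ⊗ b) = Δ a * Δ x * Δ b`. -/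
theorem smashComul_eq (s : A ⊗[K] (H ⊗[K] B)) :
    TensorProduct.map (of hact hract).toLinearMap (of hact hract).toLinearMap (smashComul ρ ψ s) =
      smashLift (deltaA hact hract ρ) (deltaH hact hract).toLinearMap (deltaB hact hract ψ) s := by
  induction s with
  | zero => simp
  | add s t hs ht => simp only [map_add, hs, ht]
  | tmul a u =>
  induction u with
  | zero => simp
  | add s t hs ht => simp only [map_add, tmul_add, hs, ht]
  | tmul x b =>
  simp only [smashLift_tmul, smashComul, deltaA, deltaB, deltaH, convAlgHom_toLinearMap, conv_apply,
    LinearMap.comp_apply, TensorProduct.map_tmul, LinearEquiv.coe_coe]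
  generalize Coalgebra.comul (R := K) a = s
  generalize Coalgebra.comul (R := K) x = t
  generalize Coalgebra.comul (R := K) b = r
  induction s with
  | zero => simp
  | add s₁ s₂ h₁ h₂ => simp only [map_add, add_tmul, add_mul, h₁, h₂]
  | tmul a₁ a₂ =>
  induction t with
  | zero => simp
  | add s₁ s₂ h₁ h₂ => simp only [map_add, add_tmul, tmul_add, add_mul, mul_add, h₁, h₂]
  | tmul x₁ x₂ =>
  induction r with
  | zero => simp
  | add s₁ s₂ h₁ h₂ => simp only [map_add, tmul_add, mul_add, h₁, h₂]
  | tmul b₁ b₂ =>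
  simp only [mulMap_tmul, LinearMap.lTensor_tmul, LinearMap.rTensor_tmul, LinearMap.comp_apply]
  generalize ρ a₂ = p
  generalize ψ b₁ = q
  induction p with
  | zero => simp
  | add s₁ s₂ h₁ h₂ => simp only [map_add, add_tmul, tmul_add, add_mul, mul_add, h₁, h₂]
  | tmul h c =>
  induction q with
  | zero => simp
  | add s₁ s₂ h₁ h₂ => simp only [map_add, add_tmul, tmul_add, add_mul, mul_add, h₁, h₂]
  | tmul d k => simp [mergeH, of_tmul, mul_assoc]

theorem map_of_smashComul_tmul (a : A) (x : H) (b : B) :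
    TensorProduct.map (of hact hract).toLinearMap (of hact hract).toLinearMap
      (smashComul ρ ψ (a ⊗ₜ (x ⊗ₜ b))) =
      deltaA hact hract ρ a * (deltaH hact hract x * deltaB hact hract ψ b) :=
  (smashComul_eq hact hract ρ ψ _).trans (smashLift_tmul _ _ _ a x b)

end Smash

end

/-! ### Relations between the coproducts of generators -/

section

section MulMap

variable {K M N P C : Type*} [Field K] [AddCommMonoid M] [Module K M] [AddCommMonoid N]
  [Module K N] [AddCommMonoid P] [Module K P] [Semiring C] [Algebra K C]

theorem mulMap_lTensor (f : M →ₗ[K] C) (g : N →ₗ[K] C) (h : P →ₗ[K] N) (t : M ⊗[K] P) :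
    mulMap f g (h.lTensor M t) = mulMap f (g ∘ₗ h) t := by
  induction t with
  | zero => simp
  | add s t hs ht => simp only [map_add, hs, ht]
  | tmul m p => simp

theorem mulMap_rTensor (f : M →ₗ[K] C) (g : N →ₗ[K] C) (h : P →ₗ[K] M) (t : P ⊗[K] N) :
    mulMap f g (h.rTensor N t) = mulMap (f ∘ₗ h) g t := by
  induction t with
  | zero => simp
  | add s t hs ht => simp only [map_add, hs, ht]
  | tmul m p => simp

end MulMap

variable {K H A B : Type*} [Field K] [Ring H] [Bialgebra K H]
  [Ring A] [Algebra K A] [Ring B] [Algebra K B]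
  {act : H →ₗ[K] A →ₗ[K] A} {ract : B →ₗ[K] H →ₗ[K] B}
  {ρ : A →ₗ[K] H ⊗[K] A} {ψ : B →ₗ[K] B ⊗[K] H}

/-- A multiplicative left coaction, as an algebra map. -/
def leftCoactHom (h1 : LeftCoactOne ρ) (hm : LeftCoactMul ρ) : A →ₐ[K] H ⊗[K] A :=
  AlgHom.ofLinearMap ρ h1 hm

/-- A multiplicative right coaction, as an algebra map. -/
def rightCoactHom (h1 : RightCoactOne ψ) (hm : RightCoactMul ψ) : B →ₐ[K] B ⊗[K] H :=
  AlgHom.ofLinearMap ψ h1 hm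

namespace Smash

variable (hact : IsLeftModuleAlgebra act) (hract : IsRightModuleAlgebra ract)

/-- `a ↦ 1 ⊗ a` -/
def sndA : A →ₐ[K] Smash hact hract ⊗[K] Smash hact hract :=
  Algebra.TensorProduct.includeRight.comp (inA hact hract)

/-- `b ↦ b ⊗ 1` -/
def fstB : B →ₐ[K] Smash hact hract ⊗[K] Smash hact hract :=
  Algebra.TensorProduct.includeLeft.comp (inB hact hract)

@[simp]
theorem sndA_apply (a : A) : sndA hact hract a = 1 ⊗ₜ inA hact hract a := rfl

@[simp]
theorem fstB_apply (b : B) : fstB hact hract b = inB hact hract b ⊗ₜ 1 := rfl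

theorem leftSmashRel_fst :
    LeftSmashRel act (fstH hact hract).toLinearMap (fstA hact hract).toLinearMap :=
  (leftSmashRel hact hract).map
    (Algebra.TensorProduct.includeLeft : Smash hact hract →ₐ[K] _ ⊗[K] Smash hact hract)

theorem leftSmashRel_snd :
    LeftSmashRel act (sndH hact hract).toLinearMap (sndA hact hract).toLinearMap :=
  (leftSmashRel hact hract).map
    (Algebra.TensorProduct.includeRight : Smash hact hract →ₐ[K] Smash hact hract ⊗[K] _)

theorem rightSmashRel_fst :
    RightSmashRel ract (fstH hact hract).toLinearMap (fstB hact hract).toLinearMap :=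
  (rightSmashRel hact hract).map
    (Algebra.TensorProduct.includeLeft : Smash hact hract →ₐ[K] _ ⊗[K] Smash hact hract)

theorem rightSmashRel_snd :
    RightSmashRel ract (sndH hact hract).toLinearMap (sndB hact hract).toLinearMap :=
  (rightSmashRel hact hract).map
    (Algebra.TensorProduct.includeRight : Smash hact hract →ₐ[K] Smash hact hract ⊗[K] _)

/-- The algebra map `s ⊗ t ↦ Δ s ⊗ t`, reassociated. -/
def comulLeft (Δ : Smash hact hract →ₐ[K] Smash hact hract ⊗[K] Smash hact hract) :
    Smash hact hract ⊗[K] Smash hact hract →ₐ[K]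
      Smash hact hract ⊗[K] (Smash hact hract ⊗[K] Smash hact hract) :=
  (Algebra.TensorProduct.assoc K K K _ _ _).toAlgHom.comp
    (Algebra.TensorProduct.map Δ (.id K (Smash hact hract)))

theorem comulLeft_tmul (Δ : Smash hact hract →ₐ[K] Smash hact hract ⊗[K] Smash hact hract)
    (s t : Smash hact hract) :
    comulLeft hact hract Δ (s ⊗ₜ t) = TensorProduct.assoc K _ _ _ (Δ s ⊗ₜ t) := rfl

section Exchange

/-! For `t = ρ c`, coassociativity of the coaction turns the right-hand side of `midA_mul_fstA` into
`((c₋₁ ▷ a) ⊗ 1) * ρ c₀`, the exchange rule that `conv_mul_of_leftBraided` asks for; likewise for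
`sndB_mul_midB`. -/

theorem midA_mul_fstA (t : H ⊗[K] A) (a : A) : midA hact hract t * fstA hact hract a =
    mulMap ((fstA hact hract).toLinearMap ∘ₗ act.flip a) (midA hact hract).toLinearMap
      (TensorProduct.assoc K H H A ((Coalgebra.comul (R := K) (A := H)).rTensor A t)) := by
  induction t with
  | zero => simp
  | add s t hs ht => simp only [map_add, add_mul, hs, ht]
  | tmul x c =>
    have h := leftSmashRel hact hract x a
    simp only [AlgHom.toLinearMap_apply, conv_apply] at h
    simp only [midA_tmul, fstA_apply, Algebra.TensorProduct.tmul_mul_tmul, mul_one, h,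
      LinearMap.rTensor_tmul]
    generalize Coalgebra.comul (R := K) x = u
    induction u with
    | zero => simp
    | add s t hs ht => simp only [map_add, add_tmul, hs, ht]
    | tmul y z => simp

theorem sndB_mul_midB (t : B ⊗[K] H) (b : B) : sndB hact hract b * midB hact hract t =
    mulMap (midB hact hract).toLinearMap ((sndB hact hract).toLinearMap ∘ₗ ract b)
      ((TensorProduct.assoc K B H H).symm
        ((Coalgebra.comul (R := K) (A := H)).lTensor B t)) := by
  induction t with
  | zero => simp
  | add s t hs ht => simp only [map_add, mul_add, hs, ht]
  | tmul c x =>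
    have h := rightSmashRel hact hract b x
    simp only [AlgHom.toLinearMap_apply, conv_apply] at h
    simp only [midB_tmul, sndB_apply, Algebra.TensorProduct.tmul_mul_tmul, one_mul, h,
      LinearMap.lTensor_tmul]
    generalize Coalgebra.comul (R := K) x = u
    induction u with
    | zero => simp
    | add s t hs ht => simp only [map_add, tmul_add, hs, ht]
    | tmul y z => simp

end Exchange

section DeltaHRel

theorem leftSmashRel_deltaH_fstA :
    LeftSmashRel act (deltaH hact hract).toLinearMap (fstA hact hract).toLinearMap := by
  rw [toLinearMap_deltaH]
  exact (leftSmashRel_fst hact hract).conv_of_commute fun x a => by simp [Commute, SemiconjBy]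

theorem rightSmashRel_deltaH_sndB :
    RightSmashRel ract (deltaH hact hract).toLinearMap (sndB hact hract).toLinearMap := by
  rw [toLinearMap_deltaH]
  exact (rightSmashRel_snd hact hract).conv_of_commute fun x a => by simp [Commute, SemiconjBy]

/-- Moving `x` past `H ⊗ A` gives the right-hand side of the Yetter-Drinfeld condition. -/
theorem deltaH_mul_midA (x : H) (t : H ⊗[K] A) : deltaH hact hract x * midA hact hract t =
    conv ((midA hact hract).toLinearMap ∘ₗ
      TensorProduct.map (LinearMap.mul' K H) (TensorProduct.lift act) ∘ₗ
      (TensorProduct.tensorTensorTensorComm K H H H A).toLinearMap ∘ₗ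
      (TensorProduct.mk K (H ⊗[K] H) (H ⊗[K] A)).flip t ∘ₗ Coalgebra.comul)
      (sndH hact hract).toLinearMap x := by
  induction t with
  | zero => simp [conv, mulMap]
  | add s t hs ht =>
    simp only [map_add, mul_add, hs, ht, conv, mulMap, LinearMap.add_comp, LinearMap.comp_add,
      TensorProduct.map_add_left, LinearMap.add_apply]
  | tmul h c =>
    have e : (midA hact hract).toLinearMap ∘ₗ
        TensorProduct.map (LinearMap.mul' K H) (TensorProduct.lift act) ∘ₗ
        (TensorProduct.tensorTensorTensorComm K H H H A).toLinearMap ∘ₗ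
        (TensorProduct.mk K (H ⊗[K] H) (H ⊗[K] A)).flip (h ⊗ₜ c) =
          mulMap (LinearMap.mulRight K (fstH hact hract h) ∘ₗ (fstH hact hract).toLinearMap)
            ((sndA hact hract).toLinearMap ∘ₗ act.flip c) :=
      TensorProduct.ext' fun y z => by simp
    have e' : (midA hact hract).toLinearMap ∘ₗ
        TensorProduct.map (LinearMap.mul' K H) (TensorProduct.lift act) ∘ₗ
        (TensorProduct.tensorTensorTensorComm K H H H A).toLinearMap ∘ₗ
        (TensorProduct.mk K (H ⊗[K] H) (H ⊗[K] A)).flip (h ⊗ₜ c) ∘ₗ Coalgebra.comul =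
          conv (LinearMap.mulRight K (fstH hact hract h) ∘ₗ (fstH hact hract).toLinearMap)
            ((sndA hact hract).toLinearMap ∘ₗ act.flip c) :=
      congrArg (fun l => l ∘ₗ (Coalgebra.comul : H →ₗ[K] H ⊗[K] H)) e
    have e2 : LinearMap.mulRight K (midA hact hract (h ⊗ₜ c)) ∘ₗ (sndH hact hract).toLinearMap =
        LinearMap.mulLeft K (fstH hact hract h) ∘ₗ
          LinearMap.mulRight K ((sndA hact hract).toLinearMap c) ∘ₗ
            (sndH hact hract).toLinearMap := by
      ext y
      simp
    rw [e', ← AlgHom.toLinearMap_apply (deltaH hact hract), toLinearMap_deltaH, conv_mul, e2,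
      (leftSmashRel_snd hact hract).mulRight, conv_mulLeft, conv_assoc]

/-- Moving `x` past `B ⊗ H` gives the right-hand side of the Yetter-Drinfeld condition. -/
theorem midB_mul_deltaH (x : H) (t : B ⊗[K] H) : midB hact hract t * deltaH hact hract x =
    conv (fstH hact hract).toLinearMap ((midB hact hract).toLinearMap ∘ₗ
      TensorProduct.map (TensorProduct.lift ract) (LinearMap.mul' K H) ∘ₗ
      (TensorProduct.tensorTensorTensorComm K B H H H).toLinearMap ∘ₗ
      (TensorProduct.mk K (B ⊗[K] H) (H ⊗[K] H)) t ∘ₗ Coalgebra.comul) x := by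
  induction t with
  | zero => simp [conv, mulMap]
  | add s t hs ht =>
    simp only [map_add, add_mul, hs, ht, conv, mulMap, LinearMap.add_comp, LinearMap.comp_add,
      TensorProduct.map_add_right, LinearMap.add_apply]
  | tmul d k =>
    have e : (midB hact hract).toLinearMap ∘ₗ
        TensorProduct.map (TensorProduct.lift ract) (LinearMap.mul' K H) ∘ₗ
        (TensorProduct.tensorTensorTensorComm K B H H H).toLinearMap ∘ₗ
        (TensorProduct.mk K (B ⊗[K] H) (H ⊗[K] H)) (d ⊗ₜ k) =
          mulMap ((fstB hact hract).toLinearMap ∘ₗ ract d)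
            (LinearMap.mulLeft K (sndH hact hract k) ∘ₗ (sndH hact hract).toLinearMap) :=
      TensorProduct.ext' fun y z => by simp
    have e' : (midB hact hract).toLinearMap ∘ₗ
        TensorProduct.map (TensorProduct.lift ract) (LinearMap.mul' K H) ∘ₗ
        (TensorProduct.tensorTensorTensorComm K B H H H).toLinearMap ∘ₗ
        (TensorProduct.mk K (B ⊗[K] H) (H ⊗[K] H)) (d ⊗ₜ k) ∘ₗ Coalgebra.comul =
          conv ((fstB hact hract).toLinearMap ∘ₗ ract d)
            (LinearMap.mulLeft K (sndH hact hract k) ∘ₗ (sndH hact hract).toLinearMap) :=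
      congrArg (fun l => l ∘ₗ (Coalgebra.comul : H →ₗ[K] H ⊗[K] H)) e
    have e2 : LinearMap.mulLeft K (midB hact hract (d ⊗ₜ k)) ∘ₗ (fstH hact hract).toLinearMap =
        LinearMap.mulRight K (sndH hact hract k) ∘ₗ
          LinearMap.mulLeft K ((fstB hact hract).toLinearMap d) ∘ₗ
            (fstH hact hract).toLinearMap := by
      ext y
      simp
    rw [e', ← AlgHom.toLinearMap_apply (deltaH hact hract), toLinearMap_deltaH, mul_conv, e2,
      (rightSmashRel_fst hact hract).mulLeft, ← conv_mulLeft, conv_assoc]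

theorem leftSmashRel_deltaH_midA (h : LeftYetterDrinfeld act ρ) :
    LeftSmashRel act (deltaH hact hract).toLinearMap
      ((midA hact hract).toLinearMap ∘ₗ ρ) := by
  intro x a
  have e : (midA hact hract).toLinearMap ∘ₗ
      TensorProduct.map (LinearMap.mul' K H) (TensorProduct.lift act) ∘ₗ
      (TensorProduct.tensorTensorTensorComm K H H H A).toLinearMap ∘ₗ
      (TensorProduct.mk K (H ⊗[K] H) (H ⊗[K] A)).flip (ρ a) ∘ₗ Coalgebra.comul =
        conv (((midA hact hract).toLinearMap ∘ₗ ρ) ∘ₗ act.flip a)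
          (fstH hact hract).toLinearMap := by
    ext y
    refine (congrArg (midA hact hract) (h y a).symm).trans ?_
    rw [conv_apply]
    generalize Coalgebra.comul (R := K) y = t
    induction t with
    | zero => simp
    | add s t hs ht => simp only [map_add, hs, ht]
    | tmul y z =>
      have hz : midA hact hract (z ⊗ₜ (1 : A)) = fstH hact hract z := by simp
      simp [hz]
  refine (deltaH_mul_midA hact hract x (ρ a)).trans ?_
  rw [e, conv_assoc, toLinearMap_deltaH]

theorem rightSmashRel_deltaH_midB (h : RightYetterDrinfeld ract ψ) :
    RightSmashRel ract (deltaH hact hract).toLinearMap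
      ((midB hact hract).toLinearMap ∘ₗ ψ) := by
  intro b x
  have e : (midB hact hract).toLinearMap ∘ₗ
      TensorProduct.map (TensorProduct.lift ract) (LinearMap.mul' K H) ∘ₗ
      (TensorProduct.tensorTensorTensorComm K B H H H).toLinearMap ∘ₗ
      (TensorProduct.mk K (B ⊗[K] H) (H ⊗[K] H)) (ψ b) ∘ₗ Coalgebra.comul =
        conv (sndH hact hract).toLinearMap
          (((midB hact hract).toLinearMap ∘ₗ ψ) ∘ₗ ract b) := by
    ext y
    refine (congrArg (midB hact hract) (h b y).symm).trans ?_
    rw [conv_apply]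
    generalize Coalgebra.comul (R := K) y = t
    induction t with
    | zero => simp
    | add s t hs ht => simp only [map_add, hs, ht]
    | tmul y z =>
      have hz : midB hact hract ((1 : B) ⊗ₜ y) = sndH hact hract y := by simp
      simp [hz]
  refine (midB_mul_deltaH hact hract x (ψ b)).trans ?_
  rw [e, ← conv_assoc, toLinearMap_deltaH]

end DeltaHRel

section Majid

/-- The linear map `(x ⊗ c) ⊗ (d ⊗ y) ↦ (d ◁ x) ⊗ (y ▷ c)` to the tensor square of `A # H # B`. It
is written with the flips and the maps that occur in `MajidCondition`. -/
def braid : (H ⊗[K] A) ⊗[K] (B ⊗[K] H) →ₗ[K] Smash hact hract ⊗[K] Smash hact hract :=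
  TensorProduct.map (inB hact hract).toLinearMap (inA hact hract).toLinearMap ∘ₗ
    (TensorProduct.comm K A B).toLinearMap ∘ₗ
    TensorProduct.map (TensorProduct.lift act) (TensorProduct.lift ract) ∘ₗ
    (TensorProduct.comm K (B ⊗[K] H) (H ⊗[K] A)).toLinearMap ∘ₗ
    (TensorProduct.tensorTensorTensorComm K B H H A).toLinearMap ∘ₗ
    (TensorProduct.comm K (H ⊗[K] A) (B ⊗[K] H)).toLinearMap

theorem braid_tmul (x y : H) (c : A) (d : B) : braid hact hract ((x ⊗ₜ c) ⊗ₜ (d ⊗ₜ y)) =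
    inB hact hract (ract d x) ⊗ₜ inA hact hract (act y c) := by
  simp [braid]

theorem braid_coact (h : MajidCondition act ρ ract ψ) (a : A) (b : B) :
    braid hact hract (ρ a ⊗ₜ ψ b) = inB hact hract b ⊗ₜ inA hact hract a := by
  simp [braid, h a b]

/-- The linear map `(x ⊗ q) ⊗ (p ⊗ y) ↦ (x ⊗ 1) * braid (q ⊗ p) * (1 ⊗ y)`. -/
def wrapBraid : (H ⊗[K] (H ⊗[K] A)) ⊗[K] ((B ⊗[K] H) ⊗[K] H) →ₗ[K]
    Smash hact hract ⊗[K] Smash hact hract :=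
  mulMap (mulMap (fstH hact hract).toLinearMap (braid hact hract) ∘ₗ
      (TensorProduct.assoc K H (H ⊗[K] A) (B ⊗[K] H)).toLinearMap)
    (sndH hact hract).toLinearMap ∘ₗ
    (TensorProduct.assoc K (H ⊗[K] (H ⊗[K] A)) (B ⊗[K] H) H).symm.toLinearMap

theorem wrapBraid_tmul (x y : H) (q : H ⊗[K] A) (p : B ⊗[K] H) :
    wrapBraid hact hract ((x ⊗ₜ q) ⊗ₜ (p ⊗ₜ y)) =
      fstH hact hract x * braid hact hract (q ⊗ₜ p) * sndH hact hract y := by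
  simp [wrapBraid]

/-- Reordering `(d ⊗ k) * (h ⊗ c)` by the smash relations gives
`h₁ (d ◁ h₂) ⊗ (k₁ ▷ c) k₂`. -/
theorem midB_mul_midA (p : B ⊗[K] H) (q : H ⊗[K] A) :
    midB hact hract p * midA hact hract q = wrapBraid hact hract
      (TensorProduct.assoc K H H A ((Coalgebra.comul (R := K) (A := H)).rTensor A q) ⊗ₜ
        (TensorProduct.assoc K B H H).symm
          ((Coalgebra.comul (R := K) (A := H)).lTensor B p)) := by
  induction p with
  | zero => simp
  | add s t hs ht => simp only [map_add, add_mul, tmul_add, hs, ht]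
  | tmul d k =>
  induction q with
  | zero => simp
  | add s t hs ht => simp only [map_add, mul_add, add_tmul, hs, ht]
  | tmul h c =>
  have h1 := rightSmashRel hact hract d h
  have h2 := leftSmashRel hact hract k c
  simp only [AlgHom.toLinearMap_apply, conv_apply] at h1 h2
  simp only [midB_tmul, midA_tmul, Algebra.TensorProduct.tmul_mul_tmul, h1, h2,
      LinearMap.lTensor_tmul, LinearMap.rTensor_tmul]
  generalize Coalgebra.comul (R := K) h = u
  generalize Coalgebra.comul (R := K) k = v
  induction u with
  | zero => simp
  | add s t hs ht => simp only [map_add, add_tmul, hs, ht]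
  | tmul h₁ h₂ =>
  induction v with
  | zero => simp
  | add s t hs ht => simp only [map_add, tmul_add, hs, ht]
  | tmul k₁ k₂ => simp [wrapBraid_tmul, braid_tmul]

/-- Majid's condition, applied between the two outer factors of the reordered product. -/
theorem wrapBraid_coact (h : MajidCondition act ρ ract ψ) (p : B ⊗[K] H) (q : H ⊗[K] A) :
    wrapBraid hact hract (ρ.lTensor H q ⊗ₜ ψ.rTensor H p) =
      midA hact hract q * midB hact hract p := by
  induction p with
  | zero => simp
  | add s t hs ht => simp only [map_add, mul_add, tmul_add, hs, ht]
  | tmul d k =>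
  induction q with
  | zero => simp
  | add s t hs ht => simp only [map_add, add_mul, add_tmul, hs, ht]
  | tmul x c => simp [wrapBraid_tmul, braid_coact hact hract h]

variable [Coalgebra K A] [Coalgebra K B]

theorem commute_midB_midA (h : MajidCondition act ρ ract ψ) (hρ : IsLeftComoduleCoalgebra ρ)
    (hψ : IsRightComoduleCoalgebra ψ) (a : A) (b : B) :
    Commute (midB hact hract (ψ b)) (midA hact hract (ρ a)) := by
  rw [Commute, SemiconjBy, midB_mul_midA, ← hρ.coassoc, ← hψ.coassoc,
    LinearEquiv.symm_apply_apply, wrapBraid_coact hact hract h]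

theorem commute_deltaA_deltaB (h : MajidCondition act ρ ract ψ) (hρ : IsLeftComoduleCoalgebra ρ)
    (hψ : IsRightComoduleCoalgebra ψ) (a : A) (b : B) :
    Commute (deltaA hact hract ρ a) (deltaB hact hract ψ b) := by
  have h1 (p : B ⊗[K] H) (a : A) : Commute (midB hact hract p) (fstA hact hract a) := by
    induction p with
    | zero => simp
    | add s t hs ht => simpa using hs.add_left ht
    | tmul d k => simp [Commute, SemiconjBy, (commute_inA_inB hact hract a d).eq]
  have h2 (q : H ⊗[K] A) (b : B) : Commute (sndB hact hract b) (midA hact hract q) := by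
    induction q with
    | zero => simp
    | add s t hs ht => simpa using hs.add_right ht
    | tmul x c => simp [Commute, SemiconjBy, (commute_inA_inB hact hract c b).eq]
  refine commute_conv (fun b => (commute_conv ?_ ?_ a).symm)
    (fun b => (commute_conv ?_ ?_ a).symm) b
  · exact h1 (ψ b)
  · exact fun a => commute_midB_midA hact hract h hρ hψ a b
  · exact fun a => by simp [Commute, SemiconjBy]
  · exact fun a => h2 (ρ a) b

end Majid

section DeltaHom

variable [Coalgebra K A] [Coalgebra K B]

/-- The comultiplication `deltaA`, as an algebra map. -/
def deltaAHom (hρ : IsLeftComoduleCoalgebra ρ) (hc : ComulOne K A) (h1 : LeftCoactOne ρ)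
    (hm : LeftCoactMul ρ) (h : LeftBraidedComulMul act ρ) :
    A →ₐ[K] Smash hact hract ⊗[K] Smash hact hract :=
  AlgHom.ofLinearMap (deltaA hact hract ρ)
    (by
      have h1' : ρ 1 = 1 ⊗ₜ 1 := h1
      rw [deltaA, conv_apply, hc]
      simp [h1', Algebra.TensorProduct.one_def])
    (conv_mul_of_leftBraided h (fstA hact hract) ((midA hact hract).comp (leftCoactHom h1 hm))
      (fun c a => by
        refine (midA_mul_fstA hact hract (ρ c) a).trans ?_
        rw [← hρ.coassoc, mulMap_lTensor]
        rfl))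

/-- The comultiplication `deltaB`, as an algebra map. -/
def deltaBHom (hψ : IsRightComoduleCoalgebra ψ) (hc : ComulOne K B) (h1 : RightCoactOne ψ)
    (hm : RightCoactMul ψ) (h : RightBraidedComulMul ract ψ) :
    B →ₐ[K] Smash hact hract ⊗[K] Smash hact hract :=
  AlgHom.ofLinearMap (deltaB hact hract ψ)
    (by
      have h1' : ψ 1 = 1 ⊗ₜ 1 := h1
      rw [deltaB, conv_apply, hc]
      simp [h1', Algebra.TensorProduct.one_def])
    (conv_mul_of_rightBraided h ((midB hact hract).comp (rightCoactHom h1 hm)) (sndB hact hract)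
      (fun b c => by
        refine (sndB_mul_midB hact hract (ψ c) b).trans ?_
        rw [← hψ.coassoc, LinearEquiv.symm_apply_apply, mulMap_rTensor]
        rfl))

end DeltaHom

end Smash

end

/-! ### The comultiplication as an algebra map, coassociativity -/

section

variable {K H A B : Type*} [Field K] [Ring H] [Bialgebra K H]
  [Ring A] [Algebra K A] [Coalgebra K A] [Ring B] [Algebra K B] [Coalgebra K B]

/-- The conditions under which `A # H # B` with the smash coproduct is a bialgebra. -/
structure SmashConditions (act : H →ₗ[K] A →ₗ[K] A) (ρ : A →ₗ[K] H ⊗[K] A)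
    (ract : B →ₗ[K] H →ₗ[K] B) (ψ : B →ₗ[K] B ⊗[K] H) : Prop where
  counitA : CounitIsAlgebraMap K A
  counitB : CounitIsAlgebraMap K B
  comulOneA : ComulOne K A
  comulOneB : ComulOne K B
  leftCoactOne : LeftCoactOne ρ
  rightCoactOne : RightCoactOne ψ
  leftCounitAct : LeftCounitAct act
  rightCounitAct : RightCounitAct ract
  leftCoactMul : LeftCoactMul ρ
  rightCoactMul : RightCoactMul ψ
  leftYetterDrinfeld : LeftYetterDrinfeld act ρ
  rightYetterDrinfeld : RightYetterDrinfeld ract ψ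
  majid : MajidCondition act ρ ract ψ
  leftBraided : LeftBraidedComulMul act ρ
  rightBraided : RightBraidedComulMul ract ψ
  leftComulAct : LeftComulAct act
  rightComulAct : RightComulAct ract

/-- A multiplicative counit, as an algebra map. -/
def counitHom {A : Type*} [Ring A] [Algebra K A] [Coalgebra K A] (h : CounitIsAlgebraMap K A) :
    A →ₐ[K] K :=
  AlgHom.ofLinearMap Coalgebra.counit h.1 h.2

@[simp]
theorem counitHom_apply {A : Type*} [Ring A] [Algebra K A] [Coalgebra K A]
    (h : CounitIsAlgebraMap K A) (a : A) : counitHom h a = Coalgebra.counit a := rfl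

variable {act : H →ₗ[K] A →ₗ[K] A} {ract : B →ₗ[K] H →ₗ[K] B}
  {ρ : A →ₗ[K] H ⊗[K] A} {ψ : B →ₗ[K] B ⊗[K] H}

section ScalarRelations

variable {C : Type*} [Semiring C] [Algebra K C]

/-- The algebra map `a ↦ ε(a) 1`. -/
def scalarHom (C : Type*) [Semiring C] [Algebra K C] {A : Type*} [Ring A] [Algebra K A]
    [Coalgebra K A] (h : CounitIsAlgebraMap K A) : A →ₐ[K] C :=
  (Algebra.ofId K C).comp (counitHom h)

@[simp]
theorem scalarHom_apply {A : Type*} [Ring A] [Algebra K A] [Coalgebra K A]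
    (h : CounitIsAlgebraMap K A) (a : A) :
    scalarHom C h a = algebraMap K C (Coalgebra.counit a) := rfl

theorem leftSmashRel_scalarHom (h : LeftCounitAct act) (hA : CounitIsAlgebraMap K A)
    (γ : H →ₗ[K] C) : LeftSmashRel act γ (scalarHom C hA).toLinearMap := by
  intro x a
  have e : (scalarHom C hA).toLinearMap ∘ₗ act.flip a =
      LinearMap.mulLeft K (algebraMap K C (Coalgebra.counit a)) ∘ₗ
        (Algebra.linearMap K C ∘ₗ Coalgebra.counit) :=
    LinearMap.ext fun y => by simp [h y a]
  rw [e, conv_mulLeft_left, conv_counit_left (fun _ => rfl)]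
  exact (Algebra.commutes _ _).symm

theorem rightSmashRel_scalarHom (h : RightCounitAct ract) (hB : CounitIsAlgebraMap K B)
    (γ : H →ₗ[K] C) : RightSmashRel ract γ (scalarHom C hB).toLinearMap := by
  intro b x
  have e : (scalarHom C hB).toLinearMap ∘ₗ ract b =
      LinearMap.mulRight K (algebraMap K C (Coalgebra.counit b)) ∘ₗ
        (Algebra.linearMap K C ∘ₗ Coalgebra.counit) :=
    LinearMap.ext fun y => by simpa [h b y] using Algebra.commutes _ _
  rw [e, conv_mulRight_right, conv_counit_right (fun _ => rfl)]
  exact Algebra.commutes _ _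

theorem commute_scalarHom_left (hA : CounitIsAlgebraMap K A) (a : A) (c : C) :
    Commute (scalarHom C hA a) c :=
  Algebra.commute_algebraMap_left _ _

theorem commute_scalarHom_right (hA : CounitIsAlgebraMap K A) (a : A) (c : C) :
    Commute c (scalarHom C hA a) :=
  Algebra.commute_algebraMap_right _ _

end ScalarRelations

namespace Smash

variable (hact : IsLeftModuleAlgebra act) (hract : IsRightModuleAlgebra ract)
  (hρ : IsLeftComoduleCoalgebra ρ) (hψ : IsRightComoduleCoalgebra ψ)
  (h : SmashConditions act ρ ract ψ)

/-- The comultiplication of `A # H # B`, as an algebra map. -/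
def comulHom : Smash hact hract →ₐ[K] Smash hact hract ⊗[K] Smash hact hract :=
  lift hact hract
    (deltaAHom hact hract hρ h.comulOneA h.leftCoactOne h.leftCoactMul h.leftBraided)
    (deltaH hact hract)
    (deltaBHom hact hract hψ h.comulOneB h.rightCoactOne h.rightCoactMul h.rightBraided)
    ((leftSmashRel_deltaH_fstA hact hract).conv_right
      (leftSmashRel_deltaH_midA hact hract h.leftYetterDrinfeld) h.leftComulAct)
    ((rightSmashRel_deltaH_midB hact hract h.rightYetterDrinfeld).conv_right
      (rightSmashRel_deltaH_sndB hact hract) h.rightComulAct)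
    (commute_deltaA_deltaB hact hract h.majid hρ hψ)

theorem comulHom_of (s : A ⊗[K] (H ⊗[K] B)) :
    comulHom hact hract hρ hψ h (of hact hract s) =
      TensorProduct.map (of hact hract).toLinearMap (of hact hract).toLinearMap
        (smashComul ρ ψ s) :=
  (smashComul_eq hact hract ρ ψ s).symm

/-- The counit of `A # H # B`, as an algebra map. -/
def counitHom : Smash hact hract →ₐ[K] K :=
  lift hact hract (scalarHom K h.counitA) (Bialgebra.counitAlgHom K H) (scalarHom K h.counitB)
    (leftSmashRel_scalarHom h.leftCounitAct _ _) (rightSmashRel_scalarHom h.rightCounitAct _ _)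
    (fun _ _ => Commute.all _ _)

theorem counitHom_of (s : A ⊗[K] (H ⊗[K] B)) :
    counitHom hact hract h (of hact hract s) = smashCounit K H A B s := by
  refine (lift_of hact hract _ _ _ _ _ _ s).trans (LinearMap.congr_fun ?_ s)
  ext a x b
  simp [smashCounit]

theorem comulHom_inA (a : A) :
    comulHom hact hract hρ hψ h (inA hact hract a) = deltaA hact hract ρ a :=
  lift_inA ..

theorem comulHom_inH (x : H) :
    comulHom hact hract hρ hψ h (inH hact hract x) = deltaH hact hract x :=
  lift_inH ..

theorem comulHom_inB (b : B) :
    comulHom hact hract hρ hψ h (inB hact hract b) = deltaB hact hract ψ b :=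
  lift_inB ..

theorem counitHom_inA (a : A) :
    counitHom hact hract h (inA hact hract a) = Coalgebra.counit a :=
  lift_inA ..

theorem counitHom_inH (x : H) :
    counitHom hact hract h (inH hact hract x) = Coalgebra.counit x :=
  lift_inH ..

theorem counitHom_inB (b : B) :
    counitHom hact hract h (inB hact hract b) = Coalgebra.counit b :=
  lift_inB ..

section Coassoc

/-! On each generator both iterated coproducts are convolution products of the same three maps into
the threefold tensor power, bracketed in the two possible ways. -/

theorem comulHom_coassoc_inH (x : H) :
    comulLeft hact hract (comulHom hact hract hρ hψ h) (deltaH hact hract x) =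
      Algebra.TensorProduct.map (.id K _) (comulHom hact hract hρ hψ h)
        (deltaH hact hract x) := by
  simp only [← AlgHom.toLinearMap_apply (deltaH hact hract), toLinearMap_deltaH, map_conv]
  have e1 : (comulLeft hact hract (comulHom hact hract hρ hψ h)).toLinearMap ∘ₗ
      (fstH hact hract).toLinearMap = conv
        ((TensorProduct.mk K _ (Smash hact hract ⊗[K] Smash hact hract)).flip 1 ∘ₗ
          (inH hact hract).toLinearMap)
        ((Algebra.TensorProduct.includeRight.comp (fstH hact hract)).toLinearMap) := by
    ext y
    rw [LinearMap.comp_apply, AlgHom.toLinearMap_apply, AlgHom.toLinearMap_apply, fstH_apply,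
      comulLeft_tmul, comulHom_inH, ← AlgHom.toLinearMap_apply (deltaH hact hract),
      toLinearMap_deltaH, conv_apply, conv_apply]
    generalize Coalgebra.comul (R := K) y = t
    induction t with
    | zero => simp
    | add s t hs ht => simp only [map_add, add_tmul, hs, ht]
    | tmul y z => simp [Algebra.TensorProduct.one_def]
  have e2 : (Algebra.TensorProduct.map (.id K _) (comulHom hact hract hρ hψ h)).toLinearMap ∘ₗ
      (sndH hact hract).toLinearMap = conv
        ((Algebra.TensorProduct.includeRight.comp (fstH hact hract)).toLinearMap)
        ((comulLeft hact hract (comulHom hact hract hρ hψ h)).toLinearMap ∘ₗ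
          (sndH hact hract).toLinearMap) := by
    ext y
    simp only [LinearMap.comp_apply, AlgHom.toLinearMap_apply, sndH_apply,
      Algebra.TensorProduct.map_tmul, comulHom_inH, map_one]
    rw [← AlgHom.toLinearMap_apply (deltaH hact hract),
      toLinearMap_deltaH, conv_apply, conv_apply]
    generalize Coalgebra.comul (R := K) y = t
    induction t with
    | zero => simp
    | add s t hs ht => simp only [map_add, tmul_add, hs, ht]
    | tmul y z => simp [comulLeft_tmul, Algebra.TensorProduct.one_def]
  have e3 : (Algebra.TensorProduct.map (.id K _) (comulHom hact hract hρ hψ h)).toLinearMap ∘ₗ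
      (fstH hact hract).toLinearMap =
        (TensorProduct.mk K _ (Smash hact hract ⊗[K] Smash hact hract)).flip 1 ∘ₗ
          (inH hact hract).toLinearMap := by
    ext y
    simp
  rw [e1, e2, e3, conv_assoc]

theorem comulHom_coassoc_inA (a : A) :
    comulLeft hact hract (comulHom hact hract hρ hψ h) (deltaA hact hract ρ a) =
      Algebra.TensorProduct.map (.id K _) (comulHom hact hract hρ hψ h)
        (deltaA hact hract ρ a) := by
  set Δ := comulHom hact hract hρ hψ h with hΔ
  set g := (midA hact hract).toLinearMap ∘ₗ ρ with hg
  -- `x ⊗ c ↦ x ⊗ (c ⊗ 1)`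
  let T := TensorProduct.map (inH hact hract).toLinearMap (fstA hact hract).toLinearMap
  -- `a ↦ a₋₁ ⊗ ((a₀)₋₁ ⊗ (a₀)₀)`
  let G := TensorProduct.map (inH hact hract).toLinearMap g ∘ₗ ρ
  have e1 : (comulLeft hact hract Δ).toLinearMap ∘ₗ (fstA hact hract).toLinearMap = conv
      ((TensorProduct.mk K _ (Smash hact hract ⊗[K] Smash hact hract)).flip 1 ∘ₗ
          (inA hact hract).toLinearMap) (T ∘ₗ ρ) := by
    ext b
    rw [LinearMap.comp_apply, AlgHom.toLinearMap_apply, AlgHom.toLinearMap_apply, fstA_apply,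
      comulLeft_tmul, comulHom_inA, deltaA, conv_apply, conv_apply]
    generalize Coalgebra.comul (R := K) b = t
    induction t with
    | zero => simp
    | add s t hs ht => simp only [map_add, add_tmul, hs, ht]
    | tmul y z =>
      simp only [mulMap_tmul, LinearMap.comp_apply]
      generalize ρ z = r
      induction r with
      | zero => simp
      | add s t hs ht => simp only [map_add, mul_add, add_tmul, hs, ht]
      | tmul x c => simp [T, Algebra.TensorProduct.one_def]
  have e2 : (Algebra.TensorProduct.map (.id K _) Δ).toLinearMap ∘ₗ
      (fstA hact hract).toLinearMap =
        (TensorProduct.mk K _ (Smash hact hract ⊗[K] Smash hact hract)).flip 1 ∘ₗ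
          (inA hact hract).toLinearMap := by
    ext y
    simp
  have e3 : (comulLeft hact hract Δ).toLinearMap ∘ₗ g = G := by
    have key (t : H ⊗[K] A) : comulLeft hact hract Δ (midA hact hract t) =
        TensorProduct.map (inH hact hract).toLinearMap (midA hact hract).toLinearMap
          (TensorProduct.assoc K H H A
            ((Coalgebra.comul (R := K) (A := H)).rTensor A t)) := by
      induction t with
      | zero => simp
      | add s t hs ht => simp only [map_add, hs, ht]
      | tmul x c =>
        rw [midA_tmul, comulLeft_tmul, comulHom_inH, LinearMap.rTensor_tmul,
          ← AlgHom.toLinearMap_apply (deltaH hact hract), toLinearMap_deltaH, conv_apply]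
        generalize Coalgebra.comul (R := K) x = t
        induction t with
        | zero => simp
        | add s t hs ht => simp only [map_add, add_tmul, hs, ht]
        | tmul y z => simp
    ext b
    refine (key (ρ b)).trans ?_
    rw [← hρ.coassoc]
    simp only [G, LinearMap.comp_apply]
    generalize ρ b = t
    induction t with
    | zero => simp
    | add s t hs ht => simp only [map_add, hs, ht]
    | tmul x c => simp [hg]
  have e4 : (Algebra.TensorProduct.map (.id K _) Δ).toLinearMap ∘ₗ g = conv (T ∘ₗ ρ) G := by
    have key (t : H ⊗[K] A) : Algebra.TensorProduct.map (.id K _) Δ (midA hact hract t) =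
        TensorProduct.map (inH hact hract).toLinearMap (mulMap (fstA hact hract).toLinearMap g)
          ((Coalgebra.comul (R := K) (A := A)).lTensor H t) := by
      induction t with
      | zero => simp
      | add s t hs ht => simp only [map_add, hs, ht]
      | tmul x c =>
        simp only [midA_tmul, Algebra.TensorProduct.map_tmul, hΔ, comulHom_inA]
        rfl
    ext b
    refine (key (ρ b)).trans ?_
    rw [hρ.coact_comul, conv_apply]
    generalize Coalgebra.comul (R := K) b = t
    induction t with
    | zero => simp
    | add s t hs ht => simp only [map_add, hs, ht]
    | tmul y z =>
      simp only [TensorProduct.map_tmul, mulMap_tmul, LinearMap.comp_apply, G]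
      generalize ρ y = p
      generalize ρ z = q
      induction p with
      | zero => simp
      | add s t hs ht => simp only [map_add, add_tmul, add_mul, hs, ht]
      | tmul x c =>
      induction q with
      | zero => simp
      | add s t hs ht => simp only [map_add, tmul_add, mul_add, hs, ht]
      | tmul x' c' => simp [T]
  rw [deltaA, map_conv, map_conv, ← hg, e1, e2, e3, e4, conv_assoc]

/-- Applying `Δ` to the factor `b₍₁₎` of the coaction of `B` is iterating the coaction. -/
theorem map_comulHom_comp_midB :
    (Algebra.TensorProduct.map (.id K _) (comulHom hact hract hρ hψ h)).toLinearMap ∘ₗ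
        (midB hact hract).toLinearMap ∘ₗ ψ =
      (Algebra.TensorProduct.assoc K K K (Smash hact hract) (Smash hact hract)
        (Smash hact hract)).toLinearMap ∘ₗ
        TensorProduct.map ((midB hact hract).toLinearMap ∘ₗ ψ) (inH hact hract).toLinearMap ∘ₗ
        ψ := by
  let L : (B ⊗[K] H) ⊗[K] H →ₗ[K] Smash hact hract ⊗[K] (Smash hact hract ⊗[K] Smash hact hract) :=
    (TensorProduct.assoc K _ _ _).toLinearMap ∘ₗ
      TensorProduct.map (midB hact hract).toLinearMap (inH hact hract).toLinearMap
  have hL (b : B) (x y : H) : L ((b ⊗ₜ x) ⊗ₜ y) =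
      inB hact hract b ⊗ₜ (inH hact hract x ⊗ₜ inH hact hract y) := rfl
  have hL' (q : B ⊗[K] H) (y : H) : L (q ⊗ₜ y) =
      Algebra.TensorProduct.assoc K K K (Smash hact hract) (Smash hact hract)
        (Smash hact hract) (midB hact hract q ⊗ₜ inH hact hract y) := rfl
  have key (t : B ⊗[K] H) :
      Algebra.TensorProduct.map (.id K _) (comulHom hact hract hρ hψ h) (midB hact hract t) =
        L ((TensorProduct.assoc K B H H).symm
          ((Coalgebra.comul (R := K) (A := H)).lTensor B t)) := by
    induction t with
    | zero => simp
    | add s t hs ht => simp only [map_add, hs, ht]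
    | tmul c x =>
      rw [midB_tmul, Algebra.TensorProduct.map_tmul, comulHom_inH, LinearMap.lTensor_tmul,
        ← AlgHom.toLinearMap_apply (deltaH hact hract), toLinearMap_deltaH, conv_apply]
      generalize Coalgebra.comul (R := K) x = t
      induction t with
      | zero => simp
      | add s t hs ht => simp only [map_add, tmul_add, hs, ht]
      | tmul y z => simp [hL]
  ext b
  refine (key (ψ b)).trans ?_
  rw [← hψ.coassoc, LinearEquiv.symm_apply_apply]
  simp only [LinearMap.comp_apply]
  generalize ψ b = t
  induction t with
  | zero => simp
  | add s t hs ht => simp only [map_add, hs, ht]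
  | tmul x c => simp [hL']

theorem comulHom_coassoc_inB (b : B) :
    comulLeft hact hract (comulHom hact hract hρ hψ h) (deltaB hact hract ψ b) =
      Algebra.TensorProduct.map (.id K _) (comulHom hact hract hρ hψ h)
        (deltaB hact hract ψ b) := by
  set Δ := comulHom hact hract hρ hψ h with hΔ
  set g := (midB hact hract).toLinearMap ∘ₗ ψ with hg
  -- `b ↦ 1 ⊗ (b₍₀₎ ⊗ b₍₁₎)`
  let T := TensorProduct.mk K (Smash hact hract) (Smash hact hract ⊗[K] Smash hact hract) 1 ∘ₗ g
  -- `b ↦ (b₍₀₎)₍₀₎ ⊗ ((b₍₀₎)₍₁₎ ⊗ b₍₁₎)`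
  let G := (Algebra.TensorProduct.assoc K K K (Smash hact hract) (Smash hact hract)
    (Smash hact hract)).toLinearMap ∘ₗ TensorProduct.map g (inH hact hract).toLinearMap ∘ₗ ψ
  have e1 : (comulLeft hact hract Δ).toLinearMap ∘ₗ (sndB hact hract).toLinearMap =
      TensorProduct.mk K (Smash hact hract) (Smash hact hract ⊗[K] Smash hact hract) 1 ∘ₗ
          (sndB hact hract).toLinearMap := by
    ext y
    simp [comulLeft_tmul, Algebra.TensorProduct.one_def]
  have e2 : (Algebra.TensorProduct.map (.id K _) Δ).toLinearMap ∘ₗ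
      (sndB hact hract).toLinearMap = conv T
        (TensorProduct.mk K (Smash hact hract) (Smash hact hract ⊗[K] Smash hact hract) 1 ∘ₗ
          (sndB hact hract).toLinearMap) := by
    ext c
    simp only [LinearMap.comp_apply, AlgHom.toLinearMap_apply, sndB_apply,
      Algebra.TensorProduct.map_tmul, hΔ, comulHom_inB, map_one, deltaB, conv_apply]
    generalize Coalgebra.comul (R := K) c = t
    induction t with
    | zero => simp
    | add s t hs ht => simp only [map_add, tmul_add, hs, ht]
    | tmul y z => simp [T, hg]
  have e3 : (comulLeft hact hract Δ).toLinearMap ∘ₗ g = conv G T := by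
    have key (t : B ⊗[K] H) : comulLeft hact hract Δ (midB hact hract t) =
        Algebra.TensorProduct.assoc K K K (Smash hact hract) (Smash hact hract)
          (Smash hact hract) (TensorProduct.map (mulMap g (sndB hact hract).toLinearMap)
            (inH hact hract).toLinearMap ((Coalgebra.comul (R := K) (A := B)).rTensor H t)) := by
      induction t with
      | zero => simp
      | add s t hs ht => simp only [map_add, hs, ht]
      | tmul c x =>
        rw [midB_tmul, comulLeft_tmul, hΔ, comulHom_inB]
        rfl
    ext b
    refine (key (ψ b)).trans ?_
    rw [hψ.coact_comul, conv_apply]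
    generalize Coalgebra.comul (R := K) b = t
    induction t with
    | zero => simp
    | add s t hs ht => simp only [map_add, hs, ht]
    | tmul y z =>
      simp only [TensorProduct.map_tmul, mulMap_tmul, LinearMap.comp_apply, G, T, hg,
        TensorProduct.mk_apply, AlgHom.toLinearMap_apply]
      generalize ψ y = p
      generalize ψ z = q
      induction p with
      | zero => simp
      | add s t hs ht => simp only [map_add, add_tmul, add_mul, hs, ht]
      | tmul c x =>
      induction q with
      | zero => simp
      | add s t hs ht => simp only [map_add, tmul_add, mul_add, hs, ht]
      | tmul c' x' =>
        have e : (1 : Smash hact hract) ⊗ₜ[K] midB hact hract (c' ⊗ₜ x') =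
            Algebra.TensorProduct.assoc K K K (Smash hact hract) (Smash hact hract)
              (Smash hact hract) (sndB hact hract c' ⊗ₜ inH hact hract x') := rfl
        rw [e]
        simp only [tensorTensorTensorComm_tmul, LinearMap.lTensor_tmul, TensorProduct.map_tmul,
          mulMap_tmul, LinearMap.mul'_apply, AlgHom.toLinearMap_apply, map_mul (inH hact hract),
          LinearMap.comp_apply, AlgEquiv.toLinearMap_apply]
        rw [← Algebra.TensorProduct.tmul_mul_tmul, map_mul]
  have e4 : (Algebra.TensorProduct.map (.id K _) Δ).toLinearMap ∘ₗ g = G :=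
    map_comulHom_comp_midB hact hract hρ hψ h
  rw [deltaB, map_conv, map_conv, ← hg, e1, e2, e3, e4, conv_assoc]

end Coassoc

end Smash

end

/-! ### Counitality and the bialgebra structure -/

section

variable {K H A B : Type*} [Field K] [Ring H] [Bialgebra K H]
  [Ring A] [Algebra K A] [Coalgebra K A] [Ring B] [Algebra K B] [Coalgebra K B]
  {act : H →ₗ[K] A →ₗ[K] A} {ract : B →ₗ[K] H →ₗ[K] B}
  {ρ : A →ₗ[K] H ⊗[K] A} {ψ : B →ₗ[K] B ⊗[K] H}

theorem tmul_eq_smul_one_tmul {M : Type*} [AddCommMonoid M] [Module K M] (r : K) (m : M) :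
    r ⊗ₜ[K] m = r • ((1 : K) ⊗ₜ[K] m) := by
  rw [smul_tmul', smul_eq_mul, mul_one]

theorem tmul_eq_smul_tmul_one {M : Type*} [AddCommMonoid M] [Module K M] (r : K) (m : M) :
    m ⊗ₜ[K] r = r • (m ⊗ₜ[K] (1 : K)) := by
  rw [← tmul_smul, smul_eq_mul, mul_one]

namespace Smash

variable (hact : IsLeftModuleAlgebra act) (hract : IsRightModuleAlgebra ract)
  (h : SmashConditions act ρ ract ψ)

section Counit

theorem counit_rTensor_deltaA (hρ : IsLeftComoduleCoalgebra ρ) (a : A) :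
    Algebra.TensorProduct.map (counitHom hact hract h) (.id K _) (deltaA hact hract ρ a) =
      1 ⊗ₜ inA hact hract a := by
  have key (t : H ⊗[K] A) :
      Algebra.TensorProduct.map (counitHom hact hract h) (.id K _) (midA hact hract t) =
        1 ⊗ₜ inA hact hract (TensorProduct.lid K A
          ((Coalgebra.counit (R := K) (A := H)).rTensor A t)) := by
    induction t with
    | zero => simp
    | add s t hs ht => simp only [map_add, tmul_add, hs, ht]
    | tmul x c =>
      simpa [counitHom_inH] using tmul_eq_smul_one_tmul (Coalgebra.counit (R := K) x) _
  rw [deltaA, map_conv, conv_counit_left]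
  · exact (key (ρ a)).trans (by rw [hρ.counit_coact])
  · intro b
    simp [counitHom_inA, Algebra.TensorProduct.algebraMap_apply]

theorem counit_lTensor_deltaA (hρ : IsLeftComoduleCoalgebra ρ) (a : A) :
    Algebra.TensorProduct.map (.id K _) (counitHom hact hract h) (deltaA hact hract ρ a) =
      inA hact hract a ⊗ₜ 1 := by
  have key (t : H ⊗[K] A) :
      Algebra.TensorProduct.map (.id K _) (counitHom hact hract h) (midA hact hract t) =
        inH hact hract (TensorProduct.rid K H
          ((Coalgebra.counit (R := K) (A := A)).lTensor H t)) ⊗ₜ 1 := by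
    induction t with
    | zero => simp
    | add s t hs ht => simp only [map_add, add_tmul, hs, ht]
    | tmul x c => simp [counitHom_inA, smul_tmul]
  rw [deltaA, map_conv, conv_counit_right]
  · simp
  · intro b
    refine (key (ρ b)).trans ?_
    rw [hρ.coact_counit, map_smul, map_one, Algebra.algebraMap_eq_smul_one,
      Algebra.TensorProduct.one_def, smul_tmul']

theorem counit_rTensor_deltaB (hψ : IsRightComoduleCoalgebra ψ) (b : B) :
    Algebra.TensorProduct.map (counitHom hact hract h) (.id K _) (deltaB hact hract ψ b) =
      1 ⊗ₜ inB hact hract b := by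
  have key (t : B ⊗[K] H) :
      Algebra.TensorProduct.map (counitHom hact hract h) (.id K _) (midB hact hract t) =
        1 ⊗ₜ inH hact hract (TensorProduct.lid K H
          ((Coalgebra.counit (R := K) (A := B)).rTensor H t)) := by
    induction t with
    | zero => simp
    | add s t hs ht => simp only [map_add, tmul_add, hs, ht]
    | tmul x c =>
      simpa [counitHom_inB] using tmul_eq_smul_one_tmul (Coalgebra.counit (R := K) x) _
  rw [deltaB, map_conv, conv_counit_left]
  · simp
  · intro b
    refine (key (ψ b)).trans ?_
    rw [hψ.coact_counit, map_smul, map_one, Algebra.algebraMap_eq_smul_one,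
      Algebra.TensorProduct.one_def, tmul_smul]

theorem counit_lTensor_deltaB (hψ : IsRightComoduleCoalgebra ψ) (b : B) :
    Algebra.TensorProduct.map (.id K _) (counitHom hact hract h) (deltaB hact hract ψ b) =
      inB hact hract b ⊗ₜ 1 := by
  have key (t : B ⊗[K] H) :
      Algebra.TensorProduct.map (.id K _) (counitHom hact hract h) (midB hact hract t) =
        inB hact hract (TensorProduct.rid K B
          ((Coalgebra.counit (R := K) (A := H)).lTensor B t)) ⊗ₜ 1 := by
    induction t with
    | zero => simp
    | add s t hs ht => simp only [map_add, add_tmul, hs, ht]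
    | tmul x c => simp [counitHom_inH, smul_tmul]
  rw [deltaB, map_conv, conv_counit_right]
  · exact (key (ψ b)).trans (by rw [hψ.counit_coact])
  · intro b
    simpa [counitHom_inB, Algebra.algebraMap_eq_smul_one, Algebra.TensorProduct.one_def] using
      tmul_eq_smul_tmul_one (Coalgebra.counit (R := K) b) (1 : Smash hact hract)

theorem counit_rTensor_deltaH (x : H) :
    Algebra.TensorProduct.map (counitHom hact hract h) (.id K _) (deltaH hact hract x) =
      1 ⊗ₜ inH hact hract x := by
  rw [← AlgHom.toLinearMap_apply (deltaH hact hract), toLinearMap_deltaH, map_conv,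
    conv_counit_left]
  · simp
  · intro y
    simp [counitHom_inH, Algebra.TensorProduct.algebraMap_apply]

theorem counit_lTensor_deltaH (x : H) :
    Algebra.TensorProduct.map (.id K _) (counitHom hact hract h) (deltaH hact hract x) =
      inH hact hract x ⊗ₜ 1 := by
  rw [← AlgHom.toLinearMap_apply (deltaH hact hract), toLinearMap_deltaH, map_conv,
    conv_counit_right]
  · simp
  · intro y
    simpa [counitHom_inH, Algebra.algebraMap_eq_smul_one, Algebra.TensorProduct.one_def] using
      tmul_eq_smul_tmul_one (Coalgebra.counit (R := K) y) (1 : Smash hact hract)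

end Counit

/-- The bialgebra structure on `A # H # B`. -/
@[reducible]
def bialgebra (hρ : IsLeftComoduleCoalgebra ρ) (hψ : IsRightComoduleCoalgebra ψ) :
    Bialgebra K (Smash hact hract) :=
  Bialgebra.ofAlgHom (comulHom hact hract hρ hψ h) (counitHom hact hract h)
    (algHom_ext
      (fun a => by
        simp only [AlgHom.comp_apply, comulHom_inA]
        exact comulHom_coassoc_inA hact hract hρ hψ h a)
      (fun x => by
        simp only [AlgHom.comp_apply, comulHom_inH]
        exact comulHom_coassoc_inH hact hract hρ hψ h x)
      (fun b => by
        simp only [AlgHom.comp_apply, comulHom_inB]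
        exact comulHom_coassoc_inB hact hract hρ hψ h b))
    (algHom_ext
      (fun a => by
        simp only [AlgHom.comp_apply, comulHom_inA]
        exact counit_rTensor_deltaA hact hract h hρ a)
      (fun x => by
        simp only [AlgHom.comp_apply, comulHom_inH]
        exact counit_rTensor_deltaH hact hract h x)
      (fun b => by
        simp only [AlgHom.comp_apply, comulHom_inB]
        exact counit_rTensor_deltaB hact hract h hψ b))
    (algHom_ext
      (fun a => by
        simp only [AlgHom.comp_apply, comulHom_inA]
        exact counit_lTensor_deltaA hact hract h hρ a)
      (fun x => by
        simp only [AlgHom.comp_apply, comulHom_inH]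
        exact counit_lTensor_deltaH hact hract h x)
      (fun b => by
        simp only [AlgHom.comp_apply, comulHom_inB]
        exact counit_lTensor_deltaB hact hract h hψ b))

end Smash

theorem SmashConditions.smashIsBialgebra (hact : IsLeftModuleAlgebra act)
    (hract : IsRightModuleAlgebra ract) (hρ : IsLeftComoduleCoalgebra ρ)
    (hψ : IsRightComoduleCoalgebra ψ) (h : SmashConditions act ρ ract ψ) :
    SmashIsBialgebra act ρ ract ψ :=
  ⟨Smash hact hract, inferInstance, Smash.bialgebra hact hract h hρ hψ, Smash.of hact hract,
    fun _ _ => rfl, rfl, fun s => (Smash.comulHom_of hact hract hρ hψ h s).symm,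
    fun s => (Smash.counitHom_of hact hract h s).symm⟩

end

/-! ### Representations of `A # H # B` on `A`, `H` and `B` -/

section

section PairRep

variable {K W M N : Type*} [Field K] [Ring W] [Algebra K W] [AddCommGroup M] [Module K M]
  [AddCommGroup N] [Module K N]

/-- The linear map `w ⊗ w' ↦ T w ⊗ T' w'` from the tensor square of `W` to operators on
`M ⊗ N`. -/
def pairRep (T : W →ₗ[K] Module.End K M) (T' : W →ₗ[K] Module.End K N) :
    W ⊗[K] W →ₗ[K] Module.End K (M ⊗[K] N) :=
  TensorProduct.homTensorHomMap (.id K) M N M N ∘ₗ TensorProduct.map T T'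

@[simp]
theorem pairRep_tmul_tmul (T : W →ₗ[K] Module.End K M) (T' : W →ₗ[K] Module.End K N) (w w' : W)
    (m : M) (n : N) : pairRep T T' (w ⊗ₜ w') (m ⊗ₜ n) = T w m ⊗ₜ T' w' n := by
  simp [pairRep]

theorem pairRep_mul {T : W →ₗ[K] Module.End K M} {T' : W →ₗ[K] Module.End K N}
    (hT : ∀ w w', T (w * w') = T w * T w') (hT' : ∀ w w', T' (w * w') = T' w * T' w')
    (z z' : W ⊗[K] W) : pairRep T T' (z * z') = pairRep T T' z * pairRep T T' z' := by
  induction z with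
  | zero => simp
  | add s t hs ht => simp only [add_mul, map_add, hs, ht]
  | tmul w₁ w₂ =>
  induction z' with
  | zero => simp
  | add s t hs ht => simp only [mul_add, map_add, hs, ht]
  | tmul v₁ v₂ => exact TensorProduct.ext' fun m n => by simp [hT, hT']

/-- Two antimultiplicative actions give an antimultiplicative action of the tensor square. -/
theorem pairRep_antimul {T : W →ₗ[K] Module.End K M} {T' : W →ₗ[K] Module.End K N}
    (hT : ∀ w w', T (w * w') = T w' * T w) (hT' : ∀ w w', T' (w * w') = T' w' * T' w)
    (z z' : W ⊗[K] W) : pairRep T T' (z * z') = pairRep T T' z' * pairRep T T' z := by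
  induction z with
  | zero => simp
  | add s t hs ht => simp only [add_mul, mul_add, map_add, hs, ht]
  | tmul w₁ w₂ =>
  induction z' with
  | zero => simp
  | add s t hs ht => simp only [add_mul, mul_add, map_add, hs, ht]
  | tmul v₁ v₂ => exact TensorProduct.ext' fun m n => by simp [hT, hT']

end PairRep

variable {K H A B : Type*} [Field K] [Ring H] [Bialgebra K H]
  [Ring A] [Algebra K A] [Ring B] [Algebra K B]
  {act : H →ₗ[K] A →ₗ[K] A} {ract : B →ₗ[K] H →ₗ[K] B}

section CounitConditions

variable [Coalgebra K A] [Coalgebra K B]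

/-- If the counit of `A # H # B` is an algebra map, then so are those of `A` and `B`, and they are
`H`-linear. -/
theorem counit_conditions (hact : IsLeftModuleAlgebra act) (hract : IsRightModuleAlgebra ract)
    (hA : (Coalgebra.counit (1 : A) : K) = 1) (hB : (Coalgebra.counit (1 : B) : K) = 1)
    (ε : Smash hact hract →ₐ[K] K)
    (hε : ∀ s, ε (Smash.of hact hract s) = smashCounit K H A B s) :
    (CounitIsAlgebraMap K A ∧ CounitIsAlgebraMap K B) ∧
      (LeftCounitAct act ∧ RightCounitAct ract) := by
  have eA (a : A) : ε (Smash.inA hact hract a) = Coalgebra.counit a := by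
    simp [Smash.inA_apply, hε, smashCounit, hB]
  have eH (x : H) : ε (Smash.inH hact hract x) = Coalgebra.counit x := by
    simp [Smash.inH_apply, hε, smashCounit, hA, hB]
  have eB (b : B) : ε (Smash.inB hact hract b) = Coalgebra.counit b := by
    simp [Smash.inB_apply, hε, smashCounit, hA]
  refine ⟨⟨⟨hA, fun a a' => by simp only [← eA, map_mul]⟩,
    ⟨hB, fun b b' => by simp only [← eB, map_mul]⟩⟩, fun x a => ?_, fun b x => ?_⟩
  · have h1 := congrArg ε (Smash.leftSmashRel hact hract x a)
    rw [map_conv, map_mul, conv_counit_right fun y => eH y] at h1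
    simp only [AlgHom.toLinearMap_apply, eA, eH, LinearMap.comp_apply, LinearMap.flip_apply] at h1
    rw [← h1, mul_comm]
  · have h1 := congrArg ε (Smash.rightSmashRel hact hract b x)
    rw [map_conv, map_mul, conv_counit_left fun y => eH y] at h1
    simp only [AlgHom.toLinearMap_apply, eB, eH, LinearMap.comp_apply] at h1
    exact h1.symm

end CounitConditions

namespace Smash

variable (hact : IsLeftModuleAlgebra act) (hract : IsRightModuleAlgebra ract)

/-- A right module algebra structure as an algebra map to the opposite of the endomorphisms. -/
def ractHom : H →ₐ[K] (Module.End K B)ᵐᵒᵖ :=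
  AlgHom.ofLinearMap ((MulOpposite.opLinearEquiv K).toLinearMap ∘ₗ ract.flip)
    (congrArg MulOpposite.op (LinearMap.ext hract.act_one))
    (fun x y => congrArg MulOpposite.op (LinearMap.ext fun b => hract.act_mul b x y))

/-- Right multiplication as an algebra map to the opposite of the endomorphisms. -/
def rmulHom (K B : Type*) [Field K] [Ring B] [Algebra K B] : B →ₐ[K] (Module.End K B)ᵐᵒᵖ :=
  AlgHom.ofLinearMap ((MulOpposite.opLinearEquiv K).toLinearMap ∘ₗ (LinearMap.mul K B).flip)
    (congrArg MulOpposite.op (LinearMap.ext mul_one))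
    (fun x y => congrArg MulOpposite.op (LinearMap.ext fun b => (mul_assoc b x y).symm))

theorem ractHom_apply (x : H) : ractHom hract x = MulOpposite.op (ract.flip x) := rfl

theorem rmulHom_apply (b : B) : rmulHom K B b = MulOpposite.op (LinearMap.mulRight K b) := rfl

theorem rightSmashRel_rmulHom :
    RightSmashRel ract (ractHom hract).toLinearMap (rmulHom K B).toLinearMap := by
  intro b x
  apply MulOpposite.unop_injective
  ext c
  refine (hract.mul_act c b x).trans ?_
  rw [conv_apply]
  generalize Coalgebra.comul (R := K) x = t
  induction t with
  | zero => simp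
  | add s t hs ht => simp only [map_add, hs, ht, MulOpposite.unop_add, LinearMap.add_apply]
  | tmul y z => simp [ractHom_apply, rmulHom_apply]

section RepA

variable [Coalgebra K B] (cB : CounitIsAlgebraMap K B) (rB : RightCounitAct ract)

/-- The representation of `A # H # B` on `A` in which `A` acts by left multiplication, `H` by its
action, and `B` by the counit. -/
def repA : Smash hact hract →ₐ[K] Module.End K A :=
  lift hact hract (Algebra.lmul K A) (actHom hact) (scalarHom (Module.End K A) cB)
    (leftSmashRel_lmul hact) (rightSmashRel_scalarHom rB cB _)
    (fun _ _ => commute_scalarHom_right cB _ _)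

variable (a : A) (x : H) (b : B)

@[simp]
theorem repA_inA (c : A) : repA hact hract cB rB (inA hact hract a) c = a * c :=
  LinearMap.congr_fun (lift_inA ..) c

@[simp]
theorem repA_inH (c : A) : repA hact hract cB rB (inH hact hract x) c = act x c :=
  LinearMap.congr_fun (lift_inH ..) c

@[simp]
theorem repA_inB (c : A) : repA hact hract cB rB (inB hact hract b) c =
    (Coalgebra.counit b : K) • c :=
  LinearMap.congr_fun (lift_inB ..) c

end RepA

section RepB

variable [Coalgebra K A] (cA : CounitIsAlgebraMap K A) (lA : LeftCounitAct act)

/-- The right representation of `A # H # B` on `B` in which `B` acts by right multiplication, `H`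
by its action, and `A` by the counit. -/
def repB : Smash hact hract →ₐ[K] (Module.End K B)ᵐᵒᵖ :=
  lift hact hract (scalarHom _ cA) (ractHom hract) (rmulHom K B)
    (leftSmashRel_scalarHom lA cA _) (rightSmashRel_rmulHom hract)
    (fun _ _ => commute_scalarHom_left cA _ _)

/-- The right representation of `A # H # B` on `B`, as a linear map. -/
def rightRepB : Smash hact hract →ₗ[K] Module.End K B :=
  (MulOpposite.opLinearEquiv K).symm.toLinearMap ∘ₗ (repB hact hract cA lA).toLinearMap

theorem rightRepB_mul (w w' : Smash hact hract) : rightRepB hact hract cA lA (w * w') =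
    rightRepB hact hract cA lA w' * rightRepB hact hract cA lA w := by
  simp [rightRepB]

variable (a : A) (x : H) (b : B)

@[simp]
theorem rightRepB_inA (c : B) : rightRepB hact hract cA lA (inA hact hract a) c =
    (Coalgebra.counit a : K) • c := by
  have e : repB hact hract cA lA (inA hact hract a) = scalarHom _ cA a := lift_inA ..
  simp [rightRepB, e, Algebra.algebraMap_eq_smul_one]

@[simp]
theorem rightRepB_inH (c : B) : rightRepB hact hract cA lA (inH hact hract x) c = ract c x := by
  have e : repB hact hract cA lA (inH hact hract x) = ractHom hract x := lift_inH ..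
  simp [rightRepB, e, ractHom_apply]

@[simp]
theorem rightRepB_inB (c : B) : rightRepB hact hract cA lA (inB hact hract b) c = c * b := by
  have e : repB hact hract cA lA (inB hact hract b) = rmulHom K B b := lift_inB ..
  simp [rightRepB, e, rmulHom_apply]

@[simp]
theorem rightRepB_one : rightRepB hact hract cA lA 1 = 1 := by
  simp [rightRepB]

end RepB

section RepH

variable [Coalgebra K A] [Coalgebra K B] (cA : CounitIsAlgebraMap K A)
  (cB : CounitIsAlgebraMap K B) (lA : LeftCounitAct act) (rB : RightCounitAct ract)

/-- The projection of `A # H # B` onto `H` given by the counits of `A` and `B`. -/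
def projH : Smash hact hract →ₐ[K] H :=
  lift hact hract (scalarHom H cA) (AlgHom.id K H) (scalarHom H cB)
    (leftSmashRel_scalarHom lA cA _) (rightSmashRel_scalarHom rB cB _)
    (fun _ _ => commute_scalarHom_right cB _ _)

/-- The anti-representation of `A # H # B` on `H` by right multiplication along `projH`. -/
def rightRepH : Smash hact hract →ₗ[K] Module.End K H :=
  (LinearMap.mul K H).flip ∘ₗ (projH hact hract cA cB lA rB).toLinearMap

theorem rightRepH_mul (w w' : Smash hact hract) : rightRepH hact hract cA cB lA rB (w * w') =
    rightRepH hact hract cA cB lA rB w' * rightRepH hact hract cA cB lA rB w := by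
  ext x
  simp [rightRepH, mul_assoc]

/-- The representation of `A # H # B` on `H` by left multiplication along `projH`. -/
def leftRepH : Smash hact hract →ₐ[K] Module.End K H :=
  (Algebra.lmul K H).comp (projH hact hract cA cB lA rB)

variable (a : A) (x : H) (b : B)

@[simp]
theorem leftRepH_inA (y : H) : leftRepH hact hract cA cB lA rB (inA hact hract a) y =
    (Coalgebra.counit a : K) • y := by
  simp [leftRepH, projH, Algebra.smul_def]

@[simp]
theorem leftRepH_inH (y : H) : leftRepH hact hract cA cB lA rB (inH hact hract x) y =
    x * y := by
  simp [leftRepH, projH]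

@[simp]
theorem leftRepH_inB (y : H) : leftRepH hact hract cA cB lA rB (inB hact hract b) y =
    (Coalgebra.counit b : K) • y := by
  simp [leftRepH, projH, Algebra.smul_def]

@[simp]
theorem rightRepH_inA (y : H) : rightRepH hact hract cA cB lA rB (inA hact hract a) y =
    (Coalgebra.counit a : K) • y := by
  simp [rightRepH, projH, Algebra.smul_def, Algebra.commutes]

@[simp]
theorem rightRepH_inH (y : H) : rightRepH hact hract cA cB lA rB (inH hact hract x) y =
    y * x := by
  simp [rightRepH, projH]

@[simp]
theorem rightRepH_inB (y : H) : rightRepH hact hract cA cB lA rB (inB hact hract b) y =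
    (Coalgebra.counit b : K) • y := by
  simp [rightRepH, projH, Algebra.smul_def, Algebra.commutes]

@[simp]
theorem rightRepH_one : rightRepH hact hract cA cB lA rB 1 = 1 := by
  ext
  simp [rightRepH]

end RepH

end Smash

end

/-! ### Actions of the tensor square -/

section

variable {K H A B : Type*} [Field K] [Ring H] [Bialgebra K H]
  [Ring A] [Algebra K A] [Ring B] [Algebra K B]
  {act : H →ₗ[K] A →ₗ[K] A} {ract : B →ₗ[K] H →ₗ[K] B}
  {ρ : A →ₗ[K] H ⊗[K] A} {ψ : B →ₗ[K] B ⊗[K] H}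

theorem lid_map_counit_comul {C : Type*} [AddCommGroup C] [Module K C] [Coalgebra K C] (c : C) :
    TensorProduct.lid K K (TensorProduct.map (Coalgebra.counit (R := K))
      (Coalgebra.counit (R := K)) (Coalgebra.comul (R := K) c)) = Coalgebra.counit c := by
  have h := congrArg (TensorProduct.lid K K)
    (congrArg (LinearMap.lTensor K (Coalgebra.counit (R := K) (A := C)))
      (Coalgebra.rTensor_counit_comul (R := K) c))
  rw [← LinearMap.comp_apply, LinearMap.lTensor_comp_rTensor] at h
  simpa using h

namespace Smash

variable (hact : IsLeftModuleAlgebra act) (hract : IsRightModuleAlgebra ract)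

section Left

variable [Coalgebra K B] (cB : CounitIsAlgebraMap K B) (rB : RightCounitAct ract)

/-- The action of the tensor square of `A # H # B` on `A ⊗ A`. -/
def actAA : Smash hact hract ⊗[K] Smash hact hract →ₗ[K] Module.End K (A ⊗[K] A) :=
  pairRep (repA hact hract cB rB).toLinearMap (repA hact hract cB rB).toLinearMap

theorem actAA_mul (z z' : Smash hact hract ⊗[K] Smash hact hract) :
    actAA hact hract cB rB (z * z') = actAA hact hract cB rB z * actAA hact hract cB rB z' :=
  pairRep_mul (map_mul (repA hact hract cB rB)) (map_mul (repA hact hract cB rB)) _ _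

theorem actAA_deltaH (x : H) (t : A ⊗[K] A) :
    actAA hact hract cB rB (deltaH hact hract x) t =
      TensorProduct.map (TensorProduct.lift act) (TensorProduct.lift act)
      (TensorProduct.tensorTensorTensorComm K H H A A (Coalgebra.comul (R := K) x ⊗ₜ[K] t)) := by
  rw [← AlgHom.toLinearMap_apply, toLinearMap_deltaH, conv_apply]
  generalize Coalgebra.comul (R := K) x = s
  induction s with
  | zero => simp
  | add s t hs ht => simp only [map_add, add_tmul, LinearMap.add_apply, hs, ht]
  | tmul x₁ x₂ =>
  induction t with
  | zero => simp
  | add s t hs ht => simp only [map_add, tmul_add, hs, ht]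
  | tmul m n => simp [actAA]

theorem actAA_deltaH_one (x : H) : actAA hact hract cB rB (deltaH hact hract x) (1 ⊗ₜ 1) =
    (Coalgebra.counit x : K) • (1 ⊗ₜ 1) := by
  rw [actAA_deltaH, ← lid_map_counit_comul x]
  generalize Coalgebra.comul (R := K) x = s
  induction s with
  | zero => simp
  | add s t hs ht => simp only [map_add, add_tmul, add_smul, hs, ht]
  | tmul x₁ x₂ => simp [hact.act_one, smul_tmul', smul_smul, mul_comm]

/-- If `B` acts on `M` by its counit, then it acts on `M ⊗ A` by its counit, along `deltaB`. -/
theorem pairRep_repA_deltaB (hψ : IsRightComoduleCoalgebra ψ) {M : Type*} [AddCommGroup M]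
    [Module K M] {T : Smash hact hract →ₗ[K] Module.End K M}
    (hB : ∀ b m, T (inB hact hract b) m = (Coalgebra.counit b : K) • m) (b : B) (z : M ⊗[K] A) :
    pairRep T (repA hact hract cB rB).toLinearMap (deltaB hact hract ψ b) z =
      (Coalgebra.counit b : K) • z := by
  rw [deltaB, conv_apply, ← lid_map_counit_comul b]
  generalize Coalgebra.comul (R := K) b = r
  induction r with
  | zero => simp
  | add s t hs ht => simp only [map_add, add_smul, LinearMap.add_apply, hs, ht]
  | tmul b₁ b₂ =>
  induction z with
  | zero => simp
  | add s t hs ht => simp only [map_add, smul_add, hs, ht]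
  | tmul m n =>
  have key (p : B ⊗[K] H) : pairRep T (repA hact hract cB rB).toLinearMap
      (midB hact hract p * sndB hact hract b₂) (m ⊗ₜ n) = m ⊗ₜ act (TensorProduct.lid K H
        ((Coalgebra.counit (R := K) (A := B)).rTensor H p)) ((Coalgebra.counit b₂ : K) • n) := by
    induction p with
    | zero => simp
    | add s t hs ht =>
      simp only [map_add, add_mul, tmul_add, LinearMap.add_apply, hs, ht]
    | tmul d k => simp [hB, smul_tmul', smul_smul]
  exact (key (ψ b₁)).trans (by simp [hψ.coact_counit, hact.one_act, smul_smul, mul_comm])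

theorem actAA_deltaB (hψ : IsRightComoduleCoalgebra ψ) (b : B) (z : A ⊗[K] A) :
    actAA hact hract cB rB (deltaB hact hract ψ b) z = (Coalgebra.counit b : K) • z :=
  pairRep_repA_deltaB hact hract cB rB hψ (repA_inB hact hract cB rB) b z

set_option synthInstance.maxHeartbeats 100000 in
/-- For `s = Δ a` and `t = Δ a'` the right-hand side is the one of `LeftBraidedComulMul`. -/
theorem actAA_mulMap_midA (s t : A ⊗[K] A) :
    actAA hact hract cB rB (mulMap (fstA hact hract).toLinearMap
      ((midA hact hract).toLinearMap ∘ₗ ρ) s) t =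
    (LinearMap.mul' K A).rTensor A ((TensorProduct.assoc K A A A).symm
      ((TensorProduct.map (TensorProduct.lift act) (LinearMap.mul' K A) ∘ₗ
          (TensorProduct.tensorTensorTensorComm K H A A A).toLinearMap).lTensor A
        (TensorProduct.assoc K A (H ⊗[K] A) (A ⊗[K] A) (ρ.lTensor A s ⊗ₜ[K] t)))) := by
  induction s with
  | zero => simp
  | add s t hs ht => simp only [map_add, add_tmul, LinearMap.add_apply, hs, ht]
  | tmul a₁ a₂ =>
  simp only [mulMap_tmul, LinearMap.comp_apply, LinearMap.lTensor_tmul]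
  generalize ρ a₂ = p
  induction p with
  | zero => simp
  | add s t hs ht =>
    simp only [map_add, mul_add, tmul_add, add_tmul, LinearMap.add_apply, hs, ht]
  | tmul h c =>
  induction t with
  | zero => simp
  | add s t hs ht => simp only [map_add, tmul_add, hs, ht]
  | tmul m n => simp [actAA]

variable [Coalgebra K A]

theorem actAA_deltaA (hρ : IsLeftComoduleCoalgebra ρ) (a : A) :
    actAA hact hract cB rB (deltaA hact hract ρ a) (1 ⊗ₜ 1) = Coalgebra.comul (R := K) a := by
  rw [deltaA, conv_apply]
  generalize Coalgebra.comul (R := K) a = s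
  induction s with
  | zero => simp
  | add s t hs ht => simp only [map_add, LinearMap.add_apply, hs, ht]
  | tmul a₁ a₂ =>
  have key (p : H ⊗[K] A) : actAA hact hract cB rB (fstA hact hract a₁ * midA hact hract p)
      (1 ⊗ₜ 1) =
        a₁ ⊗ₜ TensorProduct.lid K A ((Coalgebra.counit (R := K) (A := H)).rTensor A p) := by
    induction p with
    | zero => simp
    | add s t hs ht => simp only [map_add, mul_add, tmul_add, LinearMap.add_apply, hs, ht]
    | tmul h c => simp [actAA, hact.act_one, smul_tmul']
  exact (key (ρ a₂)).trans (by rw [hρ.counit_coact])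

end Left

section LeftH

variable [Coalgebra K A] [Coalgebra K B] (cA : CounitIsAlgebraMap K A)
  (cB : CounitIsAlgebraMap K B) (lA : LeftCounitAct act) (rB : RightCounitAct ract)

/-- The action of the tensor square of `A # H # B` on `H ⊗ A`. -/
def actHA : Smash hact hract ⊗[K] Smash hact hract →ₗ[K] Module.End K (H ⊗[K] A) :=
  pairRep (leftRepH hact hract cA cB lA rB).toLinearMap (repA hact hract cB rB).toLinearMap

theorem actHA_mul (z z' : Smash hact hract ⊗[K] Smash hact hract) :
    actHA hact hract cA cB lA rB (z * z') =
      actHA hact hract cA cB lA rB z * actHA hact hract cA cB lA rB z' :=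
  pairRep_mul (map_mul (leftRepH hact hract cA cB lA rB)) (map_mul (repA hact hract cB rB)) _ _

theorem actHA_deltaA (a : A) (z : H ⊗[K] A) :
    actHA hact hract cA cB lA rB (deltaA hact hract ρ a) z = ρ a * z := by
  have key (s : A ⊗[K] A) : actHA hact hract cA cB lA rB (mulMap (fstA hact hract).toLinearMap
      ((midA hact hract).toLinearMap ∘ₗ ρ) s) z =
      ρ (TensorProduct.lid K A ((Coalgebra.counit (R := K) (A := A)).rTensor A s)) * z := by
    induction s with
    | zero => simp
    | add s t hs ht => simp only [map_add, add_mul, LinearMap.add_apply, hs, ht]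
    | tmul a₁ a₂ =>
    simp only [mulMap_tmul, LinearMap.comp_apply, LinearMap.rTensor_tmul, TensorProduct.lid_tmul,
      map_smul]
    generalize ρ a₂ = p
    induction p with
    | zero => simp
    | add s t hs ht =>
      simp only [map_add, mul_add, add_mul, smul_add, LinearMap.add_apply, hs, ht]
    | tmul h c =>
    induction z with
    | zero => simp
    | add s t hs ht => simp only [map_add, mul_add, hs, ht]
    | tmul m n => simp [actHA, smul_tmul']
  rw [deltaA, conv_apply, key, Coalgebra.rTensor_counit_comul]
  simp

theorem actHA_deltaH (x : H) (t : H ⊗[K] A) :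
    actHA hact hract cA cB lA rB (deltaH hact hract x) t =
      TensorProduct.map (LinearMap.mul' K H) (TensorProduct.lift act)
      (TensorProduct.tensorTensorTensorComm K H H H A (Coalgebra.comul (R := K) x ⊗ₜ[K] t)) := by
  rw [← AlgHom.toLinearMap_apply, toLinearMap_deltaH, conv_apply]
  generalize Coalgebra.comul (R := K) x = s
  induction s with
  | zero => simp
  | add s t hs ht => simp only [map_add, add_tmul, LinearMap.add_apply, hs, ht]
  | tmul x₁ x₂ =>
  induction t with
  | zero => simp
  | add s t hs ht => simp only [map_add, tmul_add, hs, ht]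
  | tmul m n => simp [actHA]

theorem actHA_deltaH_one (x : H) : actHA hact hract cA cB lA rB (deltaH hact hract x) (1 ⊗ₜ 1) =
    x ⊗ₜ 1 := by
  have key (s : H ⊗[K] H) : TensorProduct.map (LinearMap.mul' K H) (TensorProduct.lift act)
      (TensorProduct.tensorTensorTensorComm K H H H A (s ⊗ₜ[K] (1 ⊗ₜ 1))) =
      TensorProduct.rid K H ((Coalgebra.counit (R := K) (A := H)).lTensor H s) ⊗ₜ 1 := by
    induction s with
    | zero => simp
    | add s t hs ht => simp only [map_add, add_tmul, hs, ht]
    | tmul x₁ x₂ => simp [hact.act_one, smul_tmul']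
  rw [actHA_deltaH, key, Coalgebra.lTensor_counit_comul]
  simp

theorem actHA_deltaB (hψ : IsRightComoduleCoalgebra ψ) (b : B) (z : H ⊗[K] A) :
    actHA hact hract cA cB lA rB (deltaB hact hract ψ b) z = (Coalgebra.counit b : K) • z :=
  pairRep_repA_deltaB hact hract cB rB hψ (leftRepH_inB hact hract cA cB lA rB) b z

end LeftH

section Right

variable [Coalgebra K A] (cA : CounitIsAlgebraMap K A) (lA : LeftCounitAct act)

/-- The right action of the tensor square of `A # H # B` on `B ⊗ B`. -/
def ractBB : Smash hact hract ⊗[K] Smash hact hract →ₗ[K] Module.End K (B ⊗[K] B) :=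
  pairRep (rightRepB hact hract cA lA) (rightRepB hact hract cA lA)

theorem ractBB_mul (z z' : Smash hact hract ⊗[K] Smash hact hract) :
    ractBB hact hract cA lA (z * z') =
      ractBB hact hract cA lA z' * ractBB hact hract cA lA z :=
  pairRep_antimul (rightRepB_mul hact hract cA lA) (rightRepB_mul hact hract cA lA) _ _

theorem ractBB_deltaH (x : H) (t : B ⊗[K] B) :
    ractBB hact hract cA lA (deltaH hact hract x) t =
      TensorProduct.map (TensorProduct.lift ract) (TensorProduct.lift ract)
      (TensorProduct.tensorTensorTensorComm K B B H H (t ⊗ₜ[K] Coalgebra.comul (R := K) x)) := by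
  rw [← AlgHom.toLinearMap_apply, toLinearMap_deltaH, conv_apply]
  generalize Coalgebra.comul (R := K) x = s
  induction s with
  | zero => simp
  | add s t hs ht => simp only [map_add, tmul_add, LinearMap.add_apply, hs, ht]
  | tmul x₁ x₂ =>
  induction t with
  | zero => simp
  | add s t hs ht => simp only [map_add, add_tmul, hs, ht]
  | tmul m n => simp [ractBB]

theorem ractBB_deltaH_one (x : H) : ractBB hact hract cA lA (deltaH hact hract x) (1 ⊗ₜ 1) =
    (Coalgebra.counit x : K) • (1 ⊗ₜ 1) := by
  rw [ractBB_deltaH, ← lid_map_counit_comul x]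
  generalize Coalgebra.comul (R := K) x = s
  induction s with
  | zero => simp
  | add s t hs ht => simp only [map_add, tmul_add, add_smul, hs, ht]
  | tmul x₁ x₂ => simp [hract.one_act, smul_tmul', smul_smul, mul_comm]

/-- If `A` acts on `N` by its counit, then it acts on `B ⊗ N` by its counit, along `deltaA`. -/
theorem pairRep_rightRepB_deltaA (hρ : IsLeftComoduleCoalgebra ρ) {N : Type*} [AddCommGroup N]
    [Module K N] {T : Smash hact hract →ₗ[K] Module.End K N}
    (hA : ∀ a n, T (inA hact hract a) n = (Coalgebra.counit a : K) • n) (a : A) (z : B ⊗[K] N) :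
    pairRep (rightRepB hact hract cA lA) T (deltaA hact hract ρ a) z =
      (Coalgebra.counit a : K) • z := by
  rw [deltaA, conv_apply, ← lid_map_counit_comul a]
  generalize Coalgebra.comul (R := K) a = r
  induction r with
  | zero => simp
  | add s t hs ht => simp only [map_add, add_smul, LinearMap.add_apply, hs, ht]
  | tmul a₁ a₂ =>
  induction z with
  | zero => simp
  | add s t hs ht => simp only [map_add, smul_add, hs, ht]
  | tmul m n =>
  have key (p : H ⊗[K] A) : pairRep (rightRepB hact hract cA lA) T
      (fstA hact hract a₁ * midA hact hract p) (m ⊗ₜ n) =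
      ract ((Coalgebra.counit a₁ : K) • m) (TensorProduct.rid K H
        ((Coalgebra.counit (R := K) (A := A)).lTensor H p)) ⊗ₜ n := by
    induction p with
    | zero => simp
    | add s t hs ht =>
      simp only [map_add, mul_add, add_tmul, LinearMap.add_apply, hs, ht]
    | tmul h c => simp [hA, rightRepB_mul, smul_tmul', smul_smul, mul_comm]
  exact (key (ρ a₂)).trans (by
    simp [hρ.coact_counit, hract.act_one, smul_tmul', smul_smul, mul_comm])

theorem ractBB_deltaA (hρ : IsLeftComoduleCoalgebra ρ) (a : A) (z : B ⊗[K] B) :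
    ractBB hact hract cA lA (deltaA hact hract ρ a) z = (Coalgebra.counit a : K) • z :=
  pairRep_rightRepB_deltaA hact hract cA lA hρ (rightRepB_inA hact hract cA lA) a z

set_option synthInstance.maxHeartbeats 100000 in
/-- For `t = Δ b` and `s = Δ b'` the right-hand side is the one of `RightBraidedComulMul`. -/
theorem ractBB_mulMap_midB (t s : B ⊗[K] B) :
    ractBB hact hract cA lA (mulMap ((midB hact hract).toLinearMap ∘ₗ ψ)
      (sndB hact hract).toLinearMap s) t =
    (LinearMap.mul' K B).lTensor B (TensorProduct.assoc K B B B
      ((TensorProduct.map (LinearMap.mul' K B) (TensorProduct.lift ract) ∘ₗ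
          (TensorProduct.tensorTensorTensorComm K B B B H).toLinearMap).rTensor B
        ((TensorProduct.assoc K (B ⊗[K] B) (B ⊗[K] H) B).symm
          (t ⊗ₜ[K] ψ.rTensor B s)))) := by
  induction s with
  | zero => simp
  | add s t hs ht => simp only [map_add, tmul_add, LinearMap.add_apply, hs, ht]
  | tmul b₁ b₂ =>
  simp only [mulMap_tmul, LinearMap.comp_apply, LinearMap.rTensor_tmul]
  generalize ψ b₁ = p
  induction p with
  | zero => simp
  | add s t hs ht =>
    simp only [map_add, add_mul, tmul_add, add_tmul, LinearMap.add_apply, hs, ht]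
  | tmul d k =>
  induction t with
  | zero => simp
  | add s t hs ht => simp only [map_add, add_tmul, hs, ht]
  | tmul m n => simp [ractBB, rightRepB_mul]

variable [Coalgebra K B]

theorem ractBB_deltaB (hψ : IsRightComoduleCoalgebra ψ) (b : B) :
    ractBB hact hract cA lA (deltaB hact hract ψ b) (1 ⊗ₜ 1) = Coalgebra.comul (R := K) b := by
  rw [deltaB, conv_apply]
  generalize Coalgebra.comul (R := K) b = s
  induction s with
  | zero => simp
  | add s t hs ht => simp only [map_add, LinearMap.add_apply, hs, ht]
  | tmul b₁ b₂ =>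
  have key (p : B ⊗[K] H) : ractBB hact hract cA lA (midB hact hract p * sndB hact hract b₂)
      (1 ⊗ₜ 1) =
        TensorProduct.rid K B ((Coalgebra.counit (R := K) (A := H)).lTensor B p) ⊗ₜ b₂ := by
    induction p with
    | zero => simp
    | add s t hs ht => simp only [map_add, add_mul, add_tmul, LinearMap.add_apply, hs, ht]
    | tmul d k => simp [ractBB, rightRepB_mul, hract.one_act, smul_tmul']
  exact (key (ψ b₁)).trans (by rw [hψ.counit_coact])

end Right

section RightH

variable [Coalgebra K A] [Coalgebra K B] (cA : CounitIsAlgebraMap K A)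
  (cB : CounitIsAlgebraMap K B) (lA : LeftCounitAct act) (rB : RightCounitAct ract)

/-- The right action of the tensor square of `A # H # B` on `B ⊗ H`. -/
def ractBH : Smash hact hract ⊗[K] Smash hact hract →ₗ[K] Module.End K (B ⊗[K] H) :=
  pairRep (rightRepB hact hract cA lA) (rightRepH hact hract cA cB lA rB)

theorem ractBH_mul (z z' : Smash hact hract ⊗[K] Smash hact hract) :
    ractBH hact hract cA cB lA rB (z * z') =
      ractBH hact hract cA cB lA rB z' * ractBH hact hract cA cB lA rB z :=
  pairRep_antimul (rightRepB_mul hact hract cA lA) (rightRepH_mul hact hract cA cB lA rB) _ _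

theorem ractBH_deltaB (b : B) (z : B ⊗[K] H) :
    ractBH hact hract cA cB lA rB (deltaB hact hract ψ b) z = z * ψ b := by
  have key (s : B ⊗[K] B) : ractBH hact hract cA cB lA rB
      (mulMap ((midB hact hract).toLinearMap ∘ₗ ψ) (sndB hact hract).toLinearMap s) z =
      z * ψ (TensorProduct.rid K B ((Coalgebra.counit (R := K) (A := B)).lTensor B s)) := by
    induction s with
    | zero => simp
    | add s t hs ht => simp only [map_add, mul_add, LinearMap.add_apply, hs, ht]
    | tmul b₁ b₂ =>
    simp only [mulMap_tmul, LinearMap.comp_apply, LinearMap.lTensor_tmul, TensorProduct.rid_tmul,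
      map_smul]
    generalize ψ b₁ = p
    induction p with
    | zero => simp
    | add s t hs ht =>
      simp only [map_add, mul_add, add_mul, smul_add, LinearMap.add_apply, hs, ht]
    | tmul d k =>
    induction z with
    | zero => simp
    | add s t hs ht => simp only [map_add, add_mul, hs, ht]
    | tmul m n => simp [ractBH, rightRepH_mul]
  rw [deltaB, conv_apply, key, Coalgebra.lTensor_counit_comul]
  simp

theorem ractBH_deltaH (x : H) (t : B ⊗[K] H) :
    ractBH hact hract cA cB lA rB (deltaH hact hract x) t =
      TensorProduct.map (TensorProduct.lift ract) (LinearMap.mul' K H)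
      (TensorProduct.tensorTensorTensorComm K B H H H (t ⊗ₜ[K] Coalgebra.comul (R := K) x)) := by
  rw [← AlgHom.toLinearMap_apply, toLinearMap_deltaH, conv_apply]
  generalize Coalgebra.comul (R := K) x = s
  induction s with
  | zero => simp
  | add s t hs ht => simp only [map_add, tmul_add, LinearMap.add_apply, hs, ht]
  | tmul x₁ x₂ =>
  induction t with
  | zero => simp
  | add s t hs ht => simp only [map_add, add_tmul, hs, ht]
  | tmul m n => simp [ractBH]

theorem ractBH_deltaH_one (x : H) :
    ractBH hact hract cA cB lA rB (deltaH hact hract x) (1 ⊗ₜ 1) = 1 ⊗ₜ x := by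
  have key (s : H ⊗[K] H) : TensorProduct.map (TensorProduct.lift ract) (LinearMap.mul' K H)
      (TensorProduct.tensorTensorTensorComm K B H H H ((1 ⊗ₜ 1) ⊗ₜ[K] s)) =
      1 ⊗ₜ TensorProduct.lid K H ((Coalgebra.counit (R := K) (A := H)).rTensor H s) := by
    induction s with
    | zero => simp
    | add s t hs ht => simp only [map_add, tmul_add, hs, ht]
    | tmul x₁ x₂ => simp [hract.one_act, smul_tmul']
  rw [ractBH_deltaH, key, Coalgebra.rTensor_counit_comul]
  simp

theorem ractBH_deltaA (hρ : IsLeftComoduleCoalgebra ρ) (a : A) (z : B ⊗[K] H) :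
    ractBH hact hract cA cB lA rB (deltaA hact hract ρ a) z = (Coalgebra.counit a : K) • z :=
  pairRep_rightRepB_deltaA hact hract cA lA hρ (rightRepH_inA hact hract cA cB lA rB) a z

end RightH

section Mixed

variable [Coalgebra K A] [Coalgebra K B] (cA : CounitIsAlgebraMap K A)
  (cB : CounitIsAlgebraMap K B) (lA : LeftCounitAct act) (rB : RightCounitAct ract)

/-- The map `w ⊗ w' ↦ (1 ◁ w) ⊗ (w' ▷ 1)` from the tensor square of `A # H # B` to `B ⊗ A`. -/
def evalOne : Smash hact hract ⊗[K] Smash hact hract →ₗ[K] B ⊗[K] A :=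
  TensorProduct.map ((rightRepB hact hract cA lA).flip 1)
    ((repA hact hract cB rB).toLinearMap.flip 1)

theorem evalOne_deltaA_mul_deltaB (hρ : IsLeftComoduleCoalgebra ρ)
    (hψ : IsRightComoduleCoalgebra ψ) (a : A) (b : B) :
    evalOne hact hract cA cB lA rB (deltaA hact hract ρ a * deltaB hact hract ψ b) = b ⊗ₜ a := by
  -- the result is `(b₁)₍₀₎ ⊗ (a₂)₀` with the counits of `a₁`, `(a₂)₋₁`, `(b₁)₍₁₎` and `b₂`
  have key (s : A ⊗[K] A) (r : B ⊗[K] B) : evalOne hact hract cA cB lA rB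
      (mulMap (fstA hact hract).toLinearMap ((midA hact hract).toLinearMap ∘ₗ ρ) s *
        mulMap ((midB hact hract).toLinearMap ∘ₗ ψ) (sndB hact hract).toLinearMap r) =
      TensorProduct.rid K B ((Coalgebra.counit (R := K) (A := B)).lTensor B r) ⊗ₜ
        TensorProduct.lid K A ((Coalgebra.counit (R := K) (A := A)).rTensor A s) := by
    induction s with
    | zero => simp
    | add s t hs ht => simp only [map_add, add_mul, tmul_add, hs, ht]
    | tmul a₁ a₂ =>
    induction r with
    | zero => simp
    | add s t hs ht => simp only [map_add, mul_add, add_tmul, hs, ht]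
    | tmul b₁ b₂ =>
    have key' (p : H ⊗[K] A) (q : B ⊗[K] H) : evalOne hact hract cA cB lA rB
        ((fstA hact hract a₁ * midA hact hract p) * (midB hact hract q * sndB hact hract b₂)) =
        ((Coalgebra.counit b₂ : K) * Coalgebra.counit a₁) •
          (TensorProduct.rid K B ((Coalgebra.counit (R := K) (A := H)).lTensor B q) ⊗ₜ
            TensorProduct.lid K A ((Coalgebra.counit (R := K) (A := H)).rTensor A p)) := by
      induction p with
      | zero => simp
      | add s t hs ht => simp only [map_add, add_mul, mul_add, tmul_add, smul_add, hs, ht]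
      | tmul h c =>
      induction q with
      | zero => simp
      | add s t hs ht => simp only [map_add, add_mul, mul_add, add_tmul, smul_add, hs, ht]
      | tmul d k =>
        simp [evalOne, rightRepB_mul, hact.act_one, hract.one_act, smul_tmul', smul_smul]
        congr 2
        ring
    refine (key' (ρ a₂) (ψ b₁)).trans ?_
    rw [hρ.counit_coact, hψ.counit_coact]
    simp [smul_tmul', smul_smul, mul_comm]
  rw [deltaA, deltaB, conv_apply, conv_apply, key, Coalgebra.rTensor_counit_comul,
    Coalgebra.lTensor_counit_comul]
  simp

/-- In the other order, evaluation at `1` gives the left-hand side of Majid's condition. -/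
theorem evalOne_deltaB_mul_deltaA (a : A) (b : B) :
    evalOne hact hract cA cB lA rB (deltaB hact hract ψ b * deltaA hact hract ρ a) =
      TensorProduct.comm K A B (TensorProduct.map (TensorProduct.lift act) (TensorProduct.lift ract)
      (TensorProduct.comm K (B ⊗[K] H) (H ⊗[K] A)
        (TensorProduct.tensorTensorTensorComm K B H H A (ψ b ⊗ₜ[K] ρ a)))) := by
  have key (s : A ⊗[K] A) (r : B ⊗[K] B) : evalOne hact hract cA cB lA rB
      (mulMap ((midB hact hract).toLinearMap ∘ₗ ψ) (sndB hact hract).toLinearMap r *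
        mulMap (fstA hact hract).toLinearMap ((midA hact hract).toLinearMap ∘ₗ ρ) s) =
      TensorProduct.comm K A B (TensorProduct.map (TensorProduct.lift act) (TensorProduct.lift ract)
        (TensorProduct.comm K (B ⊗[K] H) (H ⊗[K] A) (TensorProduct.tensorTensorTensorComm K B H H A
          (ψ (TensorProduct.rid K B ((Coalgebra.counit (R := K) (A := B)).lTensor B r)) ⊗ₜ[K]
          ρ (TensorProduct.lid K A ((Coalgebra.counit (R := K) (A := A)).rTensor A s)))))) := by
    induction s with
    | zero => simp
    | add s t hs ht => simp only [map_add, mul_add, tmul_add, hs, ht]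
    | tmul a₁ a₂ =>
    induction r with
    | zero => simp
    | add s t hs ht => simp only [map_add, add_mul, add_tmul, hs, ht]
    | tmul b₁ b₂ =>
    simp only [mulMap_tmul, LinearMap.comp_apply, LinearMap.lTensor_tmul, LinearMap.rTensor_tmul,
      TensorProduct.rid_tmul, TensorProduct.lid_tmul, map_smul]
    generalize ρ a₂ = p
    generalize ψ b₁ = q
    induction p with
    | zero => simp
    | add s t hs ht => simp only [map_add, mul_add, tmul_add, smul_add, hs, ht]
    | tmul h c =>
    induction q with
    | zero => simp
    | add s t hs ht => simp only [map_add, add_mul, add_tmul, smul_add, hs, ht]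
    | tmul d k =>
      simp [evalOne, rightRepB_mul, smul_tmul', smul_smul, mul_comm]
  rw [deltaA, deltaB, conv_apply, conv_apply, key, Coalgebra.rTensor_counit_comul,
    Coalgebra.lTensor_counit_comul]
  simp

end Mixed

end Smash

end

/-! ### Necessity of the conditions -/

section

variable {K H A B : Type*} [Field K] [Ring H] [Bialgebra K H]
  [Ring A] [Algebra K A] [Coalgebra K A] [Ring B] [Algebra K B] [Coalgebra K B]
  {act : H →ₗ[K] A →ₗ[K] A} {ract : B →ₗ[K] H →ₗ[K] B}
  {ρ : A →ₗ[K] H ⊗[K] A} {ψ : B →ₗ[K] B ⊗[K] H}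

namespace Smash

variable (hact : IsLeftModuleAlgebra act) (hract : IsRightModuleAlgebra ract)

/-- If the smash coproduct is an algebra map and the counits of `A` and `B` are multiplicative and
`H`-linear, then all the conditions hold. -/
theorem smashConditions_of_comul (cA : CounitIsAlgebraMap K A) (cB : CounitIsAlgebraMap K B)
    (lA : LeftCounitAct act) (rB : RightCounitAct ract) (hρ : IsLeftComoduleCoalgebra ρ)
    (hψ : IsRightComoduleCoalgebra ψ)
    (Δ : Smash hact hract →ₐ[K] Smash hact hract ⊗[K] Smash hact hract)
    (hΔ : ∀ a x b, Δ (of hact hract (a ⊗ₜ (x ⊗ₜ b))) =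
      deltaA hact hract ρ a * (deltaH hact hract x * deltaB hact hract ψ b)) :
    SmashConditions act ρ ract ψ := by
  have hone : deltaA hact hract ρ 1 * deltaB hact hract ψ 1 = 1 := by
    simpa [of_tmul] using (hΔ 1 1 1).symm
  have oneA : (actAA hact hract cB rB) 1 = 1 :=
    TensorProduct.ext' fun m n => by simp [actAA, Algebra.TensorProduct.one_def]
  have oneHA : (actHA hact hract cA cB lA rB) 1 = 1 :=
    TensorProduct.ext' fun m n => by simp [actHA, Algebra.TensorProduct.one_def]
  have oneB : (ractBB hact hract cA lA) 1 = 1 :=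
    TensorProduct.ext' fun m n => by simp [ractBB, Algebra.TensorProduct.one_def]
  have oneBH : (ractBH hact hract cA cB lA rB) 1 = 1 :=
    TensorProduct.ext' fun m n => by simp [ractBH, Algebra.TensorProduct.one_def]
  -- `Δ 1 = 1` only says that the product of `deltaA 1` and `deltaB 1` is `1`; the actions on which
  -- one of the two factors is trivial separate them
  have comulA : ComulOne K A := by
    have e := congrArg (fun w => actAA hact hract cB rB w (1 ⊗ₜ 1)) hone
    simp only [actAA_mul, Module.End.mul_apply, actAA_deltaB hact hract cB rB hψ, cB.1, one_smul,
      actAA_deltaA hact hract cB rB hρ, oneA, Module.End.one_apply] at e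
    exact e
  have comulB : ComulOne K B := by
    have e := congrArg (fun w => ractBB hact hract cA lA w (1 ⊗ₜ 1)) hone
    simp only [ractBB_mul, Module.End.mul_apply, ractBB_deltaA hact hract cA lA hρ, cA.1,
      one_smul, ractBB_deltaB hact hract cA lA hψ, oneB, Module.End.one_apply] at e
    exact e
  have coactA : LeftCoactOne ρ := by
    have e := congrArg (fun w => actHA hact hract cA cB lA rB w 1) hone
    simp only [actHA_mul, Module.End.mul_apply, actHA_deltaB hact hract cA cB lA rB hψ, cB.1,
      one_smul, actHA_deltaA, oneHA, Module.End.one_apply, mul_one] at e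
    exact e
  have coactB : RightCoactOne ψ := by
    have e := congrArg (fun w => ractBH hact hract cA cB lA rB w 1) hone
    simp only [ractBH_mul, Module.End.mul_apply, ractBH_deltaA hact hract cA cB lA rB hρ, cA.1,
      one_smul, ractBH_deltaB, oneBH, Module.End.one_apply, one_mul] at e
    exact e
  have dA1 : deltaA hact hract ρ 1 = 1 := by
    rw [deltaA, conv_apply, comulA, mulMap_tmul, LinearMap.comp_apply, coactA]
    simp [Algebra.TensorProduct.one_def]
  have dB1 : deltaB hact hract ψ 1 = 1 := by
    rw [deltaB, conv_apply, comulB, mulMap_tmul, LinearMap.comp_apply, coactB]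
    simp [Algebra.TensorProduct.one_def]
  have DA (a : A) : Δ (inA hact hract a) = deltaA hact hract ρ a := by
    rw [inA_apply, hΔ, map_one (deltaH hact hract), dB1, mul_one, mul_one]
  have DH (x : H) : Δ (inH hact hract x) = deltaH hact hract x := by
    rw [inH_apply, hΔ, dA1, dB1, mul_one, one_mul]
  have DB (b : B) : Δ (inB hact hract b) = deltaB hact hract ψ b := by
    rw [inB_apply, hΔ, map_one (deltaH hact hract), dA1, one_mul, one_mul]
  -- the relations of `A # H # B`, transported to the tensor square
  have mulA (a a' : A) : deltaA hact hract ρ (a * a') =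
      deltaA hact hract ρ a * deltaA hact hract ρ a' := by
    simp only [← DA, map_mul]
  have mulB (b b' : B) : deltaB hact hract ψ (b * b') =
      deltaB hact hract ψ b * deltaB hact hract ψ b' := by
    simp only [← DB, map_mul]
  have relA (x : H) (a : A) : deltaH hact hract x * deltaA hact hract ρ a =
      conv (deltaA hact hract ρ ∘ₗ act.flip a) (deltaH hact hract).toLinearMap x := by
    have e := congrArg Δ (leftSmashRel hact hract x a)
    rw [map_mul, map_conv] at e
    rw [← DH, ← DA]
    refine e.trans (congrArg₂ (fun f g => conv f g x) ?_ ?_)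
    · exact LinearMap.ext fun y => DA _
    · exact LinearMap.ext fun y => DH _
  have relB (b : B) (x : H) : deltaB hact hract ψ b * deltaH hact hract x =
      conv (deltaH hact hract).toLinearMap (deltaB hact hract ψ ∘ₗ ract b) x := by
    have e := congrArg Δ (rightSmashRel hact hract b x)
    rw [map_mul, map_conv] at e
    rw [← DH, ← DB]
    refine e.trans (congrArg₂ (fun f g => conv f g x) ?_ ?_)
    · exact LinearMap.ext fun y => DH _
    · exact LinearMap.ext fun y => DB _
  have comm (a : A) (b : B) : deltaA hact hract ρ a * deltaB hact hract ψ b =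
      deltaB hact hract ψ b * deltaA hact hract ρ a := by
    simpa only [map_mul, DA, DB] using congrArg Δ (commute_inA_inB hact hract a b).eq
  refine
    { counitA := cA
      counitB := cB
      comulOneA := comulA
      comulOneB := comulB
      leftCoactOne := coactA
      rightCoactOne := coactB
      leftCounitAct := lA
      rightCounitAct := rB
      leftCoactMul := fun a a' => ?_
      rightCoactMul := fun b b' => ?_
      leftYetterDrinfeld := fun x a => ?_
      rightYetterDrinfeld := fun b x => ?_
      majid := fun a b => ?_
      leftBraided := fun a a' => ?_
      rightBraided := fun b b' => ?_
      leftComulAct := fun x a => ?_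
      rightComulAct := fun b x => ?_ }
  · have e := congrArg (fun w => actHA hact hract cA cB lA rB w 1) (mulA a a')
    simpa only [actHA_mul, Module.End.mul_apply, actHA_deltaA, mul_one] using e
  · have e := congrArg (fun w => ractBH hact hract cA cB lA rB w 1) (mulB b b')
    simpa only [ractBH_mul, Module.End.mul_apply, ractBH_deltaB, one_mul] using e
  · have e := congrArg (fun w => actHA hact hract cA cB lA rB w (1 ⊗ₜ 1)) (relA x a)
    simp only [actHA_mul, Module.End.mul_apply, actHA_deltaA, actHA_deltaH] at e
    rw [← Algebra.TensorProduct.one_def, mul_one] at e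
    refine Eq.trans ?_ e.symm
    rw [conv_apply]
    generalize Coalgebra.comul (R := K) x = t
    induction t with
    | zero => simp
    | add s t hs ht => simp only [map_add, LinearMap.add_apply, hs, ht]
    | tmul y z =>
      simp [actHA_mul, actHA_deltaA, actHA_deltaH_one, Algebra.TensorProduct.one_def]
  · have e := congrArg (fun w => ractBH hact hract cA cB lA rB w (1 ⊗ₜ 1)) (relB b x)
    simp only [ractBH_mul, Module.End.mul_apply, ractBH_deltaB, ractBH_deltaH] at e
    rw [← Algebra.TensorProduct.one_def, one_mul] at e
    refine Eq.trans ?_ e.symm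
    rw [conv_apply]
    generalize Coalgebra.comul (R := K) x = t
    induction t with
    | zero => simp
    | add s t hs ht => simp only [map_add, LinearMap.add_apply, hs, ht]
    | tmul y z =>
      simp [ractBH_mul, ractBH_deltaB, ractBH_deltaH_one, Algebra.TensorProduct.one_def]
  · have e := congrArg (evalOne hact hract cA cB lA rB) (comm a b)
    rw [evalOne_deltaA_mul_deltaB hact hract cA cB lA rB hρ hψ, evalOne_deltaB_mul_deltaA] at e
    exact (TensorProduct.comm K A B).injective e.symm
  · have e := congrArg (fun w => actAA hact hract cB rB w (1 ⊗ₜ 1)) (mulA a a')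
    simp only [actAA_mul, Module.End.mul_apply, actAA_deltaA hact hract cB rB hρ] at e
    rw [e, deltaA, conv_apply, actAA_mulMap_midA]
  · have e := congrArg (fun w => ractBB hact hract cA lA w (1 ⊗ₜ 1)) (mulB b b')
    simp only [ractBB_mul, Module.End.mul_apply, ractBB_deltaB hact hract cA lA hψ] at e
    rw [e, deltaB, conv_apply, ractBB_mulMap_midB]
  · have e := congrArg (fun w => actAA hact hract cB rB w (1 ⊗ₜ 1)) (relA x a)
    simp only [actAA_mul, Module.End.mul_apply, actAA_deltaA hact hract cB rB hρ,
      actAA_deltaH] at e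
    rw [e, conv_apply]
    have key (t : H ⊗[K] H) : actAA hact hract cB rB
        (mulMap (deltaA hact hract ρ ∘ₗ act.flip a) (deltaH hact hract).toLinearMap t) (1 ⊗ₜ 1) =
        Coalgebra.comul (R := K) (act (TensorProduct.rid K H
          ((Coalgebra.counit (R := K) (A := H)).lTensor H t)) a) := by
      induction t with
      | zero => simp
      | add s t hs ht => simp only [map_add, LinearMap.add_apply, hs, ht]
      | tmul y z => simp [actAA_mul, actAA_deltaA hact hract cB rB hρ, actAA_deltaH_one]
    rw [key, Coalgebra.lTensor_counit_comul]
    simp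
  · have e := congrArg (fun w => ractBB hact hract cA lA w (1 ⊗ₜ 1)) (relB b x)
    simp only [ractBB_mul, Module.End.mul_apply, ractBB_deltaB hact hract cA lA hψ,
      ractBB_deltaH] at e
    rw [e, conv_apply]
    have key (t : H ⊗[K] H) : ractBB hact hract cA lA
        (mulMap (deltaH hact hract).toLinearMap (deltaB hact hract ψ ∘ₗ ract b) t) (1 ⊗ₜ 1) =
        Coalgebra.comul (R := K) (ract b (TensorProduct.lid K H
          ((Coalgebra.counit (R := K) (A := H)).rTensor H t))) := by
      induction t with
      | zero => simp
      | add s t hs ht => simp only [map_add, LinearMap.add_apply, hs, ht]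
      | tmul y z => simp [ractBB_mul, ractBB_deltaB hact hract cA lA hψ, ractBB_deltaH_one]
    rw [key, Coalgebra.rTensor_counit_comul]
    simp

end Smash

theorem SmashIsBialgebra.smashConditions (hact : IsLeftModuleAlgebra act)
    (hract : IsRightModuleAlgebra ract) (hρ : IsLeftComoduleCoalgebra ρ)
    (hψ : IsRightComoduleCoalgebra ψ) (hA : (Coalgebra.counit (1 : A) : K) = 1)
    (hB : (Coalgebra.counit (1 : B) : K) = 1) (h : SmashIsBialgebra act ρ ract ψ) :
    SmashConditions act ρ ract ψ := by
  obtain ⟨Δ, ε, hΔ, hε⟩ := h.map_mul hact hract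
  obtain ⟨⟨cA, cB⟩, lA, rB⟩ := counit_conditions hact hract hA hB ε hε
  exact Smash.smashConditions_of_comul hact hract cA cB lA rB hρ hψ Δ fun a x b =>
    (hΔ _).trans (Smash.map_of_smashComul_tmul hact hract ρ ψ a x b)

end

end DoubleBiproduct

end

open DoubleBiproduct in
theorem corollary3p6 {K H A B : Type*} [Field K] [Ring H] [Bialgebra K H]
    [Ring A] [Algebra K A] [Coalgebra K A] [Ring B] [Algebra K B] [Coalgebra K B]
    (act : H →ₗ[K] A →ₗ[K] A) (ρ : A →ₗ[K] H ⊗[K] A)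
    (ract : B →ₗ[K] H →ₗ[K] B) (ψ : B →ₗ[K] B ⊗[K] H)
    (hact : IsLeftModuleAlgebra act) (hρ : IsLeftComoduleCoalgebra ρ)
    (hA : (Coalgebra.counit (1 : A) : K) = 1)
    (hract : IsRightModuleAlgebra ract) (hψ : IsRightComoduleCoalgebra ψ)
    (hB : (Coalgebra.counit (1 : B) : K) = 1) :
    (SmashIsBialgebra act ρ ract ψ ↔
      (CounitIsAlgebraMap K A ∧ CounitIsAlgebraMap K B) ∧
      (ComulOne K A ∧ ComulOne K B) ∧
      (LeftCoactOne ρ ∧ RightCoactOne ψ) ∧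
      (LeftCounitAct act ∧ RightCounitAct ract) ∧
      LeftCoactMul ρ ∧
      RightCoactMul ψ ∧
      LeftYetterDrinfeld act ρ ∧
      RightYetterDrinfeld ract ψ ∧
      MajidCondition act ρ ract ψ ∧
      LeftBraidedComulMul act ρ ∧
      RightBraidedComulMul ract ψ ∧
      LeftComulAct act ∧
      RightComulAct ract) ∧
    (IsLeftYDBialgebra act ρ → IsRightYDBialgebra ract ψ →
      (SmashIsBialgebra act ρ ract ψ ↔ MajidCondition act ρ ract ψ)) := by
  have iff_conditions : SmashIsBialgebra act ρ ract ψ ↔ SmashConditions act ρ ract ψ :=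
    ⟨fun h => h.smashConditions hact hract hρ hψ hA hB,
      fun h => h.smashIsBialgebra hact hract hρ hψ⟩
  refine ⟨iff_conditions.trans ⟨fun h => ?_, fun h => ?_⟩, fun hL hR =>
    iff_conditions.trans ⟨fun h => h.majid, fun h => ?_⟩⟩
  · exact ⟨⟨h.counitA, h.counitB⟩, ⟨h.comulOneA, h.comulOneB⟩,
      ⟨h.leftCoactOne, h.rightCoactOne⟩, ⟨h.leftCounitAct, h.rightCounitAct⟩, h.leftCoactMul,
      h.rightCoactMul, h.leftYetterDrinfeld, h.rightYetterDrinfeld, h.majid, h.leftBraided,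
      h.rightBraided, h.leftComulAct, h.rightComulAct⟩
  · obtain ⟨⟨cA, cB⟩, ⟨uA, uB⟩, ⟨oA, oB⟩, ⟨lA, rB⟩, mA, mB, yA, yB, hM, bA, bB, dA, dB⟩ := h
    exact ⟨cA, cB, uA, uB, oA, oB, lA, rB, mA, mB, yA, yB, hM, bA, bB, dA, dB⟩
  · exact
      { counitA := hL.counit_algebraMap
        counitB := hR.counit_algebraMap
        comulOneA := hL.comul_one
        comulOneB := hR.comul_one
        leftCoactOne := hL.coact_one
        rightCoactOne := hR.coact_one
        leftCounitAct := hL.counit_act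
        rightCounitAct := hR.counit_act
        leftCoactMul := hL.coact_mul
        rightCoactMul := hR.coact_mul
        leftYetterDrinfeld := hL.yetterDrinfeld
        rightYetterDrinfeld := hR.yetterDrinfeld
        majid := h
        leftBraided := hL.comul_mul
        rightBraided := hR.comul_mul
        leftComulAct := hL.comul_act
        rightComulAct := hR.comul_act }
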